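/- **Graph planar algebra.** Let $\Gamma_4$ be the graph with vertices $1,\dots,6$, adjacency (loops included) $1:\{2,6\}$, $2:\{1,2,3,5,6\}$, $3:\{2,3,4,5,6\}$, $4:\{3,5\}$, $5:\{2,3,4,5,6\}$, $6:\{1,2,3,5,6\}$, and Frobenius-Perron vector $\lambda=(2,\delta,\delta,2,\delta,\delta)$, $\delta=2+\sqrt6$. An $n$-path is a sequence of $n+1$ consecutively adjacent vertices; $s(p),t(p)$ are its first and last vertices. $\mathrm{Hom}(m\to n)$ is the complex vector space with basis the pairs $(p,q)$ of an $m$-path $p$ and an $n$-path $q$ with $s(p)=s(q)$, $t(p)=t(q)$. Composition (first $(p,q)$, then $(p',q')$) gives $\delta_{q=p'}(p,q')$; the tensor product is $(p,q)\otimes(p',q')=\delta_{t(p)=s(p')}(pp',qq')$; $\mathrm{ev}=\sum_e\sqrt{\lambda_{t(e)}/\lambda_{s(e)}}\,(e\bar e,s(e))$ and $\mathrm{coev}=\sum_e\sqrt{\lambda_{t(e)}/\lambda_{s(e)}}\,(s(e),e\bar e)$. Planar diagrams are interpreted through these maps, read from bottom to top. $[n]_q=(q^n-q^{-n})/(q-q^{-1})$.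 **The trivalent vertex.** Let $\alpha_1=\sqrt{\tfrac12(1+2\sqrt2+\sqrt3+\sqrt6)}$, $\alpha_2=\sqrt{\tfrac12(-1+\sqrt2+\sqrt3)}$, $\alpha_3=\sqrt{\tfrac32(\sqrt{2+\sqrt3}-1)}$, $\alpha_4=\sqrt{2+\sqrt3-\sqrt{2+\sqrt3}}$, $\alpha_5=\sqrt{\tfrac12(\sqrt{2+\sqrt3}-1)}$, $\alpha_6=\sqrt{\tfrac12(\sqrt3+\sqrt{2+\sqrt3})}$, $\alpha_7=\sqrt{1-\sqrt{3/2}+1/\sqrt2}$, and $\alpha_8,\alpha_9=\tfrac12\bigl(\sqrt{1+\sqrt{6-3\sqrt3}}\mp\sqrt{\sqrt{2+\sqrt3}-1}\bigr)$ ($-$ for $\alpha_8$, $+$ for $\alpha_9$). Let $T\in\mathrm{Hom}(2\to1)$ have coordinate $T^{(i)}_{jk}$ at $((i,j,k),(i,k))$, where $$\begin{gathered} T^{(1)}=\begin{pmatrix}0 & 0 & 0 & 0 & 0 & 0 \\ 0 & \alpha_1 & 0 & 0 & 0 & \alpha_2 \\ 0 & 0 & 0 & 0 & 0 & 0 \\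 0 & 0 & 0 & 0 & 0 & 0 \\ 0 & 0 & 0 & 0 & 0 & 0 \\ 0 & \alpha_2 & 0 & 0 & 0 & \alpha_1\end{pmatrix},\\ T^{(2)}=\begin{pmatrix}0 & \alpha_4 & 0 & 0 & 0 & \alpha_7 \\ \alpha_1 & -\alpha_3 & -\alpha_8 & 0 & \alpha_9 & -\alpha_5 \\ 0 & -\alpha_8 & \alpha_9 & 0 & \alpha_6 & -\alpha_6 \\ 0 & 0 & 0 & 0 & 0 & 0 \\ 0 & \alpha_9 & \alpha_6 & 0 & -\alpha_8 & -\alpha_6 \\ \alpha_2 & -\alpha_5 & -\alpha_6 & 0 & -\alpha_6 & -\alpha_5\end{pmatrix},\\ T^{(3)}=\begin{pmatrix}0 & 0 & 0 & 0 & 0 & 0 \\ 0 & -\alpha_8 & \alpha_9 & 0 & \alpha_6 & -\alpha_6 \\ 0 & \alpha_9 & -\alpha_3 & \alpha_1 & -\alpha_5 & -\alpha_8 \\ 0 & 0 & \alpha_4 & 0 & \alpha_7 & 0 \\ 0 & \alpha_6 & -\alpha_5 & \alpha_2 & -\alpha_5 & -\alpha_6 \\ 0 & -\alpha_6 & -\alpha_8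 & 0 & -\alpha_6 & \alpha_9\end{pmatrix},\\ T^{(4)}=\begin{pmatrix}0 & 0 & 0 & 0 & 0 & 0 \\ 0 & 0 & 0 & 0 & 0 & 0 \\ 0 & 0 & \alpha_1 & 0 & \alpha_2 & 0 \\ 0 & 0 & 0 & 0 & 0 & 0 \\ 0 & 0 & \alpha_2 & 0 & \alpha_1 & 0 \\ 0 & 0 & 0 & 0 & 0 & 0\end{pmatrix},\\ T^{(5)}=\begin{pmatrix}0 & 0 & 0 & 0 & 0 & 0 \\ 0 & \alpha_9 & \alpha_6 & 0 & -\alpha_8 & -\alpha_6 \\ 0 & \alpha_6 & -\alpha_5 & \alpha_2 & -\alpha_5 & -\alpha_6 \\ 0 & 0 & \alpha_7 & 0 & \alpha_4 & 0 \\ 0 & -\alpha_8 & -\alpha_5 & \alpha_1 & -\alpha_3 & \alpha_9 \\ 0 & -\alpha_6 & -\alpha_6 & 0 & \alpha_9 & -\alpha_8\end{pmatrix},\\ T^{(6)}=\begin{pmatrix}0 & \alpha_7 & 0 & 0 & 0 & \alpha_4 \\ \alpha_2 & -\alpha_5 & -\alpha_6 & 0 & -\alpha_6 & -\alpha_5 \\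 0 & -\alpha_6 & -\alpha_8 & 0 & -\alpha_6 & \alpha_9 \\ 0 & 0 & 0 & 0 & 0 & 0 \\ 0 & -\alpha_6 & -\alpha_6 & 0 & \alpha_9 & -\alpha_8 \\ \alpha_1 & -\alpha_5 & \alpha_9 & 0 & -\alpha_8 & -\alpha_3\end{pmatrix}. \end{gathered}$$ **The element $P_4$.** Let $s=\sqrt{\sqrt6-2}$, $h=\sqrt{\delta/2}$, $e=e^{\pi i/4}$, $\zeta=\sqrt{1-c}+i\sqrt c$ with $c=\cos(\pi/12)$. Put $u^{11}=(0,h,0,0,0,-h)$, $u^{44}=(0,0,h,0,-h,0)$, $u^{26}=(s,e,-\bar\zeta,0,-\zeta,\bar e)$, $u^{35}=(0,\zeta,e,s,\bar e,-\bar\zeta)$, $u^{62}=\overline{u^{26}}$, $u^{53}=\overline{u^{35}}$, and $u^{ab}=0$ otherwise. $P_4\in\mathrm{Hom}(2\to2)$ has coordinate $u^{ab}_x\overline{u^{ab}_y}$ at $((a,x,b),(a,y,b))$. It is the image of the diagram consisting of a cup above a cap, joined by a vertical red strand that points up. The diagram of two vertical black strands joined by a horizontal red strand is its rotation by one click. **Diagram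 conventions.** For diagrams with $n$ boundary points numbered clockwise $1,\dots,n$ (all at the top, from left to right), $\mathrm{Right}$ is the clockwise rotation by one click, moving boundary point $i$ to $i+1$. $\mathrm{Dec}_i$ ($1\le i\le n$) joins the legs $i$ and $i+1$ (legs $n$ and $1$ if $i=n$) by a red strand, oriented clockwise, near the boundary; $\mathrm{Dec}_0$ is the identity operation. Write $Y$ for the vertex $T$ with its three legs at the top. Let $H$ be the tree with two vertices that carry the legs $1,2$ and $3,4$; $H'=\mathrm{Right}(H)$; $\mathrm{tree}$ the tree with three vertices that carry the legs $\{1,2\}$, $\{3\}$, $\{4,5\}$; $\mathrm{forest}$ a strand joining $1,2$ next to a vertex with legs $3,4,5$. Let $A$ be the diagram of two arcs $12$ and $34$, $A'$ the one of two arcs $14$ and $23$, and $A_r,A'_r$ these diagrams with their two arcs joined by a red strand ($A_r$ is $P_4$ with all boundary points bent to the top, and $A'_r$ is its rotation). **Theorem.** Let $q=q_4=e^{2\pi i/48}$. Then $T$ and $P_4$ satisfy all of the following defining relations of $\mathcal D_4$ in $\mathrm{GPA}(\Gamma_4)$. 1. The relations of $\mathcal G_2(q)$: (Loop) a closed loop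 equals $q^{10}+q^8+q^2+1+q^{-2}+q^{-8}+q^{-10}$; (Lollipop) $T\circ\mathrm{coev}=0$; (Rotate) $\mathrm{Right}(Y)=Y$; (Bigon) a bigon equals $[7]_q-1$ times a strand; (Trigon) a trigon equals $-(q^4+1+q^{-4})Y$; (Tetragon) a tetragon equals $(q^2+q^{-2})(H+H')+(q^2+1+q^{-2})(A+A')$; (Pentagon) a pentagon equals $-\sum_{j=0}^4\mathrm{Right}^j(\mathrm{tree})-\sum_{j=0}^4\mathrm{Right}^j(\mathrm{forest})$. 2. (Recouple) $P_4$ next to $P_4$ rotated by $180^\circ$ (a red strand up next to a red strand down) equals the diagram with the two caps at the bottom joined by a red strand to the right and the two cups at the top joined by a red strand to the left. 3. (Reverse) $P_4$ rotated by $180^\circ$, that is, with its red strand reversed, equals $P_4$. 4. (Schur 0) capping $P_4$ off with $\mathrm{ev}$ or $\mathrm{coev}$ gives $0$. (Schur 1) composing $P_4$ with a trivalent vertex, at the top or at the bottom, gives $0$. 5. (Swap, with $\omega=-1$) For three vertical black strands, a red strand between the first and the second one below a red strand between the second and the third one equals $-1$ times the same diagram with the heights of the red strands exchanged (both red strands point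 to the right). 6. (decStick) The partial closure of $P_4$ on the right, and also the one on the left, is the identity strand. 7. (decBigon) A bigon with a red strand at one of its vertices, in any of the three regions at that vertex, equals $q^2+1+q^{-2}$ times a strand. 8. (Change of Basis) The vertex with a red strand going up on its left (between the lower left leg and the top leg) equals $q^{-4}$ times the plain vertex plus $q^{16}$ times the vertex with a red strand going up on its right (between the lower right leg and the top leg). 9. (decTrigon) A trigon with a red strand between outer leg $1$ and the side that follows it clockwise equals $-Y$ minus $Y$ with a red strand between the legs $1$ and $2$. With the red strand between outer leg $1$ and the preceding side, it equals $-Y$ minus $Y$ with a red strand between the legs $3$ and $1$; with the red strand inside the trigon at the vertex of leg $1$, it equals $-Y$ minus $Y$ with a red strand between the legs $2$ and $3$. 10. (decTetragon) A tetragon with a red strand between outer leg $2$ and the side that leads from its vertex to that of leg $3$ equals $$q^2H+q^2H'+\frac{q^{17}}{q-q^{-1}}A+q^2A'+\frac{1+[3]_q}{q^4}A_r+\frac{[2]_q}{q^{13}}A'_r+q^{-14}\mathrm{Dec}_1(H)+\frac{[2]_q}{q^{13}}\mathrm{Dec}_1(H')-\mathrm{Dec}_2(H').$$ 11. (decPentagon)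 A pentagon with a red strand between outer leg $1$ and the side that leads from its vertex to that of leg $2$ equals $$\sum_{i=0}^5\sum_{j=0}^4w_{i,j}\,\mathrm{Dec}_i(\mathrm{Right}^j(\mathrm{tree}))+\sum_{i=0}^5\sum_{j=0}^4x_{i,j}\,\mathrm{Dec}_i(\mathrm{Right}^j(\mathrm{forest})),$$ where the matrices $(w_{i,j})$ and $(x_{i,j})$, with rows $i=0,\dots,5$ and columns $j=0,\dots,4$, are, in this order, $$\begin{pmatrix} q^{8}-q^{4}+q^{-4}+q^{-2} & -q^{6}-q^{4} & 0 & 0 & -q^{4} \\ -q^{-6} & -q^{6}-q^{2}-q^{-4} & 0 & -q^{8}-q^{4}-q^{-4} & -q^{-4} \\ q^{6} & 0 & q^{8}-q^{-6} & q^{-6} & 0 \\ -q^{4} & q^{6}+q^{2} & q^{-8} & q^{8}+q^{4}-q^{2} & 0 \\ -q^{-8} & 0 & -q^{-10} & 0 & 0 \\ -q^{10}+q^{4}+1 & q^{2}+q^{-2} & q^{-2} & 1+q^{-2}+q^{-4} & 0 \end{pmatrix}$$ $$\begin{pmatrix} 1 & -q^{4}-q^{2}-q^{-8} & -q^{4}+1-q^{-6}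 & q^{-6} & -q^{4}-1-q^{-4} \\ 0 & q^{12}-q^{8} & q^{-2} & -q^{-4} & q^{12}+q^{8}-q^{-4} \\ -q^{-2}-q^{-4} & 0 & q^{6}+q^{4}+1 & -q^{-6} & 0 \\ -q^{12} & q^{4}+q^{-6} & 0 & q^{12}-q^{2}-q^{-2}-q^{-10} & -q^{8}-q^{4} \\ -q^{-10} & q^{-2} & -q^{8}-q^{6}-q^{4}-q^{2} & 0 & 1 \\ q^{12}+q^{8}-q^{-6} & -1 & -q^{8}-q^{-4} & q^{12}-2q^{2}-q^{-2}-q^{-8} & 0 \end{pmatrix}$$ Exactly $44$ of these $60$ coefficients are nonzero. -/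

import Mathlib

open scoped BigOperators

noncomputable section

namespace GPA

/-! ## Graph planar algebras -/

/-- A finite undirected graph (loops allowed, at most one edge between two vertices) together with
a positive eigenvector of its adjacency matrix. On a connected graph this is the Frobenius–Perron
eigenvector, unique up to a positive factor. -/
structure PFGraph (V : Type) [Fintype V] where
  /-- adjacency -/
  adj : V → V → Bool
  symm : ∀ a b, adj a b = adj b a
  /-- the Frobenius–Perron eigenvector -/
  lam : V → ℝ
  lam_pos : ∀ a, 0 < lam a
  lam_eigen : ∃ d : ℝ, ∀ a, (∑ b, if adj a b then lam b else 0) = d * lam a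

variable {V : Type} [Fintype V] [DecidableEq V] {Γ : PFGraph V}

/-- An `n`-path: since there is at most one edge between two vertices, it is given by the sequence
of its `n + 1` vertices. -/
abbrev Path (Γ : PFGraph V) (n : ℕ) : Type :=
  {p : Fin (n + 1) → V // ∀ i : Fin n, Γ.adj (p i.castSucc) (p i.succ) = true}

/-- Source of a path. -/
def src {n : ℕ} (p : Path Γ n) : V := p.1 0

/-- Target of a path. -/
def tgt {n : ℕ} (p : Path Γ n) : V := p.1 (Fin.last n)

/-- The pairs `(p, q)` of parallel paths that form the basis of `Hom (m → n)`. -/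
abbrev PathPair (Γ : PFGraph V) (m n : ℕ) : Type :=
  {x : Path Γ m × Path Γ n // src x.1 = src x.2 ∧ tgt x.1 = tgt x.2}

/-- `Hom (m → n)`: the complex vector space with basis the pairs of parallel paths. A morphism is
given by its coordinates. -/
abbrev Hom (Γ : PFGraph V) (m n : ℕ) : Type := PathPair Γ m n → ℂ

/-- The coordinate of `f` at `(p, q)`, and `0` if `p`, `q` are not parallel. -/
def coeff {m n : ℕ} (f : Hom Γ m n) (p : Path Γ m) (q : Path Γ n) : ℂ :=
  if h : src p = src q ∧ tgt p = tgt q then f ⟨(p, q), h⟩ else 0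

/-- The identity of `n`. -/
def idm (n : ℕ) : Hom Γ n n := fun x => if x.1.1 = x.1.2 then 1 else 0

/-- Composition `m → n → k`, first `f` and then `g`: on basis elements
`(p, q), (p', q') ↦ δ_{q = p'} (p, q')`. -/
def comp {m n k : ℕ} (f : Hom Γ m n) (g : Hom Γ n k) : Hom Γ m k :=
  fun x => ∑ q : Path Γ n, coeff f x.1.1 q * coeff g q x.1.2

/-- The first `m` edges of a path. -/
def Path.left {m m' : ℕ} (p : Path Γ (m + m')) : Path Γ m :=
  ⟨fun i => p.1 (Fin.castLE (by omega) i), fun i => p.2 (Fin.castLE (by omega) i)⟩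

/-- The last `m'` edges of a path. -/
def Path.right {m m' : ℕ} (p : Path Γ (m + m')) : Path Γ m' :=
  ⟨fun i => p.1 (Fin.natAdd m i), fun i => p.2 (Fin.natAdd m i)⟩

/-- Monoidal product: on basis elements `(p, q), (p', q') ↦ δ_{t(p) = s(p')} (p p', q q')`. -/
def tensor {m n m' n' : ℕ} (f : Hom Γ m n) (g : Hom Γ m' n') : Hom Γ (m + m') (n + n') :=
  fun x => coeff f (Path.left x.1.1) (Path.left x.1.2) *
    coeff g (Path.right x.1.1) (Path.right x.1.2)

infixl:67 " ⨾ " => comp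
infixl:75 " ⊠ " => tensor

/-- Evaluation `2 → 0`, `∑_e √(λ_{t(e)} / λ_{s(e)}) (e ē, s(e))`. -/
def ev : Hom Γ 2 0 := fun x => ((Real.sqrt (Γ.lam (x.1.1.1 1) / Γ.lam (x.1.1.1 0)) : ℝ) : ℂ)

/-- Coevaluation `0 → 2`, `∑_e √(λ_{t(e)} / λ_{s(e)}) (s(e), e ē)`. -/
def coev : Hom Γ 0 2 := fun x => ((Real.sqrt (Γ.lam (x.1.2.1 1) / Γ.lam (x.1.2.1 0)) : ℝ) : ℂ)

/-! ## Planar diagrams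

Diagrams are read from bottom to top. A diagram with `n` boundary points all at the top is an
element of `Hom 0 n`; its boundary points `1, …, n` are then numbered from left to right, that is,
clockwise. Region `i` is the outer region between the boundary points `i` and `i + 1`, and region
`n` is the one between `n` and `1`. -/

/-- Two nested caps turned upside down: points `1, 4` are joined, and `2, 3` are joined. -/
def nest : Hom Γ 0 4 := coev ⨾ (idm 1 ⊠ coev ⊠ idm 1)

/-- Clockwise rotation of a `2 → 2` diagram by one click. -/
def rotCW (f : Hom Γ 2 2) : Hom Γ 2 2 := (coev ⊠ idm 2) ⨾ (idm 1 ⊠ f ⊠ idm 1 :) ⨾ (idm 2 ⊠ ev)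

/-- Counterclockwise rotation of a `2 → 2` diagram by one click. -/
def rotCCW (f : Hom Γ 2 2) : Hom Γ 2 2 := (idm 2 ⊠ coev) ⨾ (idm 1 ⊠ f ⊠ idm 1 :) ⨾ (ev ⊠ idm 2)

/-- All boundary points of a `2 → 2` diagram bent to the top; the points are then, in this order,
top left, top right, bottom right, bottom left. -/
def bend22 (f : Hom Γ 2 2) : Hom Γ 0 4 := nest ⨾ (f ⊠ idm 2)

/-- All boundary points of a `2 → 1` diagram bent to the top; the points are then, in this order,
top, bottom right, bottom left. -/
def bend21 (f : Hom Γ 2 1) : Hom Γ 0 3 := nest ⨾ (f ⊠ idm 2)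

/-- `Right¹`: clockwise rotation by one click. Boundary point `i` moves to `i + 1`. -/
def right3 (v : Hom Γ 0 3) : Hom Γ 0 3 := coev ⨾ (idm 1 ⊠ v ⊠ idm 1) ⨾ (idm 3 ⊠ ev)

/-- Clockwise rotation by one click of a diagram with `4` boundary points. -/
def right4 (v : Hom Γ 0 4) : Hom Γ 0 4 := coev ⨾ (idm 1 ⊠ v ⊠ idm 1) ⨾ (idm 4 ⊠ ev)

/-- Clockwise rotation by one click of a diagram with `5` boundary points. -/
def right5 (v : Hom Γ 0 5) : Hom Γ 0 5 := coev ⨾ (idm 1 ⊠ v ⊠ idm 1) ⨾ (idm 5 ⊠ ev)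

/-- External decoration in region `i`: a red strand joins the legs `i` and `i + 1`. Here `R` is the
diagram of two vertical black strands joined by a horizontal red one; the decoration is clockwise
if the red strand of `R` points to the right. By convention `i = 0` means no decoration. -/
def dec3 (R : Hom Γ 2 2) (i : Fin 4) (v : Hom Γ 0 3) : Hom Γ 0 3 :=
  match i with
  | 0 => v
  | 1 => v ⨾ (R ⊠ idm 1)
  | 2 => v ⨾ (idm 1 ⊠ R)
  | 3 => right3^[2] (right3 v ⨾ (R ⊠ idm 1))

/-- As `dec3`, for a diagram with `4` boundary points. -/
def dec4 (R : Hom Γ 2 2) (i : Fin 5) (v : Hom Γ 0 4) : Hom Γ 0 4 :=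
  match i with
  | 0 => v
  | 1 => v ⨾ (R ⊠ idm 2)
  | 2 => v ⨾ (idm 1 ⊠ R ⊠ idm 1)
  | 3 => v ⨾ (idm 2 ⊠ R)
  | 4 => right4^[3] (right4 v ⨾ (R ⊠ idm 2))

/-- As `dec3`, for a diagram with `5` boundary points. -/
def dec5 (R : Hom Γ 2 2) (i : Fin 6) (v : Hom Γ 0 5) : Hom Γ 0 5 :=
  match i with
  | 0 => v
  | 1 => v ⨾ (R ⊠ idm 3)
  | 2 => v ⨾ (idm 1 ⊠ R ⊠ idm 2)
  | 3 => v ⨾ (idm 2 ⊠ R ⊠ idm 1)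
  | 4 => v ⨾ (idm 3 ⊠ R)
  | 5 => right5^[4] (right5 v ⨾ (R ⊠ idm 3))

/-- A (possibly decorated) trivalent vertex as a `1 → 2` diagram: its legs `1, 2, 3` become the
input, the left output and the right output. -/
def split (v : Hom Γ 0 3) : Hom Γ 1 2 := (idm 1 ⊠ v) ⨾ (ev ⊠ idm 2)

/-- The diagram with two trivalent vertices joined by an edge; one vertex carries the legs `1, 2`,
the other one the legs `3, 4`. -/
def treeI (T : Hom Γ 2 1) : Hom Γ 0 4 := bend21 T ⨾ (idm 2 ⊠ split (bend21 T) :)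

/-- The tree with three trivalent vertices that carry the legs `1, 2`, the leg `3`, and the legs
`4, 5`, respectively. -/
def tree5 (T : Hom Γ 2 1) : Hom Γ 0 5 := treeI T ⨾ (idm 3 ⊠ split (bend21 T) :)

/-- A strand joining the boundary points `1, 2` next to a trivalent vertex with legs `3, 4, 5`. -/
def forest5 (T : Hom Γ 2 1) : Hom Γ 0 5 := coev ⊠ bend21 T

/-- The bigon whose first vertex is replaced by `v`. -/
def bigon (T : Hom Γ 2 1) (v : Hom Γ 0 3) : Hom Γ 1 1 := split v ⨾ T

/-- The trigon with legs `1, 2, 3`, in which the vertex at leg `1` is replaced by `v`. In this and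
the next two diagrams leg `1` of `v` is the side of the polygon that ends at the last vertex, leg
`2` of `v` is the outer leg, and leg `3` of `v` is the side that leads to the next vertex in
clockwise order. A decoration of `v` in region `2` is thus a red strand between outer leg `1` and
the following side, in the outer region `1`; in region `1` it is a red strand between the preceding
side and outer leg `1`, in the last outer region; in region `3` it lies inside the polygon. -/
def trigon (T : Hom Γ 2 1) (v : Hom Γ 0 3) : Hom Γ 0 3 :=
  coev ⨾ (split v ⊠ idm 1) ⨾ (idm 1 ⊠ split (bend21 T) ⊠ idm 1 :) ⨾ (idm 2 ⊠ T)

/-- The tetragon with the vertex at leg `1` replaced by `v`. -/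
def tetragon (T : Hom Γ 2 1) (v : Hom Γ 0 3) : Hom Γ 0 4 :=
  coev ⨾ (split v ⊠ idm 1) ⨾ (idm 1 ⊠ split (bend21 T) ⊠ idm 1 :) ⨾
    (idm 2 ⊠ split (bend21 T) ⊠ idm 1 :) ⨾ (idm 3 ⊠ T)

/-- The pentagon with the vertex at leg `1` replaced by `v`. -/
def pentagon (T : Hom Γ 2 1) (v : Hom Γ 0 3) : Hom Γ 0 5 :=
  coev ⨾ (split v ⊠ idm 1) ⨾ (idm 1 ⊠ split (bend21 T) ⊠ idm 1 :) ⨾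
    (idm 2 ⊠ split (bend21 T) ⊠ idm 1 :) ⨾ (idm 3 ⊠ split (bend21 T) ⊠ idm 1 :) ⨾ (idm 4 ⊠ T)

/-! ## The relations -/

/-- The quantum integer `[n]_q`. -/
def qint (q : ℂ) (n : ℕ) : ℂ := (q ^ n - q ^ (-(n : ℤ))) / (q - q⁻¹)

/-- The relations of the trivalent skein theory `𝒢₂(q)` (with `κ² = [7]_q - 1`). -/
structure G2Relations (q : ℂ) (T : Hom Γ 2 1) : Prop where
  loop : (coev ⨾ ev : Hom Γ 0 0) =
    (q ^ 10 + q ^ 8 + q ^ 2 + 1 + q ^ (-2 : ℤ) + q ^ (-8 : ℤ) + q ^ (-10 : ℤ)) • idm 0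
  lollipop : coev ⨾ T = 0
  rotate : right3 (bend21 T) = bend21 T
  bigon : bigon T (bend21 T) = (qint q 7 - 1) • idm 1
  trigon : trigon T (bend21 T) = (-(q ^ 4 + 1 + q ^ (-4 : ℤ))) • bend21 T
  tetragon : tetragon T (bend21 T) =
    (q ^ 2 + q ^ (-2 : ℤ)) • (treeI T + right4 (treeI T)) +
      (q ^ 2 + 1 + q ^ (-2 : ℤ)) • (coev ⊠ coev + nest)
  pentagon : pentagon T (bend21 T) =
    -(∑ j : Fin 5, right5^[j] (tree5 T)) - ∑ j : Fin 5, right5^[j] (forest5 T)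

/-- Coefficients of `Dec_i (Right^j (tree))` in the relation (decPentagon). -/
def pentTree (q : ℂ) : Fin 6 → Fin 5 → ℂ := ![
  ![q ^ 8 - q ^ 4 + q ^ (-4 : ℤ) + q ^ (-2 : ℤ), -q ^ 6 - q ^ 4, 0, 0, -q ^ 4],
  ![-q ^ (-6 : ℤ), -q ^ 6 - q ^ 2 - q ^ (-4 : ℤ), 0, -q ^ 8 - q ^ 4 - q ^ (-4 : ℤ), -q ^ (-4 : ℤ)],
  ![q ^ 6, 0, q ^ 8 - q ^ (-6 : ℤ), q ^ (-6 : ℤ), 0],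
  ![-q ^ 4, q ^ 6 + q ^ 2, q ^ (-8 : ℤ), q ^ 8 + q ^ 4 - q ^ 2, 0],
  ![-q ^ (-8 : ℤ), 0, -q ^ (-10 : ℤ), 0, 0],
  ![-q ^ 10 + q ^ 4 + 1, q ^ 2 + q ^ (-2 : ℤ), q ^ (-2 : ℤ), 1 + q ^ (-2 : ℤ) + q ^ (-4 : ℤ), 0]]

/-- Coefficients of `Dec_i (Right^j (forest))` in the relation (decPentagon). -/
def pentForest (q : ℂ) : Fin 6 → Fin 5 → ℂ := ![
  ![1, -q ^ 4 - q ^ 2 - q ^ (-8 : ℤ), -q ^ 4 + 1 - q ^ (-6 : ℤ), q ^ (-6 : ℤ), -q ^ 4 - 1 - q ^ (-4 : ℤ)],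
  ![0, q ^ 12 - q ^ 8, q ^ (-2 : ℤ), -q ^ (-4 : ℤ), q ^ 12 + q ^ 8 - q ^ (-4 : ℤ)],
  ![-q ^ (-2 : ℤ) - q ^ (-4 : ℤ), 0, q ^ 6 + q ^ 4 + 1, -q ^ (-6 : ℤ), 0],
  ![-q ^ 12, q ^ 4 + q ^ (-6 : ℤ), 0, q ^ 12 - q ^ 2 - q ^ (-2 : ℤ) - q ^ (-10 : ℤ), -q ^ 8 - q ^ 4],
  ![-q ^ (-10 : ℤ), q ^ (-2 : ℤ), -q ^ 8 - q ^ 6 - q ^ 4 - q ^ 2, 0, 1],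
  ![q ^ 12 + q ^ 8 - q ^ (-6 : ℤ), -1, -q ^ 8 - q ^ (-4 : ℤ), q ^ 12 - 2 * q ^ 2 - q ^ (-2 : ℤ) - q ^ (-8 : ℤ), 0]]

/-- The defining relations of `𝒟₄` for a trivalent vertex `T` and for `P`, the diagram of a cup
above a cap, joined by a vertical red strand that points up. The relations are those of `𝒢₂(q)`, the
relations of a `ℤ₂`-like extension, and the relations with the structure constants of `𝒟₄`.
`rotCW P` (or `rotCCW P`) consists of two vertical black strands joined by a horizontal red strand
that points to the right (or left). -/
structure D4Relations (q : ℂ) (T : Hom Γ 2 1) (P : Hom Γ 2 2) : Prop where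
  trivalent : G2Relations q T
  /-- A red strand up next to a red strand down equals a red strand to the right between the two
  lower arcs together with a red strand to the left between the two upper arcs. -/
  recouple : P ⊠ rotCW (rotCW P) =
    (idm 1 ⊠ rotCW P ⊠ idm 1 :) ⨾ (ev ⊠ (ev : Hom Γ 2 0) :) ⨾ ((coev ⊠ coev) ⨾ (idm 1 ⊠ rotCCW P ⊠ idm 1 :))
  reverse : rotCW (rotCW P) = P
  schur0 : coev ⨾ P = 0 ∧ P ⨾ ev = 0
  schur1 : P ⨾ T = 0 ∧ split (bend21 T) ⨾ P = 0
  swap : (rotCW P ⊠ idm 1 :) ⨾ (idm 1 ⊠ rotCW P :) =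
    (-1 : ℂ) • ((idm 1 ⊠ rotCW P :) ⨾ (rotCW P ⊠ idm 1 :))
  decStick : (idm 1 ⊠ coev) ⨾ (P ⊠ idm 1 :) ⨾ (idm 1 ⊠ (ev : Hom Γ 2 0) :) =
    (idm 1 : Hom Γ 1 1) ∧
    (coev ⊠ idm 1) ⨾ (idm 1 ⊠ P :) ⨾ ((ev : Hom Γ 2 0) ⊠ idm 1 :) = (idm 1 : Hom Γ 1 1)
  /-- The three cases are the three places of the red strand at a vertex of the bigon. -/
  decBigon : ∀ i : Fin 4, i ≠ 0 →
    bigon T (dec3 (rotCW P) i (bend21 T)) = (q ^ 2 + 1 + q ^ (-2 : ℤ)) • idm 1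
  /-- Red strand up on the left equals a combination of the plain vertex and the vertex with a red
  strand up on the right. -/
  changeOfBasis : dec3 (rotCW P) 3 (bend21 T) =
    q ^ (-4 : ℤ) • bend21 T + q ^ 16 • dec3 (rotCCW P) 1 (bend21 T)
  /-- The red strand joins the outer leg `1` and the following side. -/
  decTrigon : trigon T (dec3 (rotCW P) 2 (bend21 T)) =
    (-1 : ℂ) • bend21 T + (-1 : ℂ) • dec3 (rotCCW P) 1 (bend21 T)
  /-- The red strand joins the outer leg `1` and the preceding side. -/
  decTrigon' : trigon T (dec3 (rotCW P) 1 (bend21 T)) =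
    (-1 : ℂ) • bend21 T + (-1 : ℂ) • dec3 (rotCCW P) 3 (bend21 T)
  /-- The red strand is inside the trigon, at the vertex of leg `1`. -/
  decTrigonInner : trigon T (dec3 (rotCW P) 3 (bend21 T)) =
    (-1 : ℂ) • bend21 T + (-1 : ℂ) • dec3 (rotCCW P) 2 (bend21 T)
  decTetragon : right4 (tetragon T (dec3 (rotCW P) 2 (bend21 T))) =
    q ^ 2 • treeI T + q ^ 2 • right4 (treeI T) +
      (q ^ 17 / (q - q⁻¹)) • (coev ⊠ coev) + q ^ 2 • nest +
      ((1 + qint q 3) / q ^ 4) • bend22 P + (qint q 2 / q ^ 13) • bend22 (rotCW P) +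
      q ^ (-14 : ℤ) • dec4 (rotCW P) 1 (treeI T) +
      (qint q 2 / q ^ 13) • dec4 (rotCW P) 1 (right4 (treeI T)) +
      (-1 : ℂ) • dec4 (rotCW P) 2 (right4 (treeI T))
  decPentagon : pentagon T (dec3 (rotCW P) 2 (bend21 T)) =
    (∑ i : Fin 6, ∑ j : Fin 5, pentTree q i j • dec5 (rotCW P) i (right5^[j] (tree5 T))) +
      ∑ i : Fin 6, ∑ j : Fin 5, pentForest q i j • dec5 (rotCW P) i (right5^[j] (forest5 T))

/-! ## The graph `Γ₄` and the two explicit morphisms -/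

/-- The adjacency matrix of `Γ₄`. The vertices `1, …, 6` of `Γ₄` are `0, …, 5 : Fin 6` here. -/
def adj4 : Matrix (Fin 6) (Fin 6) Bool :=
  !![false, true,  false, false, false, true;
     true,  true,  true,  false, true,  true;
     false, true,  true,  true,  true,  true;
     false, false, true,  false, true,  false;
     false, true,  true,  true,  true,  true;
     true,  true,  true,  false, true,  true]

/-- The Frobenius–Perron eigenvalue of `Γ₄`. -/
def delta4 : ℝ := 2 + Real.sqrt 6

/-- The Frobenius–Perron eigenvector of `Γ₄`. -/
def lam4 : Fin 6 → ℝ := ![2, delta4, delta4, 2, delta4, delta4]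

theorem lam4_pos (a : Fin 6) : 0 < lam4 a := by
  have h : 0 < delta4 := by unfold delta4; positivity
  fin_cases a <;> simp [lam4, h]

theorem lam4_eigen (a : Fin 6) :
    (∑ b, if adj4 a b then lam4 b else 0) = delta4 * lam4 a := by
  have h : Real.sqrt 6 * Real.sqrt 6 = 6 := Real.mul_self_sqrt (by norm_num)
  fin_cases a <;> simp [Fin.sum_univ_six, adj4, lam4, delta4] <;> nlinarith

theorem adj4_symm (a b : Fin 6) : adj4 a b = adj4 b a := by
  fin_cases a <;> fin_cases b <;> rfl

/-- The graph `Γ₄`. -/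
def Γ₄ : PFGraph (Fin 6) where
  adj := fun a b => adj4 a b
  symm := adj4_symm
  lam := lam4
  lam_pos := lam4_pos
  lam_eigen := ⟨delta4, lam4_eigen⟩

/-- `q₄ = e^{2πi/48}`. -/
def q4 : ℂ := Complex.exp (2 * Real.pi * Complex.I / 48)

def a1 : ℝ := √((1 + 2 * √2 + √3 + √6) / 2)

def a2 : ℝ := √((-1 + √2 + √3) / 2)

def a3 : ℝ := √(3 / 2 * (√(2 + √3) - 1))

def a4 : ℝ := √(2 + √3 - √(2 + √3))

def a5 : ℝ := √((√(2 + √3) - 1) / 2)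

def a6 : ℝ := √((√3 + √(2 + √3)) / 2)

def a7 : ℝ := √(1 - √(3 / 2) + 1 / √2)

def a8 : ℝ := (√(1 + √(6 - 3 * √3)) - √(√(2 + √3) - 1)) / 2

def a9 : ℝ := (√(1 + √(6 - 3 * √3)) + √(√(2 + √3) - 1)) / 2

/-- The entry `(j, k)` of the `i`-th matrix is the coordinate of the trivalent vertex at
`((i, j, k), (i, k))`. -/
def trivCoeff : Fin 6 → Matrix (Fin 6) (Fin 6) ℝ := ![
  !![  0,   0,   0,   0,   0,   0;
       0,  a1,   0,   0,   0,  a2;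
       0,   0,   0,   0,   0,   0;
       0,   0,   0,   0,   0,   0;
       0,   0,   0,   0,   0,   0;
       0,  a2,   0,   0,   0,  a1],
  !![  0,  a4,   0,   0,   0,  a7;
      a1, -a3, -a8,   0,  a9, -a5;
       0, -a8,  a9,   0,  a6, -a6;
       0,   0,   0,   0,   0,   0;
       0,  a9,  a6,   0, -a8, -a6;
      a2, -a5, -a6,   0, -a6, -a5],
  !![  0,   0,   0,   0,   0,   0;
       0, -a8,  a9,   0,  a6, -a6;
       0,  a9, -a3,  a1, -a5, -a8;
       0,   0,  a4,   0,  a7,   0;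
       0,  a6, -a5,  a2, -a5, -a6;
       0, -a6, -a8,   0, -a6,  a9],
  !![  0,   0,   0,   0,   0,   0;
       0,   0,   0,   0,   0,   0;
       0,   0,  a1,   0,  a2,   0;
       0,   0,   0,   0,   0,   0;
       0,   0,  a2,   0,  a1,   0;
       0,   0,   0,   0,   0,   0],
  !![  0,   0,   0,   0,   0,   0;
       0,  a9,  a6,   0, -a8, -a6;
       0,  a6, -a5,  a2, -a5, -a6;
       0,   0,  a7,   0,  a4,   0;
       0, -a8, -a5,  a1, -a3,  a9;
       0, -a6, -a6,   0,  a9, -a8],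
  !![  0,  a7,   0,   0,   0,  a4;
      a2, -a5, -a6,   0, -a6, -a5;
       0, -a6, -a8,   0, -a6,  a9;
       0,   0,   0,   0,   0,   0;
       0, -a6, -a6,   0,  a9, -a8;
      a1, -a5,  a9,   0, -a8, -a3]]

/-- The image of the trivalent vertex in `Hom (2 → 1)`. -/
def triv4 : Hom Γ₄ 2 1 := fun x => ((trivCoeff (x.1.1.1 0) (x.1.1.1 1) (x.1.1.1 2) : ℝ) : ℂ)

/-- `√(√6 - 2)`. -/
def s4 : ℂ := ((√(√6 - 2) : ℝ) : ℂ)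

/-- `√(δ / 2)`. -/
def h4 : ℂ := ((√(delta4 / 2) : ℝ) : ℂ)

/-- `e^{πi/4}`. -/
def e4 : ℂ := Complex.exp (Real.pi * Complex.I / 4)

/-- The complex number `√(1 - cos (π/12)) + i √(cos (π/12))` of modulus `1`. -/
def z4 : ℂ := ((√(1 - Real.cos (Real.pi / 12)) : ℝ) : ℂ) +
  ((√(Real.cos (Real.pi / 12)) : ℝ) : ℂ) * Complex.I

/-- `projVec a b x` is the component at the path `a → x → b` of a vector `u`, such that `P₄`
restricted to the paths from `a` to `b` is the matrix `u uᴴ`. -/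
def projVec (a b : Fin 6) : Fin 6 → ℂ :=
  if a = 0 ∧ b = 0 then ![0, h4, 0, 0, 0, -h4]
  else if a = 3 ∧ b = 3 then ![0, 0, h4, 0, -h4, 0]
  else if a = 1 ∧ b = 5 then ![s4, e4, -star z4, 0, -z4, star e4]
  else if a = 5 ∧ b = 1 then ![s4, star e4, -z4, 0, -star z4, e4]
  else if a = 2 ∧ b = 4 then ![0, z4, e4, s4, star e4, -star z4]
  else if a = 4 ∧ b = 2 then ![0, star z4, star e4, s4, e4, -z4]
  else 0

/-- The element `P₄` of `Hom (2 → 2)`: its coordinate at `((a, x, b), (a, y, b))` is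
`u_x · conj u_y` with `u = projVec a b`. -/
def proj4 : Hom Γ₄ 2 2 := fun x =>
  projVec (x.1.1.1 0) (x.1.1.1 2) (x.1.1.1 1) *
    star (projVec (x.1.1.1 0) (x.1.1.1 2) (x.1.2.1 1))

end GPA

end

/-!
The proof compares coordinates. A morphism is recorded by `GPA.lval`, a function of two lists of
vertices, and the coordinates of a diagram are sums over its inner regions of products of vertices and
edge weights (`GPA.lval_comp_idm_tensor_idm` and the formulas derived from it).

After a change of basis, a `GPA.Gauge`, these formulas become symmetric. The weights
`√(λ_b / λ_a)` are quotients of square roots of the vertex weights, so they can be distributed over the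
regions and edges of a diagram. In the normalised coordinates `norm3`, `norm4` and `norm5` a rotation
of a diagram only rotates its boundary regions, grafting is multiplication, and a polygon is a
single sum over its inner region (`norm3_trigon`, `norm4_tetragon`, `norm5_pentagon`). The element `P₄`
is supported on pairs of regions `a`, `σ a`, where the involution `GPA.invol` of the graph plays the
role of `σ`; hence a red strand that crosses a region acts by a factor and by `σ` on this region. The
relations that involve only the red strand, except (Swap), follow from this and from the moduli and
the conjugation symmetry of the components of the vectors that define `P₄`.

For the graph `Γ₄` the gauge `GPA.gauge4` is chosen so that the normalised trivalent vertex is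
invariant under rotation and that its entries, those of the red strand and all weights lie in the
number field `ℚ(x, θ)`, where `x = q²` is a primitive 24th root of unity and
`θ² = (√2 - 1)(√3 - √2)`. This field has degree 16 and is generated by `y = x³ θ`. Each of the
remaining relations is thereby reduced to one identity in this field for each admissible sequence of
boundary regions; (Lollipop) and (Schur 1) are short enough to be checked directly.

The identities are verified modulo an integer. Let `N` be the value at `B = 2 ^ 256` of the minimal
polynomial of `y`. Sending `y` to `B` defines a homomorphism from `ℤ[1/2, x, θ]` to `ℤ/N`. Both
sides of an identity are, up to a power of 2, sums of a bounded number of monomials in `x` and `θ`, and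
hence polynomials in `y` of degree at most 15 with coefficients far below `B`. Such a number
vanishes if its residue does, because the coefficients are the digits in base `B` of an integer
that is smaller than `N` (`GPA.IsSmall.fst_eq_zero`, `GPA.Rep.eq`). To apply this without expanding
any expression, the formulas are written for arbitrary operations, `GPA.Ops`, and evaluated
three times: in `ℂ`, modulo `N`, and in a domain that measures sizes. A relation respected by the
operations relates the three values of every formula (`GPA.OpsRel`), and the identities between
residues are decided by evaluation in `ℕ`.

For the number of nonzero coefficients it remains to see that the listed ones do not vanish. They are
sums of powers of `x`, and reduction modulo 97, where 4 is a primitive 24th root of unity, shows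
that they are nonzero (`GPA.root_eq_zero`).
-/

open scoped BigOperators

set_option linter.unusedSectionVars false
set_option linter.unusedSimpArgs false

noncomputable section

namespace GPA

section
variable {V : Type} [Fintype V] [DecidableEq V] {Γ : PFGraph V}

/-! ### Coordinates as functions of vertex sequences -/

/-- The list `l` is the vertex sequence of an `n`-path. -/
def IsPathList (Γ : PFGraph V) (n : ℕ) (l : List V) : Prop :=
  l.length = n + 1 ∧ l.IsChain fun a b => Γ.adj a b = true

/-- The vertex sequence of a path. -/
def verts {n : ℕ} (p : Path Γ n) : List V := List.ofFn p.1

theorem isPathList_verts {n : ℕ} (p : Path Γ n) : IsPathList Γ n (verts p) := by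
  refine ⟨by simp [verts], ?_⟩
  rw [verts, List.isChain_ofFn]
  intro i hi
  exact p.2 ⟨i, by omega⟩

theorem IsPathList.exists_path {n : ℕ} {l : List V} (h : IsPathList Γ n l) :
    ∃ p : Path Γ n, verts p = l := by
  obtain ⟨h1, h2⟩ := h
  refine ⟨⟨fun i => l[i.1]'(by omega), fun i => ?_⟩, ?_⟩
  · rw [List.isChain_iff_getElem] at h2
    exact h2 i.1 (by omega)
  · apply List.ext_getElem
    · simp [verts, h1]
    · intro i _ _
      simp only [verts, List.getElem_ofFn]

theorem verts_injective {n : ℕ} : Function.Injective (verts : Path Γ n → List V) := by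
  intro p q h
  exact Subtype.ext (List.ofFn_injective h)

theorem head?_verts {n : ℕ} (p : Path Γ n) : (verts p).head? = some (src p) := by
  simp [verts, src, List.ofFn_succ]

theorem getLast?_verts {n : ℕ} (p : Path Γ n) : (verts p).getLast? = some (tgt p) := by
  rw [verts, List.getLast?_eq_getElem?]
  simp only [List.length_ofFn, Nat.add_sub_cancel]
  rw [List.getElem?_eq_getElem (by simp), List.getElem_ofFn]
  rfl

open Classical in
/-- The coordinate of a morphism at a pair of vertex sequences, and `0` if these are not a pair of
parallel paths of the right lengths. -/
def lval {m n : ℕ} (f : Hom Γ m n) (p q : List V) : ℂ :=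
  if h : ∃ x : PathPair Γ m n, verts x.1.1 = p ∧ verts x.1.2 = q then f h.choose else 0

theorem lval_verts {m n : ℕ} (f : Hom Γ m n) (x : PathPair Γ m n) :
    lval f (verts x.1.1) (verts x.1.2) = f x := by
  have h : ∃ y : PathPair Γ m n, verts y.1.1 = verts x.1.1 ∧ verts y.1.2 = verts x.1.2 :=
      ⟨x, rfl, rfl⟩
  rw [lval, dif_pos h]
  congr 1
  exact Subtype.ext (Prod.ext (verts_injective h.choose_spec.1) (verts_injective h.choose_spec.2))

/-- The vertex sequences `p`, `q` form a pair of parallel paths. -/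
def IsPair (Γ : PFGraph V) (m n : ℕ) (p q : List V) : Prop :=
  IsPathList Γ m p ∧ IsPathList Γ n q ∧ p.head? = q.head? ∧ p.getLast? = q.getLast?

theorem isPair_iff {m n : ℕ} {p q : List V} :
    IsPair Γ m n p q ↔ ∃ x : PathPair Γ m n, verts x.1.1 = p ∧ verts x.1.2 = q := by
  constructor
  · rintro ⟨hp, hq, h1, h2⟩
    obtain ⟨p, rfl⟩ := hp.exists_path
    obtain ⟨q, rfl⟩ := hq.exists_path
    rw [head?_verts, head?_verts, Option.some_inj] at h1
    rw [getLast?_verts, getLast?_verts, Option.some_inj] at h2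
    exact ⟨⟨(p, q), h1, h2⟩, rfl, rfl⟩
  · rintro ⟨⟨⟨p, q⟩, h1, h2⟩, rfl, rfl⟩
    refine ⟨isPathList_verts _, isPathList_verts _, ?_, ?_⟩
    · simpa [head?_verts] using h1
    · simpa [getLast?_verts] using h2

theorem lval_of_not_isPair {m n : ℕ} (f : Hom Γ m n) {p q : List V} (h : ¬ IsPair Γ m n p q) :
    lval f p q = 0 := by
  rw [isPair_iff] at h
  rw [lval, dif_neg h]

theorem isPair_of_lval_ne_zero {m n : ℕ} {f : Hom Γ m n} {p q : List V} (h : lval f p q ≠ 0) :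
    IsPair Γ m n p q := by
  by_contra h'
  exact h (lval_of_not_isPair f h')

theorem hom_ext {m n : ℕ} {f g : Hom Γ m n}
    (h : ∀ p q, IsPair Γ m n p q → lval f p q = lval g p q) : f = g := by
  funext x
  rw [← lval_verts f, ← lval_verts g]
  exact h _ _ (isPair_iff.2 ⟨x, rfl, rfl⟩)

theorem coeff_eq_lval {m n : ℕ} (f : Hom Γ m n) (p : Path Γ m) (q : Path Γ n) :
    coeff f p q = lval f (verts p) (verts q) := by
  by_cases h : src p = src q ∧ tgt p = tgt q
  · rw [coeff, dif_pos h]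
    exact (lval_verts f ⟨(p, q), h⟩).symm
  · rw [coeff, dif_neg h, lval_of_not_isPair]
    rintro ⟨-, -, h1, h2⟩
    rw [head?_verts, head?_verts, Option.some_inj] at h1
    rw [getLast?_verts, getLast?_verts, Option.some_inj] at h2
    exact h ⟨h1, h2⟩

/-- The sum over all lists of length `k`, as an iterated sum over the vertices. The sum over the paths
in the definition of a composition is of this kind, because the summand vanishes unless the list is
the vertex sequence of a path. -/
def sumL : ℕ → (List V → ℂ) → ℂ
  | 0, F => F []
  | k + 1, F => ∑ a, sumL k fun l => F (a :: l)

theorem sum_ofFn (k : ℕ) (F : List V → ℂ) :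
    ∑ r : Fin k → V, F (List.ofFn r) = sumL k F := by
  induction k generalizing F with
  | zero => simp [sumL]
  | succ k ih =>
    rw [sumL, ← (Fin.consEquiv fun _ => V).sum_comp, Fintype.sum_prod_type]
    refine Finset.sum_congr rfl fun a _ => ?_
    rw [← ih]
    simp [Fin.consEquiv, List.ofFn_succ]

theorem sum_path {n : ℕ} (F : List V → ℂ) (hF : ∀ l, ¬ IsPathList Γ n l → F l = 0) :
    ∑ r : Path Γ n, F (verts r) = sumL (n + 1) F := by
  rw [← sum_ofFn]
  classical
  rw [← Fintype.sum_subtype_add_sum_subtype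
    (fun p : Fin (n + 1) → V => ∀ i : Fin n, Γ.adj (p i.castSucc) (p i.succ) = true)]
  rw [Finset.sum_eq_zero (s := Finset.univ) (f := fun i : {p : Fin (n + 1) → V //
    ¬ ∀ i : Fin n, Γ.adj (p i.castSucc) (p i.succ) = true} => F (List.ofFn i.1)), add_zero]
  · rfl
  · rintro ⟨p, hp⟩ -
    apply hF
    rintro ⟨-, h⟩
    rw [List.isChain_ofFn] at h
    exact hp fun i => h i.1 (by omega)

theorem sumL_add (i k : ℕ) (F : List V → ℂ) :
    sumL (i + k) F = sumL i fun s => sumL k fun t => F (s ++ t) := by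
  induction i generalizing F with
  | zero => simp [sumL]
  | succ i ih =>
    rw [Nat.add_right_comm, sumL, sumL]
    exact Finset.sum_congr rfl fun a _ => by rw [ih]; rfl

theorem sumL_congr (i : ℕ) {F G : List V → ℂ} (h : ∀ l, l.length = i → F l = G l) :
    sumL i F = sumL i G := by
  induction i generalizing F G with
  | zero => exact h _ rfl
  | succ i ih =>
    exact Finset.sum_congr rfl fun a _ => ih fun l hl => h _ (by simp [hl])

theorem sumL_zero (i : ℕ) : sumL i (fun _ : List V => 0) = 0 := by
  induction i with
  | zero => rfl
  | succ i ih => simp [sumL, ih]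

theorem sumL_single (i : ℕ) (c : List V) (hc : c.length = i) (F : List V → ℂ)
    (hF : ∀ l, l.length = i → l ≠ c → F l = 0) : sumL i F = F c := by
  induction i generalizing F c with
  | zero => rw [List.length_eq_zero_iff.1 hc]; rfl
  | succ i ih =>
    obtain ⟨a, c, rfl⟩ := List.exists_cons_of_length_eq_add_one hc
    rw [sumL, Finset.sum_eq_single a]
    · exact ih c (by simpa using hc) _ fun l hl hne => hF _ (by simp [hl]) (by simpa using hne)
    · intro b _ hb
      rw [sumL_congr i (G := fun _ => 0) fun l hl => hF _ (by simp [hl]) (by simp [hb]), sumL_zero]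
    · simp

theorem lval_comp {m n k : ℕ} (f : Hom Γ m n) (g : Hom Γ n k) (p q : List V) :
    lval (f ⨾ g) p q = sumL (n + 1) fun r => lval f p r * lval g r q := by
  have hz : ∀ l, ¬ IsPathList Γ n l → lval f p l * lval g l q = 0 := by
    intro l hl
    rw [lval_of_not_isPair f (fun h => hl h.2.1), zero_mul]
  by_cases h : IsPair Γ m k p q
  · obtain ⟨x, rfl, rfl⟩ := isPair_iff.1 h
    rw [lval_verts, ← sum_path (Γ := Γ) _ hz]
    simp only [comp, coeff_eq_lval]
  · rw [lval_of_not_isPair _ h, ← sum_path (Γ := Γ) _ hz]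
    refine (Finset.sum_eq_zero fun r _ => ?_).symm
    by_contra h'
    obtain ⟨h1, h2⟩ := mul_ne_zero_iff.1 h'
    have h1 := isPair_of_lval_ne_zero h1
    have h2 := isPair_of_lval_ne_zero h2
    exact h ⟨h1.1, h2.2.1, h1.2.2.1.trans h2.2.2.1, h1.2.2.2.trans h2.2.2.2⟩

theorem verts_left {m m' : ℕ} (p : Path Γ (m + m')) :
    verts (Path.left p) = (verts p).take (m + 1) := by
  apply List.ext_getElem
  · simp only [verts, List.length_ofFn, List.length_take]; omega
  · intro i h1 h2
    simp only [verts, List.getElem_ofFn, List.getElem_take]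
    rfl

theorem verts_right {m m' : ℕ} (p : Path Γ (m + m')) :
    verts (Path.right p) = (verts p).drop m := by
  apply List.ext_getElem
  · simp only [verts, List.length_ofFn, List.length_drop]; omega
  · intro i h1 h2
    simp only [verts, List.getElem_ofFn, List.getElem_drop]
    rfl

theorem IsPathList.glue {m m' : ℕ} {l : List V} (h1 : IsPathList Γ m (l.take (m + 1)))
    (h2 : IsPathList Γ m' (l.drop m)) : IsPathList Γ (m + m') l := by
  have e2 := h2.1
  rw [List.length_drop] at e2
  refine ⟨by omega, ?_⟩
  rw [List.isChain_iff_getElem]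
  intro i hi
  by_cases him : i < m
  · have := (List.isChain_iff_getElem.1 h1.2) i (by rw [List.length_take]; omega)
    simpa using this
  · obtain ⟨j, rfl⟩ := Nat.exists_eq_add_of_le (not_lt.1 him)
    have := (List.isChain_iff_getElem.1 h2.2) j (by rw [List.length_drop]; omega)
    simpa [add_assoc] using this

theorem lval_tensor {m n m' n' : ℕ} (f : Hom Γ m n) (g : Hom Γ m' n') (p q : List V) :
    lval (f ⊠ g) p q = lval f (p.take (m + 1)) (q.take (n + 1)) * lval g (p.drop m) (q.drop n) := by
  by_cases h : IsPair Γ (m + m') (n + n') p q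
  · obtain ⟨x, rfl, rfl⟩ := isPair_iff.1 h
    rw [lval_verts, ← verts_left, ← verts_left, ← verts_right, ← verts_right]
    simp only [tensor, coeff_eq_lval]
  · rw [lval_of_not_isPair _ h]
    by_contra h'
    obtain ⟨h1, h2⟩ := mul_ne_zero_iff.1 (Ne.symm h')
    have h1 := isPair_of_lval_ne_zero h1
    have h2 := isPair_of_lval_ne_zero h2
    refine h ⟨h1.1.glue h2.1, h1.2.1.glue h2.2.1, ?_, ?_⟩
    · simpa [List.head?_take] using h1.2.2.1
    · have e1 := h2.1.1
      have e2 := h2.2.1.1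
      rw [List.length_drop] at e1 e2
      have := h2.2.2.2
      rwa [List.getLast?_drop, List.getLast?_drop, if_neg (by omega), if_neg (by omega)] at this

theorem lval_idm (n : ℕ) (p q : List V) :
    lval (idm n : Hom Γ n n) p q = Set.indicator {l | IsPathList Γ n l ∧ l = q} 1 p := by
  classical
  rw [Set.indicator_apply]
  simp only [Set.mem_ofPred_eq, Pi.one_apply]
  by_cases h : IsPair Γ n n p q
  · obtain ⟨x, rfl, rfl⟩ := isPair_iff.1 h
    rw [lval_verts, idm]
    simp only [isPathList_verts, true_and, verts_injective.eq_iff]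
  · rw [lval_of_not_isPair _ h, if_neg]
    rintro ⟨h1, rfl⟩
    exact h ⟨h1, h1, rfl, rfl⟩

/-! ### Diagrams with strands at their sides -/

theorem lval_idm_self {n : ℕ} {l : List V} (h : IsPathList Γ n l) :
    lval (idm n : Hom Γ n n) l l = 1 := by
  rw [lval_idm, Set.indicator_of_mem]
  · rfl
  · exact ⟨h, rfl⟩

theorem lval_idm_of_ne {n : ℕ} {p q : List V} (h : p ≠ q) :
    lval (idm n : Hom Γ n n) p q = 0 := by
  rw [lval_idm, Set.indicator_of_notMem]
  exact fun h' => h h'.2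

/-- Strands to the left of a diagram fix the corresponding part of the vertex sequence. -/
theorem sumL_idm_tensor {m n i : ℕ} (G : Hom Γ m n) (Φ : List V → ℂ) (q : List V)
    (hΦ : ∀ T, T.length = i + m + 1 → Φ T ≠ 0 → IsPathList Γ i (T.take (i + 1))) :
    sumL (i + m + 1) (fun T => Φ T * lval (idm i ⊠ G) T q) =
      sumL (m + 1) fun t => Φ (q.take i ++ t) * lval G t (q.drop i) := by
  by_cases hq : i ≤ q.length
  swap
  · have h0 : ∀ t, lval G t (q.drop i) = 0 := fun t => lval_of_not_isPair _ fun h => by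
      have := h.2.1.1
      rw [List.length_drop] at this
      omega
    simp only [lval_tensor, h0, mul_zero, sumL_zero]
  rw [add_assoc, sumL_add, sumL_single i (q.take i) (by simpa using hq)]
  · refine sumL_congr _ fun t ht => ?_
    rw [lval_tensor]
    have hl : (q.take i).length = i := by simpa using hq
    have hd : (q.take i ++ t).drop i = t := by rw [List.drop_append_of_le_length (by omega)]; simp
    rw [hd]
    by_cases h1 : Φ (q.take i ++ t) = 0
    · rw [h1]; ring
    by_cases h2 : lval G t (q.drop i) = 0
    · rw [h2]; ring
    have h3 := (isPair_of_lval_ne_zero h2).2.2.1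
    have h4 : (q.take i ++ t).take (i + 1) = q.take (i + 1) := by
      rw [List.take_append, List.take_of_length_le (by omega), hl, Nat.add_sub_cancel_left,
        List.take_add (i := i) (j := 1)]
      congr 1
      rw [List.take_one, List.take_one, h3]
    have h5 := hΦ _ (by rw [List.length_append]; omega) h1
    rw [h4] at h5 ⊢
    rw [lval_idm_self h5]; ring
  · intro s hs hne
    rw [sumL_congr _ (G := fun _ => 0), sumL_zero]
    intro t _
    rw [lval_tensor, lval_idm_of_ne]
    · ring
    · intro h
      apply hne
      have := congrArg (List.take i) h
      rw [List.take_take, List.take_take, min_eq_left (by omega), List.take_append_of_le_length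
        (by omega), List.take_of_length_le (by omega)] at this
      exact this

/-- Strands to the right of a diagram fix the corresponding part of the vertex sequence. -/
theorem sumL_tensor_idm {m n j : ℕ} (G : Hom Γ m n) (Φ : List V → ℂ) (q : List V)
    (hΦ : ∀ T, Φ T ≠ 0 → IsPathList Γ j (T.drop m)) :
    sumL (m + j + 1) (fun T => Φ T * lval (G ⊠ idm j) T q) =
      sumL (m + 1) fun t => Φ (t ++ q.drop (n + 1)) * lval G t (q.take (n + 1)) := by
  rw [show m + j + 1 = m + 1 + j by omega, sumL_add]
  refine sumL_congr _ fun t ht => ?_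
  by_cases h2 : lval G t (q.take (n + 1)) = 0
  · have ht' : ∀ s : List V, (t ++ s).take (m + 1) = t := fun s => by
      rw [List.take_append_of_le_length (by omega), List.take_of_length_le (by omega)]
    simp only [lval_tensor, ht', h2, zero_mul, mul_zero, sumL_zero]
  have hp := isPair_of_lval_ne_zero h2
  have hn := hp.2.1.1
  rw [List.length_take] at hn
  have ht' : ∀ s : List V, (t ++ s).take (m + 1) = t := fun s => by
    rw [List.take_append_of_le_length (by omega), List.take_of_length_le (by omega)]
  have hdt : ∀ s : List V, (t ++ s).drop m = t.drop m ++ s := fun s =>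
    List.drop_append_of_le_length (by omega)
  have hlast : t.drop m = (q.drop n).take 1 := by
    have h := hp.2.2.2
    rw [List.take_one, List.head?_drop]
    rw [List.getLast?_eq_getElem?, List.getLast?_eq_getElem?, ht, List.length_take,
      min_eq_left (by omega), List.getElem?_take_of_lt (by omega)] at h
    rw [show n = n + 1 - 1 by omega, ← h, List.getElem?_eq_getElem (by omega)]
    have : m < t.length := by omega
    rw [List.drop_eq_getElem_cons this, List.drop_of_length_le (by omega)]
    simp
  have hq : q.drop n = (q.drop n).take 1 ++ q.drop (n + 1) := by
    rw [← List.drop_drop, List.take_append_drop]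
  by_cases hj : (q.drop (n + 1)).length = j
  · rw [sumL_single j (q.drop (n + 1)) hj]
    · rw [lval_tensor, ht', hdt, hlast, ← hq]
      by_cases h1 : Φ (t ++ q.drop (n + 1)) = 0
      · rw [h1]; ring
      have h5 := hΦ _ h1
      rw [hdt, hlast, ← hq] at h5
      rw [lval_idm_self h5]; ring
    · intro s _ hne
      rw [lval_tensor, hdt, hlast, lval_idm_of_ne]
      · ring
      · rw [hq]
        intro h
        simp only [List.take_append, List.take_take] at h
        apply hne
        have h6 : ((q.drop n).take 1).length = 1 := by
          rw [List.length_take, List.length_drop]; omega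
        simp only [h6, min_self, Nat.sub_self, List.take_zero, List.append_nil] at h
        exact List.append_cancel_left h
  · rw [sumL_congr _ (G := fun _ => 0), sumL_zero]
    · by_contra h1
      have h1 := hΦ _ (left_ne_zero_of_mul (Ne.symm h1))
      have := h1.1
      rw [hdt, List.length_append, List.length_drop] at this
      omega
    · intro s hs
      rw [lval_tensor, hdt, hlast, lval_idm_of_ne]
      · ring
      · rw [hq]
        intro h
        have h6 : ((q.drop n).take 1).length = 1 := by
          rw [List.length_take, List.length_drop]; omega
        simp only [List.take_append, List.take_take] at h
        simp only [h6, min_self, Nat.sub_self, List.take_zero, List.append_nil] at h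
        rw [List.append_cancel_left h] at hs
        exact hj hs

theorem lval_comp_idm_tensor {k m n i : ℕ} (v : Hom Γ k (i + m)) (G : Hom Γ m n) (p q : List V) :
    lval (v ⨾ (idm i ⊠ G)) p q =
      sumL (m + 1) fun t => lval v p (q.take i ++ t) * lval G t (q.drop i) := by
  rw [lval_comp, sumL_idm_tensor]
  intro T _ hT
  have h := (isPair_of_lval_ne_zero hT).2.1
  exact ⟨by rw [List.length_take, h.1]; omega, h.2.take _⟩

theorem lval_comp_tensor_idm {k m n j : ℕ} (v : Hom Γ k (m + j)) (G : Hom Γ m n) (p q : List V) :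
    lval (v ⨾ (G ⊠ idm j)) p q =
      sumL (m + 1) fun t => lval v p (t ++ q.drop (n + 1)) * lval G t (q.take (n + 1)) := by
  rw [lval_comp, sumL_tensor_idm]
  intro T hT
  have h := (isPair_of_lval_ne_zero hT).2.1
  exact ⟨by rw [List.length_drop, h.1]; omega, h.2.drop _⟩

theorem lval_comp_idm_tensor_idm {k m n i j : ℕ} (v : Hom Γ k (i + m + j)) (G : Hom Γ m n)
    (p q : List V) :
    lval (v ⨾ (idm i ⊠ G ⊠ idm j)) p q = sumL (m + 1) fun t =>
      lval v p (q.take i ++ t ++ q.drop (i + n + 1)) * lval G t ((q.drop i).take (n + 1)) := by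
  rw [lval_comp_tensor_idm, sumL_idm_tensor (Φ := fun T => lval v p (T ++ q.drop (i + n + 1)))]
  · refine sumL_congr _ fun t _ => ?_
    rw [List.take_take, min_eq_left (by omega), List.drop_take, show i + n + 1 - i = n + 1 by omega]
  · intro T hl hT
    have h := (isPair_of_lval_ne_zero hT).2.1
    refine ⟨by rw [List.length_take]; omega, ?_⟩
    rw [← List.take_append_of_le_length (l₂ := q.drop (i + n + 1)) (by omega : i + 1 ≤ T.length)]
    exact h.2.take _

/-- A diagram without input fixes the only vertex of its source. -/
theorem sumL_one (Φ : List V → ℂ) {n : ℕ} (G : Hom Γ 0 n) (a : V) (u : List V) :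
    sumL 1 (fun t => Φ t * lval G t (a :: u)) = Φ [a] * lval G [a] (a :: u) := by
  refine sumL_single 1 [a] rfl _ fun l hl hne => ?_
  by_contra h
  have h := isPair_of_lval_ne_zero (right_ne_zero_of_mul h)
  obtain ⟨b, rfl⟩ := List.length_eq_one_iff.1 hl
  have := h.2.2.1
  simp only [List.head?_cons, Option.some_inj] at this
  exact hne (by rw [this])

theorem sumL_two (Φ : List V → ℂ) {n : ℕ} (G : Hom Γ 1 n) (a : V) (u : List V) :
    sumL 2 (fun t => Φ t * lval G t (a :: u)) =
      Φ [a, (a :: u).getLast (by simp)] * lval G [a, (a :: u).getLast (by simp)] (a :: u) := by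
  refine sumL_single 2 _ rfl _ fun l hl hne => ?_
  by_contra h
  have h := (isPair_of_lval_ne_zero (right_ne_zero_of_mul h)).2.2
  obtain ⟨b, c, rfl⟩ := List.length_eq_two.1 hl
  rw [List.getLast?_eq_some_getLast (l := a :: u) (by simp)] at h
  simp only [List.head?_cons, Option.some_inj, List.getLast?_cons_cons,
      List.getLast?_singleton] at h
  exact hne (by rw [h.1, h.2])

theorem sumL_three (Φ : List V → ℂ) {n : ℕ} (G : Hom Γ 2 n) (a : V) (u : List V) :
    sumL 3 (fun t => Φ t * lval G t (a :: u)) =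
      ∑ x, Φ [a, x, (a :: u).getLast (by simp)] *
        lval G [a, x, (a :: u).getLast (by simp)] (a :: u) := by
  have key : ∀ b x c, (b ≠ a ∨ c ≠ (a :: u).getLast (by simp)) →
      Φ [b, x, c] * lval G [b, x, c] (a :: u) = 0 := by
    intro b x c hne
    by_contra h
    have h := (isPair_of_lval_ne_zero (right_ne_zero_of_mul h)).2.2
    rw [List.getLast?_eq_some_getLast (l := a :: u) (by simp)] at h
    simp only [List.head?_cons, Option.some_inj, List.getLast?_cons_cons,
      List.getLast?_singleton] at h
    rcases hne with hne | hne
    · exact hne h.1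
    · exact hne h.2
  simp only [sumL]
  rw [Finset.sum_eq_single a]
  · refine Finset.sum_congr rfl fun x _ => ?_
    exact Finset.sum_eq_single _ (fun c _ hc => key _ _ _ (Or.inr hc)) (by simp)
  · intro b _ hb
    exact Finset.sum_eq_zero fun x _ => Finset.sum_eq_zero fun c _ => key _ _ _ (Or.inl hb)
  · simp

/-! ### Coordinates of the elementary diagrams -/

/-- The weight `√(λ_b / λ_a)` of the edge `a → b` in `ev` and `coev`, and `0` for a non-edge. -/
def edgeWeight (Γ : PFGraph V) (a b : V) : ℂ :=
  if Γ.adj a b = true then ((Real.sqrt (Γ.lam b / Γ.lam a) : ℝ) : ℂ) else 0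

theorem isPathList_two {a b c : V} :
    IsPathList Γ 2 [a, b, c] ↔ Γ.adj a b = true ∧ Γ.adj b c = true := by
  simp [IsPathList]

theorem lval_ev (a b c d : V) :
    lval (ev : Hom Γ 2 0) [a, b, c] [d] = if c = a ∧ d = a then edgeWeight Γ a b else 0 := by
  by_cases h : IsPair Γ 2 0 [a, b, c] [d]
  · have h' := h
    obtain ⟨x, h1, h2⟩ := isPair_iff.1 h
    rw [← h1, ← h2, lval_verts, ev]
    obtain ⟨h3, -, h4, h5⟩ := h'
    rw [isPathList_two] at h3
    simp only [List.head?_cons, Option.some_inj, List.getLast?_cons_cons,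
      List.getLast?_singleton] at h4 h5
    rw [if_pos ⟨by rw [h5, h4], h4.symm⟩, edgeWeight, if_pos h3.1]
    have e0 : x.1.1.1 0 = a := by
      have := congrArg (fun l => l[0]?) h1
      simpa [verts] using this
    have e1 : x.1.1.1 1 = b := by
      have := congrArg (fun l => l[1]?) h1
      simpa [verts] using this
    rw [e0, e1]
  · rw [lval_of_not_isPair _ h]
    split_ifs with h'
    · obtain ⟨rfl, rfl⟩ := h'
      rw [edgeWeight, if_neg]
      intro h1
      refine h ⟨?_, by simp [IsPathList], rfl, rfl⟩
      rw [isPathList_two]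
      exact ⟨h1, by rw [Γ.symm]; exact h1⟩
    · rfl

theorem lval_coev (a b c d : V) :
    lval (coev : Hom Γ 0 2) [d] [a, b, c] = if c = a ∧ d = a then edgeWeight Γ a b else 0 := by
  by_cases h : IsPair Γ 0 2 [d] [a, b, c]
  · have h' := h
    obtain ⟨x, h1, h2⟩ := isPair_iff.1 h
    rw [← h1, ← h2, lval_verts, coev]
    obtain ⟨-, h3, h4, h5⟩ := h'
    rw [isPathList_two] at h3
    simp only [List.head?_cons, Option.some_inj, List.getLast?_cons_cons,
      List.getLast?_singleton] at h4 h5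
    rw [if_pos ⟨by rw [← h5, h4], h4⟩, edgeWeight, if_pos h3.1]
    have e0 : x.1.2.1 0 = a := by
      have := congrArg (fun l => l[0]?) h2
      simpa [verts] using this
    have e1 : x.1.2.1 1 = b := by
      have := congrArg (fun l => l[1]?) h2
      simpa [verts] using this
    rw [e0, e1]
  · rw [lval_of_not_isPair _ h]
    split_ifs with h'
    · obtain ⟨rfl, rfl⟩ := h'
      rw [edgeWeight, if_neg]
      intro h1
      refine h ⟨by simp [IsPathList], ?_, rfl, rfl⟩
      rw [isPathList_two]
      exact ⟨h1, by rw [Γ.symm]; exact h1⟩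
    · rfl

theorem lval_add {m n : ℕ} (f g : Hom Γ m n) (p q : List V) :
    lval (f + g) p q = lval f p q + lval g p q := by
  by_cases h : IsPair Γ m n p q
  · obtain ⟨x, rfl, rfl⟩ := isPair_iff.1 h
    simp only [lval_verts, Pi.add_apply]
  · simp only [lval_of_not_isPair _ h, add_zero]

theorem lval_smul {m n : ℕ} (c : ℂ) (f : Hom Γ m n) (p q : List V) :
    lval (c • f) p q = c * lval f p q := by
  by_cases h : IsPair Γ m n p q
  · obtain ⟨x, rfl, rfl⟩ := isPair_iff.1 h
    simp only [lval_verts, Pi.smul_apply, smul_eq_mul]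
  · simp only [lval_of_not_isPair _ h, mul_zero]

/-- Both paths of a pair end at the same vertex. -/
theorem lval_eq_zero_of_ne {m n : ℕ} {f : Hom Γ m n} {p q : List V}
    (h : p.getLast? ≠ q.getLast?) : lval f p q = 0 :=
  lval_of_not_isPair _ fun h' => h h'.2.2.2

/-- Both paths of a pair start at the same vertex. -/
theorem lval_eq_zero_of_head_ne {m n : ℕ} {f : Hom Γ m n} {p q : List V}
    (h : p.head? ≠ q.head?) : lval f p q = 0 :=
  lval_of_not_isPair _ fun h' => h h'.2.2.1

theorem lval_right3 (v : Hom Γ 0 3) (a b c : V) :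
    lval (right3 v) [a] [a, b, c, a] =
      edgeWeight Γ a b * edgeWeight Γ a b * lval v [b] [b, c, a, b] := by
  have h1 : ∀ x, lval (coev ⨾ (idm 1 ⊠ v ⊠ idm 1)) [a] [a, b, c, a, x, a] =
      lval coev [a] [a, b, a] * lval v [b] [b, c, a, x] := fun x => by
    rw [lval_comp_idm_tensor_idm (i := 1) (j := 1) (m := 0) (n := 3)]
    simp only [List.take, List.drop, List.cons_append, List.nil_append]
    rw [sumL_one]
    rfl
  rw [right3, lval_comp_idm_tensor (i := 3) (m := 2) (n := 0)]
  simp only [List.take, List.drop, List.cons_append, List.nil_append]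
  rw [sumL_three]
  simp only [List.getLast, List.cons_append, List.nil_append]
  rw [Finset.sum_eq_single b]
  · simp only [h1, lval_ev, lval_coev, and_self, if_true]
    ring
  · intro x _ hx
    rw [h1, lval_eq_zero_of_ne (f := v) (by simp [Ne.symm hx])]
    ring
  · simp

theorem lval_right4 (v : Hom Γ 0 4) (a b c d : V) :
    lval (right4 v) [a] [a, b, c, d, a] =
      edgeWeight Γ a b * edgeWeight Γ a b * lval v [b] [b, c, d, a, b] := by
  have h1 : ∀ x, lval (coev ⨾ (idm 1 ⊠ v ⊠ idm 1)) [a] [a, b, c, d, a, x, a] =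
      lval coev [a] [a, b, a] * lval v [b] [b, c, d, a, x] := fun x => by
    rw [lval_comp_idm_tensor_idm (i := 1) (j := 1) (m := 0) (n := 4)]
    simp only [List.take, List.drop, List.cons_append, List.nil_append]
    rw [sumL_one]
    rfl
  rw [right4, lval_comp_idm_tensor (i := 4) (m := 2) (n := 0)]
  simp only [List.take, List.drop, List.cons_append, List.nil_append]
  rw [sumL_three]
  simp only [List.getLast, List.cons_append, List.nil_append]
  rw [Finset.sum_eq_single b]
  · simp only [h1, lval_ev, lval_coev, and_self, if_true]
    ring
  · intro x _ hx
    rw [h1, lval_eq_zero_of_ne (f := v) (by simp [Ne.symm hx])]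
    ring
  · simp

theorem lval_right5 (v : Hom Γ 0 5) (a b c d e : V) :
    lval (right5 v) [a] [a, b, c, d, e, a] =
      edgeWeight Γ a b * edgeWeight Γ a b * lval v [b] [b, c, d, e, a, b] := by
  have h1 : ∀ x, lval (coev ⨾ (idm 1 ⊠ v ⊠ idm 1)) [a] [a, b, c, d, e, a, x, a] =
      lval coev [a] [a, b, a] * lval v [b] [b, c, d, e, a, x] := fun x => by
    rw [lval_comp_idm_tensor_idm (i := 1) (j := 1) (m := 0) (n := 5)]
    simp only [List.take, List.drop, List.cons_append, List.nil_append]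
    rw [sumL_one]
    rfl
  rw [right5, lval_comp_idm_tensor (i := 5) (m := 2) (n := 0)]
  simp only [List.take, List.drop, List.cons_append, List.nil_append]
  rw [sumL_three]
  simp only [List.getLast, List.cons_append, List.nil_append]
  rw [Finset.sum_eq_single b]
  · simp only [h1, lval_ev, lval_coev, and_self, if_true]
    ring
  · intro x _ hx
    rw [h1, lval_eq_zero_of_ne (f := v) (by simp [Ne.symm hx])]
    ring
  · simp

theorem lval_nest (a b c d : V) :
    lval (nest : Hom Γ 0 4) [a] [a, b, c, d, a] =
      if d = b then edgeWeight Γ a b * edgeWeight Γ b c else 0 := by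
  rw [nest, lval_comp_idm_tensor_idm (i := 1) (j := 1) (m := 0) (n := 2)]
  simp only [List.take, List.drop, List.cons_append, List.nil_append]
  rw [sumL_one]
  simp only [List.cons_append, List.nil_append, lval_coev, and_true, if_true, and_self]
  split_ifs <;> ring

theorem lval_bend22 (f : Hom Γ 2 2) (a b c d : V) :
    lval (bend22 f) [a] [a, b, c, d, a] =
      edgeWeight Γ a d * edgeWeight Γ d c * lval f [a, d, c] [a, b, c] := by
  rw [bend22, lval_comp_tensor_idm (j := 2) (m := 2) (n := 2)]
  simp only [List.take, List.drop, List.cons_append, List.nil_append]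
  rw [sumL_three]
  simp only [List.getLast, List.cons_append, List.nil_append, lval_nest]
  rw [Finset.sum_eq_single d]
  · rw [if_pos rfl]
  · intro x _ hx
    rw [if_neg (Ne.symm hx), zero_mul]
  · simp

theorem lval_bend21 (f : Hom Γ 2 1) (a b c : V) :
    lval (bend21 f) [a] [a, b, c, a] =
      edgeWeight Γ a c * edgeWeight Γ c b * lval f [a, c, b] [a, b] := by
  rw [bend21, lval_comp_tensor_idm (j := 2) (m := 2) (n := 1)]
  simp only [List.take, List.drop, List.cons_append, List.nil_append]
  rw [sumL_three]
  simp only [List.getLast, List.cons_append, List.nil_append, lval_nest]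
  rw [Finset.sum_eq_single c]
  · rw [if_pos rfl]
  · intro x _ hx
    rw [if_neg (Ne.symm hx), zero_mul]
  · simp

theorem lval_idm_one (a b c d : V) : lval (idm 1 : Hom Γ 1 1) [a, b] [c, d] =
    if Γ.adj a b = true ∧ a = c ∧ b = d then 1 else 0 := by
  classical
  rw [lval_idm, Set.indicator_apply]
  simp [IsPathList, and_assoc]

theorem lval_split (u : Hom Γ 0 3) (a c d : V) :
    lval (split u) [a, c] [a, d, c] = edgeWeight Γ a c * lval u [c] [c, a, d, c] := by
  rw [split, lval_comp_tensor_idm (j := 2) (m := 2) (n := 0)]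
  simp only [List.take, List.drop, List.cons_append, List.nil_append]
  rw [sumL_three]
  simp only [List.getLast, List.cons_append, List.nil_append]
  have h1 : ∀ x, lval (idm 1 ⊠ u) [a, c] [a, x, a, d, c] =
      lval (idm 1 : Hom Γ 1 1) [a, c] [a, x] * lval u [c] [x, a, d, c] := fun x => by
    rw [lval_tensor (m := 1) (n := 1) (m' := 0) (n' := 3)]
    rfl
  rw [Finset.sum_eq_single c]
  · rw [h1, lval_idm_one, lval_ev, edgeWeight]
    by_cases h : Γ.adj a c = true
    · simp [h, mul_comm]
    · simp [h]
  · intro x _ hx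
    rw [h1, lval_idm_one, if_neg (by simp [Ne.symm hx])]
    ring
  · simp

theorem lval_coev_tensor_coev (a b c d : V) :
    lval (coev ⊠ coev : Hom Γ 0 4) [a] [a, b, c, d, a] =
      if c = a then edgeWeight Γ a b * edgeWeight Γ a d else 0 := by
  rw [lval_tensor (m := 0) (n := 2) (m' := 0) (n' := 2)]
  simp only [List.take, List.drop, List.cons_append, List.nil_append]
  rw [lval_coev, lval_coev]
  by_cases h : c = a
  · subst h; simp
  · simp [h]

theorem lval_coev_tensor (u : Hom Γ 0 3) (a b c d e : V) :
    lval (coev ⊠ u : Hom Γ 0 5) [a] [a, b, c, d, e, a] =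
      if c = a then edgeWeight Γ a b * lval u [a] [a, d, e, a] else 0 := by
  rw [lval_tensor (m := 0) (n := 2) (m' := 0) (n' := 3)]
  simp only [List.take, List.drop, List.cons_append, List.nil_append]
  rw [lval_coev]
  by_cases h : c = a
  · subst h; simp
  · simp [h]

theorem lval_graft4 (v : Hom Γ 0 3) (g : Hom Γ 1 2) (a b c d : V) :
    lval (v ⨾ (idm 2 ⊠ g :) : Hom Γ 0 4) [a] [a, b, c, d, a] =
      lval v [a] [a, b, c, a] * lval g [c, a] [c, d, a] := by
  rw [lval_comp_idm_tensor (i := 2) (m := 1) (n := 2)]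
  simp only [List.take, List.drop, List.cons_append, List.nil_append]
  rw [sumL_two]
  rfl

theorem lval_graft5 (v : Hom Γ 0 4) (g : Hom Γ 1 2) (a b c d e : V) :
    lval (v ⨾ (idm 3 ⊠ g :) : Hom Γ 0 5) [a] [a, b, c, d, e, a] =
      lval v [a] [a, b, c, d, a] * lval g [d, a] [d, e, a] := by
  rw [lval_comp_idm_tensor (i := 3) (m := 1) (n := 2)]
  simp only [List.take, List.drop, List.cons_append, List.nil_append]
  rw [sumL_two]
  rfl

theorem lval_bigon (T : Hom Γ 2 1) (v : Hom Γ 0 3) (a b : V) :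
    lval (bigon T v) [a, b] [a, b] =
      ∑ c, lval (split v) [a, b] [a, c, b] * lval T [a, c, b] [a, b] := by
  rw [bigon, lval_comp, sumL_three]
  simp only [List.getLast]

theorem lval_coev_split (g : Hom Γ 1 2) (a b x : V) :
    lval (coev ⨾ (g ⊠ idm 1)) [a] [a, b, x, a] =
      edgeWeight Γ a x * lval g [a, x] [a, b, x] := by
  rw [lval_comp_tensor_idm (j := 1) (m := 1) (n := 2)]
  simp only [List.take, List.drop, List.cons_append, List.nil_append]
  rw [sumL_two]
  simp [List.getLast, lval_coev]

theorem lval_comp_split1 (F : Hom Γ 0 3) (g : Hom Γ 1 2) (a b c x : V) :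
    lval (F ⨾ (idm 1 ⊠ g ⊠ idm 1 :)) [a] [a, b, c, x, a] =
      lval F [a] [a, b, x, a] * lval g [b, x] [b, c, x] := by
  rw [lval_comp_idm_tensor_idm (i := 1) (j := 1) (m := 1) (n := 2)]
  simp only [List.take, List.drop, List.cons_append, List.nil_append]
  rw [sumL_two]
  rfl

theorem lval_comp_split2 (F : Hom Γ 0 4) (g : Hom Γ 1 2) (a b c d x : V) :
    lval (F ⨾ (idm 2 ⊠ g ⊠ idm 1 :)) [a] [a, b, c, d, x, a] =
      lval F [a] [a, b, c, x, a] * lval g [c, x] [c, d, x] := by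
  rw [lval_comp_idm_tensor_idm (i := 2) (j := 1) (m := 1) (n := 2)]
  simp only [List.take, List.drop, List.cons_append, List.nil_append]
  rw [sumL_two]
  rfl

theorem lval_comp_split3 (F : Hom Γ 0 5) (g : Hom Γ 1 2) (a b c d e x : V) :
    lval (F ⨾ (idm 3 ⊠ g ⊠ idm 1 :)) [a] [a, b, c, d, e, x, a] =
      lval F [a] [a, b, c, d, x, a] * lval g [d, x] [d, e, x] := by
  rw [lval_comp_idm_tensor_idm (i := 3) (j := 1) (m := 1) (n := 2)]
  simp only [List.take, List.drop, List.cons_append, List.nil_append]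
  rw [sumL_two]
  rfl

/-- The inner region `x` of a polygon is the only free region: the coordinates of a trigon are sums
over `x`. -/
theorem lval_trigon (T : Hom Γ 2 1) (v : Hom Γ 0 3) (a b c : V) :
    lval (trigon T v) [a] [a, b, c, a] = ∑ x, edgeWeight Γ a x *
      lval (split v) [a, x] [a, b, x] * lval (split (bend21 T)) [b, x] [b, c, x] *
      lval T [c, x, a] [c, a] := by
  rw [trigon, lval_comp_idm_tensor (i := 2) (m := 2) (n := 1)]
  simp only [List.take, List.drop, List.cons_append, List.nil_append]
  rw [sumL_three]
  simp only [List.getLast, List.cons_append, List.nil_append]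
  refine Finset.sum_congr rfl fun x _ => ?_
  rw [lval_comp_split1, lval_coev_split]

theorem lval_tetragon (T : Hom Γ 2 1) (v : Hom Γ 0 3) (a b c d : V) :
    lval (tetragon T v) [a] [a, b, c, d, a] = ∑ x, edgeWeight Γ a x *
      lval (split v) [a, x] [a, b, x] * lval (split (bend21 T)) [b, x] [b, c, x] *
      lval (split (bend21 T)) [c, x] [c, d, x] *
      lval T [d, x, a] [d, a] := by
  rw [tetragon, lval_comp_idm_tensor (i := 3) (m := 2) (n := 1)]
  simp only [List.take, List.drop, List.cons_append, List.nil_append]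
  rw [sumL_three]
  simp only [List.getLast, List.cons_append, List.nil_append]
  refine Finset.sum_congr rfl fun x _ => ?_
  rw [lval_comp_split2, lval_comp_split1, lval_coev_split]

theorem lval_pentagon (T : Hom Γ 2 1) (v : Hom Γ 0 3) (a b c d e : V) :
    lval (pentagon T v) [a] [a, b, c, d, e, a] = ∑ x, edgeWeight Γ a x *
      lval (split v) [a, x] [a, b, x] * lval (split (bend21 T)) [b, x] [b, c, x] *
      lval (split (bend21 T)) [c, x] [c, d, x] *
      lval (split (bend21 T)) [d, x] [d, e, x] *
      lval T [e, x, a] [e, a] := by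
  rw [pentagon, lval_comp_idm_tensor (i := 4) (m := 2) (n := 1)]
  simp only [List.take, List.drop, List.cons_append, List.nil_append]
  rw [sumL_three]
  simp only [List.getLast, List.cons_append, List.nil_append]
  refine Finset.sum_congr rfl fun x _ => ?_
  rw [lval_comp_split3, lval_comp_split2, lval_comp_split1, lval_coev_split]

theorem lval_act3_1 (R : Hom Γ 2 2) (v : Hom Γ 0 3) (a b c : V) :
    lval (v ⨾ (R ⊠ idm 1) : Hom Γ 0 3) [a] [a, b, c, a] =
      ∑ x, lval v [a] [a, x, c, a] * lval R [a, x, c] [a, b, c] := by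
  rw [lval_comp_tensor_idm (j := 1) (m := 2) (n := 2)]
  simp only [List.take, List.drop, List.cons_append, List.nil_append]
  rw [sumL_three]
  rfl

theorem lval_act3_2 (R : Hom Γ 2 2) (v : Hom Γ 0 3) (a b c : V) :
    lval (v ⨾ (idm 1 ⊠ R) : Hom Γ 0 3) [a] [a, b, c, a] =
      ∑ x, lval v [a] [a, b, x, a] * lval R [b, x, a] [b, c, a] := by
  rw [lval_comp_idm_tensor (i := 1) (m := 2) (n := 2)]
  simp only [List.take, List.drop, List.cons_append, List.nil_append]
  rw [sumL_three]
  rfl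

theorem lval_act4_1 (R : Hom Γ 2 2) (v : Hom Γ 0 4) (a b c d : V) :
    lval (v ⨾ (R ⊠ idm 2) : Hom Γ 0 4) [a] [a, b, c, d, a] =
      ∑ x, lval v [a] [a, x, c, d, a] * lval R [a, x, c] [a, b, c] := by
  rw [lval_comp_tensor_idm (j := 2) (m := 2) (n := 2)]
  simp only [List.take, List.drop, List.cons_append, List.nil_append]
  rw [sumL_three]
  rfl

theorem lval_act4_2 (R : Hom Γ 2 2) (v : Hom Γ 0 4) (a b c d : V) :
    lval (v ⨾ (idm 1 ⊠ R ⊠ idm 1) : Hom Γ 0 4) [a] [a, b, c, d, a] =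
      ∑ x, lval v [a] [a, b, x, d, a] * lval R [b, x, d] [b, c, d] := by
  rw [lval_comp_idm_tensor_idm (i := 1) (j := 1) (m := 2) (n := 2)]
  simp only [List.take, List.drop, List.cons_append, List.nil_append]
  rw [sumL_three]
  rfl

theorem lval_act5_1 (R : Hom Γ 2 2) (v : Hom Γ 0 5) (a b c d e : V) :
    lval (v ⨾ (R ⊠ idm 3) : Hom Γ 0 5) [a] [a, b, c, d, e, a] =
      ∑ x, lval v [a] [a, x, c, d, e, a] * lval R [a, x, c] [a, b, c] := by
  rw [lval_comp_tensor_idm (j := 3) (m := 2) (n := 2)]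
  simp only [List.take, List.drop, List.cons_append, List.nil_append]
  rw [sumL_three]
  rfl

theorem lval_act5_2 (R : Hom Γ 2 2) (v : Hom Γ 0 5) (a b c d e : V) :
    lval (v ⨾ (idm 1 ⊠ R ⊠ idm 2) : Hom Γ 0 5) [a] [a, b, c, d, e, a] =
      ∑ x, lval v [a] [a, b, x, d, e, a] * lval R [b, x, d] [b, c, d] := by
  rw [lval_comp_idm_tensor_idm (i := 1) (j := 2) (m := 2) (n := 2)]
  simp only [List.take, List.drop, List.cons_append, List.nil_append]
  rw [sumL_three]
  rfl

theorem lval_act5_3 (R : Hom Γ 2 2) (v : Hom Γ 0 5) (a b c d e : V) :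
    lval (v ⨾ (idm 2 ⊠ R ⊠ idm 1) : Hom Γ 0 5) [a] [a, b, c, d, e, a] =
      ∑ x, lval v [a] [a, b, c, x, e, a] * lval R [c, x, e] [c, d, e] := by
  rw [lval_comp_idm_tensor_idm (i := 2) (j := 1) (m := 2) (n := 2)]
  simp only [List.take, List.drop, List.cons_append, List.nil_append]
  rw [sumL_three]
  rfl

theorem lval_act5_4 (R : Hom Γ 2 2) (v : Hom Γ 0 5) (a b c d e : V) :
    lval (v ⨾ (idm 3 ⊠ R) : Hom Γ 0 5) [a] [a, b, c, d, e, a] =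
      ∑ x, lval v [a] [a, b, c, d, x, a] * lval R [d, x, a] [d, e, a] := by
  rw [lval_comp_idm_tensor (i := 3) (m := 2) (n := 2)]
  simp only [List.take, List.drop, List.cons_append, List.nil_append]
  rw [sumL_three]
  rfl

theorem lval_rotCW (f : Hom Γ 2 2) (x b z a : V) :
    lval (rotCW f) [x, b, z] [x, a, z] =
      edgeWeight Γ x a * edgeWeight Γ z b * lval f [a, x, b] [a, z, b] := by
  have h0 : ∀ y c, lval (coev ⊠ idm 2 : Hom Γ 2 4) [x, b, z] [x, a, y, c, z] =
      if y = x then edgeWeight Γ x a * lval (idm 2 : Hom Γ 2 2) [x, b, z] [x, c, z] else 0 := by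
    intro y c
    rw [lval_tensor (m := 0) (n := 2) (m' := 2) (n' := 2)]
    simp only [List.take, List.drop]
    rw [lval_coev]
    by_cases h : y = x
    · subst h; simp
    · simp [h]
  have h1 : ∀ y c, lval ((coev ⊠ idm 2) ⨾ (idm 1 ⊠ f ⊠ idm 1 :)) [x, b, z] [x, a, y, c, z] =
      edgeWeight Γ x a * lval (idm 2 : Hom Γ 2 2) [x, b, z] [x, c, z] *
        lval f [a, x, c] [a, y, c] := fun y c => by
    rw [lval_comp_idm_tensor_idm (i := 1) (j := 1) (m := 2) (n := 2)]
    simp only [List.take, List.drop, List.cons_append, List.nil_append]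
    rw [sumL_three]
    simp only [List.getLast, List.cons_append, List.nil_append, h0]
    simp
  rw [rotCW, lval_comp_idm_tensor (i := 2) (m := 2) (n := 0)]
  simp only [List.take, List.drop, List.cons_append, List.nil_append]
  rw [sumL_three]
  simp only [List.getLast, List.cons_append, List.nil_append, h1, lval_ev, and_self, if_true]
  rw [Finset.sum_eq_single b]
  · by_cases hf : lval f [a, x, b] [a, z, b] = 0
    · rw [hf]; ring
    · have h2 := isPair_of_lval_ne_zero hf
      have hp : IsPathList Γ 2 [x, b, z] :=
        isPathList_two.2 ⟨(isPathList_two.1 h2.1).2, by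
          rw [Γ.symm]; exact (isPathList_two.1 h2.2.1).2⟩
      rw [lval_idm_self hp]; ring
  · intro c _ hc
    rw [lval_idm_of_ne (by simp [Ne.symm hc])]; ring
  · simp

theorem lval_rotCCW (f : Hom Γ 2 2) (x b z a : V) :
    lval (rotCCW f) [x, b, z] [x, a, z] =
      edgeWeight Γ z a * edgeWeight Γ x b * lval f [b, z, a] [b, x, a] := by
  have h0 : ∀ y c, lval (idm 2 ⊠ coev : Hom Γ 2 4) [x, b, z] [x, c, y, a, z] =
      if y = z then edgeWeight Γ z a * lval (idm 2 : Hom Γ 2 2) [x, b, z] [x, c, z] else 0 := by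
    intro y c
    rw [lval_tensor (m := 2) (n := 2) (m' := 0) (n' := 2)]
    simp only [List.take, List.drop]
    rw [lval_coev]
    by_cases h : y = z
    · subst h; simp [mul_comm]
    · simp [h, Ne.symm h]
  have h1 : ∀ y c, lval ((idm 2 ⊠ coev) ⨾ (idm 1 ⊠ f ⊠ idm 1 :)) [x, b, z] [x, c, y, a, z] =
      edgeWeight Γ z a * lval (idm 2 : Hom Γ 2 2) [x, b, z] [x, c, z] *
        lval f [c, z, a] [c, y, a] := fun y c => by
    rw [lval_comp_idm_tensor_idm (i := 1) (j := 1) (m := 2) (n := 2)]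
    simp only [List.take, List.drop, List.cons_append, List.nil_append]
    rw [sumL_three]
    simp only [List.getLast, List.cons_append, List.nil_append, h0]
    simp
  rw [rotCCW, lval_comp_tensor_idm (j := 2) (m := 2) (n := 0)]
  simp only [List.take, List.drop, List.cons_append, List.nil_append]
  rw [sumL_three]
  simp only [List.getLast, List.cons_append, List.nil_append, h1, lval_ev, and_self, if_true]
  rw [Finset.sum_eq_single b]
  · by_cases hf : lval f [b, z, a] [b, x, a] = 0
    · rw [hf]; ring
    · have h2 := isPair_of_lval_ne_zero hf
      have hp : IsPathList Γ 2 [x, b, z] :=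
        isPathList_two.2 ⟨by rw [Γ.symm]; exact (isPathList_two.1 h2.2.1).1,
          (isPathList_two.1 h2.1).1⟩
      rw [lval_idm_self hp]; ring
  · intro c _ hc
    rw [lval_idm_of_ne (by simp [Ne.symm hc])]; ring
  · simp

/-! ### Extensionality for morphisms with few boundary points -/

theorem hom_ext_0_0 {f g : Hom Γ 0 0}
    (h : ∀ a, IsPair Γ 0 0 [a] [a] → lval f [a] [a] = lval g [a] [a]) : f = g := by
  refine hom_ext fun p q hpq => ?_
  have hpq' := hpq
  obtain ⟨⟨h1, -⟩, ⟨h2, -⟩, h4, h5⟩ := hpq'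
  match p, q, h1, h2 with
  | [p0], [q0], _, _ =>
    simp only [List.head?_cons, Option.some_inj, List.getLast?_singleton] at h4 h5
    subst h4
    exact h _ hpq

theorem hom_ext_1_1 {f g : Hom Γ 1 1}
    (h : ∀ a b, IsPair Γ 1 1 [a, b] [a, b] → lval f [a, b] [a, b] = lval g [a, b] [a, b]) : f = g := by
  refine hom_ext fun p q hpq => ?_
  have hpq' := hpq
  obtain ⟨⟨h1, -⟩, ⟨h2, -⟩, h4, h5⟩ := hpq'
  match p, q, h1, h2 with
  | [p0, p1], [q0, q1], _, _ =>
    simp only [List.head?_cons, Option.some_inj, List.getLast?_cons_cons,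
      List.getLast?_singleton] at h4 h5
    subst h4
    subst h5
    exact h _ _ hpq

theorem hom_ext_2_2 {f g : Hom Γ 2 2}
    (h : ∀ a x y b, IsPair Γ 2 2 [a, x, b] [a, y, b] → lval f [a, x, b] [a, y, b] =
        lval g [a, x, b] [a, y, b]) : f = g := by
  refine hom_ext fun p q hpq => ?_
  have hpq' := hpq
  obtain ⟨⟨h1, -⟩, ⟨h2, -⟩, h4, h5⟩ := hpq'
  match p, q, h1, h2 with
  | [p0, p1, p2], [q0, q1, q2], _, _ =>
    simp only [List.head?_cons, Option.some_inj, List.getLast?_cons_cons,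
      List.getLast?_singleton] at h4 h5
    subst h4
    subst h5
    exact h _ _ _ _ hpq

theorem hom_ext_0_2 {f g : Hom Γ 0 2}
    (h : ∀ a y, IsPair Γ 0 2 [a] [a, y, a] → lval f [a] [a, y, a] = lval g [a] [a, y, a]) : f = g := by
  refine hom_ext fun p q hpq => ?_
  have hpq' := hpq
  obtain ⟨⟨h1, -⟩, ⟨h2, -⟩, h4, h5⟩ := hpq'
  match p, q, h1, h2 with
  | [p0], [q0, q1, q2], _, _ =>
    simp only [List.head?_cons, Option.some_inj, List.getLast?_cons_cons,
      List.getLast?_singleton] at h4 h5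
    subst h4
    subst h5
    exact h _ _ hpq

theorem hom_ext_2_0 {f g : Hom Γ 2 0}
    (h : ∀ a x, IsPair Γ 2 0 [a, x, a] [a] → lval f [a, x, a] [a] = lval g [a, x, a] [a]) : f = g := by
  refine hom_ext fun p q hpq => ?_
  have hpq' := hpq
  obtain ⟨⟨h1, -⟩, ⟨h2, -⟩, h4, h5⟩ := hpq'
  match p, q, h1, h2 with
  | [p0, p1, p2], [q0], _, _ =>
    simp only [List.head?_cons, Option.some_inj, List.getLast?_cons_cons,
      List.getLast?_singleton] at h4 h5
    subst h4
    subst h5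
    exact h _ _ hpq

theorem hom_ext_2_1 {f g : Hom Γ 2 1}
    (h : ∀ a x b, IsPair Γ 2 1 [a, x, b] [a, b] → lval f [a, x, b] [a, b] = lval g [a, x, b] [a, b])
        : f = g := by
  refine hom_ext fun p q hpq => ?_
  have hpq' := hpq
  obtain ⟨⟨h1, -⟩, ⟨h2, -⟩, h4, h5⟩ := hpq'
  match p, q, h1, h2 with
  | [p0, p1, p2], [q0, q1], _, _ =>
    simp only [List.head?_cons, Option.some_inj, List.getLast?_cons_cons,
      List.getLast?_singleton] at h4 h5
    subst h4
    subst h5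
    exact h _ _ _ hpq

theorem hom_ext_1_2 {f g : Hom Γ 1 2}
    (h : ∀ a y b, IsPair Γ 1 2 [a, b] [a, y, b] → lval f [a, b] [a, y, b] = lval g [a, b] [a, y, b])
        : f = g := by
  refine hom_ext fun p q hpq => ?_
  have hpq' := hpq
  obtain ⟨⟨h1, -⟩, ⟨h2, -⟩, h4, h5⟩ := hpq'
  match p, q, h1, h2 with
  | [p0, p1], [q0, q1, q2], _, _ =>
    simp only [List.head?_cons, Option.some_inj, List.getLast?_cons_cons,
      List.getLast?_singleton] at h4 h5
    subst h4
    subst h5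
    exact h _ _ _ hpq

theorem hom_ext_3_3 {f g : Hom Γ 3 3}
    (h : ∀ a x1 x2 y1 y2 b, IsPair Γ 3 3 [a, x1, x2, b] [a, y1, y2, b] →
        lval f [a, x1, x2, b] [a, y1, y2, b] = lval g [a, x1, x2, b] [a, y1, y2, b]) : f = g := by
  refine hom_ext fun p q hpq => ?_
  have hpq' := hpq
  obtain ⟨⟨h1, -⟩, ⟨h2, -⟩, h4, h5⟩ := hpq'
  match p, q, h1, h2 with
  | [p0, p1, p2, p3], [q0, q1, q2, q3], _, _ =>
    simp only [List.head?_cons, Option.some_inj, List.getLast?_cons_cons,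
      List.getLast?_singleton] at h4 h5
    subst h4
    subst h5
    exact h _ _ _ _ _ _ hpq

theorem hom_ext_4_4 {f g : Hom Γ 4 4}
    (h : ∀ a x1 x2 x3 y1 y2 y3 b, IsPair Γ 4 4 [a, x1, x2, x3, b] [a, y1, y2, y3, b] →
        lval f [a, x1, x2, x3, b] [a, y1, y2, y3, b] = lval g [a, x1, x2, x3, b] [a, y1, y2, y3, b])
        : f = g := by
  refine hom_ext fun p q hpq => ?_
  have hpq' := hpq
  obtain ⟨⟨h1, -⟩, ⟨h2, -⟩, h4, h5⟩ := hpq'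
  match p, q, h1, h2 with
  | [p0, p1, p2, p3, p4], [q0, q1, q2, q3, q4], _, _ =>
    simp only [List.head?_cons, Option.some_inj, List.getLast?_cons_cons,
      List.getLast?_singleton] at h4 h5
    subst h4
    subst h5
    exact h _ _ _ _ _ _ _ _ hpq

theorem hom_ext_0_1 {f g : Hom Γ 0 1} (h : ∀ a, lval f [a] [a, a] = lval g [a] [a, a]) : f = g := by
  refine hom_ext fun p q hpq => ?_
  obtain ⟨⟨h1, -⟩, ⟨h2, -⟩, h4, h5⟩ := hpq
  match p, q, h1, h2 with
  | [a], [b, c], _, _ =>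
    simp only [List.head?_cons, Option.some_inj, List.getLast?_cons_cons,
      List.getLast?_singleton] at h4 h5
    subst h4
    subst h5
    exact h _

/-! ### Coordinates that are compatible with rotations -/

/-- Data for a change of basis in the graph planar algebra. -/
structure Gauge (Γ : PFGraph V) where
  /-- Square roots of the Frobenius–Perron weights, up to a common factor. -/
  rt : V → ℂ
  /-- The factors by which the edges are rescaled. -/
  k : V → V → ℂ
  rt_ne : ∀ a, rt a ≠ 0
  k_ne : ∀ a b, k a b ≠ 0
  edge : ∀ a b, Γ.adj a b = true → edgeWeight Γ a b = rt b / rt a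

namespace Gauge
variable (G : Gauge Γ)

/-- The weight of an inner edge between the regions `a` and `b`. It is symmetric, and it collects the
factors that arise when the normalised coordinates of two diagrams are multiplied along the edge. -/
def wt (a b : V) : ℂ :=
  if Γ.adj a b = true then 1 / (G.rt a * G.rt b * (G.k a b * G.k b a)) else 0

/-- The weight of a strand between the regions `a` and `b`; on edges, the inverse of `wt`. -/
def iwt (a b : V) : ℂ :=
  if Γ.adj a b = true then G.rt a * G.rt b * (G.k a b * G.k b a) else 0

/-- The normalised trivalent vertex between the regions `a`, `b`, `c`: the normalised coordinates of
`bend21 T`, by `norm3_bend21`. -/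
def tri (T : Hom Γ 2 1) (a b c : V) : ℂ :=
  G.rt a * G.rt b * lval T [a, c, b] [a, b] * (G.k a b * G.k b c * G.k c a)

/-- The normalised coefficient of a red strand that crosses the region `b` between the regions `a`
and `c`; on the other side of the red strand, `b` becomes `σ b`. -/
def red (R : Hom Γ 2 2) (σ : V → V) (a b c : V) : ℂ :=
  lval R [a, σ b, c] [a, b, c] * (G.k a b * G.k b c) / (G.k a (σ b) * G.k (σ b) c)

/-- The coordinates of a diagram with `3` boundary points, normalised so that a rotation of the
diagram rotates its boundary regions. -/
def norm3 (v : Hom Γ 0 3) (a b c : V) : ℂ :=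
  G.rt a ^ 2 * lval v [a] [a, b, c, a] * (G.k a b * G.k b c * G.k c a)

theorem norm3_add (v w : Hom Γ 0 3) (a b c : V) :
    G.norm3 (v + w) a b c = G.norm3 v a b c + G.norm3 w a b c := by
  simp only [norm3, lval_add]; ring

theorem norm3_smul (z : ℂ) (v : Hom Γ 0 3) (a b c : V) :
    G.norm3 (z • v) a b c = z * G.norm3 v a b c := by
  simp only [norm3, lval_smul]; ring

theorem ext3 {v w : Hom Γ 0 3}
    (h : ∀ a b c, Γ.adj a b = true → Γ.adj b c = true → Γ.adj c a = true →
      G.norm3 v a b c = G.norm3 w a b c) : v = w := by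
  refine hom_ext fun p q hpq => ?_
  obtain ⟨⟨h1, -⟩, ⟨h2, h3⟩, h4, h5⟩ := hpq
  obtain ⟨x, rfl⟩ := List.length_eq_one_iff.1 h1
  match q, h2 with
  | [a, b, c, z], _ =>
    simp only [List.head?_cons, Option.some_inj, List.getLast?_cons_cons,
      List.getLast?_singleton] at h4 h5
    subst h4 h5
    simp only [List.isChain_cons_cons, List.isChain_singleton, and_true] at h3
    obtain ⟨e0, e1, e2⟩ := h3
    have := h _ _ _ e0 e1 e2
    simp only [norm3] at this
    refine mul_left_cancel₀ (pow_ne_zero 2 (G.rt_ne x)) (mul_right_cancel₀ ?_ this)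
    simp [G.k_ne]

theorem norm3_right3 (v : Hom Γ 0 3) (a b c : V) :
    G.norm3 (right3 v) a b c = G.norm3 v b c a := by
  rw [norm3, norm3, lval_right3]
  by_cases hv : lval v [b] [b, c, a, b] = 0
  · rw [hv]; ring
  · have h := (isPair_of_lval_ne_zero hv).2.1.2
    simp only [List.isChain_cons_cons] at h
    rw [G.edge a b h.2.2.1]
    have := G.rt_ne a
    field_simp

/-- The coordinates of a diagram with `4` boundary points, normalised so that a rotation of the
diagram rotates its boundary regions. -/
def norm4 (v : Hom Γ 0 4) (a b c d : V) : ℂ :=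
  G.rt a ^ 2 * lval v [a] [a, b, c, d, a] * (G.k a b * G.k b c * G.k c d * G.k d a)

theorem norm4_add (v w : Hom Γ 0 4) (a b c d : V) :
    G.norm4 (v + w) a b c d = G.norm4 v a b c d + G.norm4 w a b c d := by
  simp only [norm4, lval_add]; ring

theorem norm4_smul (z : ℂ) (v : Hom Γ 0 4) (a b c d : V) :
    G.norm4 (z • v) a b c d = z * G.norm4 v a b c d := by
  simp only [norm4, lval_smul]; ring

theorem ext4 {v w : Hom Γ 0 4}
    (h : ∀ a b c d, Γ.adj a b = true → Γ.adj b c = true → Γ.adj c d = true → Γ.adj d a = true →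
      G.norm4 v a b c d = G.norm4 w a b c d) : v = w := by
  refine hom_ext fun p q hpq => ?_
  obtain ⟨⟨h1, -⟩, ⟨h2, h3⟩, h4, h5⟩ := hpq
  obtain ⟨x, rfl⟩ := List.length_eq_one_iff.1 h1
  match q, h2 with
  | [a, b, c, d, z], _ =>
    simp only [List.head?_cons, Option.some_inj, List.getLast?_cons_cons,
      List.getLast?_singleton] at h4 h5
    subst h4 h5
    simp only [List.isChain_cons_cons, List.isChain_singleton, and_true] at h3
    obtain ⟨e0, e1, e2, e3⟩ := h3
    have := h _ _ _ _ e0 e1 e2 e3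
    simp only [norm4] at this
    refine mul_left_cancel₀ (pow_ne_zero 2 (G.rt_ne x)) (mul_right_cancel₀ ?_ this)
    simp [G.k_ne]

theorem norm4_right4 (v : Hom Γ 0 4) (a b c d : V) :
    G.norm4 (right4 v) a b c d = G.norm4 v b c d a := by
  rw [norm4, norm4, lval_right4]
  by_cases hv : lval v [b] [b, c, d, a, b] = 0
  · rw [hv]; ring
  · have h := (isPair_of_lval_ne_zero hv).2.1.2
    simp only [List.isChain_cons_cons] at h
    rw [G.edge a b h.2.2.2.1]
    have := G.rt_ne a
    field_simp

/-- The coordinates of a diagram with `5` boundary points, normalised so that a rotation of the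
diagram rotates its boundary regions. -/
def norm5 (v : Hom Γ 0 5) (a b c d e : V) : ℂ :=
  G.rt a ^ 2 * lval v [a] [a, b, c, d, e, a] * (G.k a b * G.k b c * G.k c d * G.k d e * G.k e a)

theorem norm5_add (v w : Hom Γ 0 5) (a b c d e : V) :
    G.norm5 (v + w) a b c d e = G.norm5 v a b c d e + G.norm5 w a b c d e := by
  simp only [norm5, lval_add]; ring

theorem norm5_smul (z : ℂ) (v : Hom Γ 0 5) (a b c d e : V) :
    G.norm5 (z • v) a b c d e = z * G.norm5 v a b c d e := by
  simp only [norm5, lval_smul]; ring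

theorem norm5_sum {ι : Type*} (s : Finset ι) (v : ι → Hom Γ 0 5) (a b c d e : V) :
    G.norm5 (∑ i ∈ s, v i) a b c d e = ∑ i ∈ s, G.norm5 (v i) a b c d e :=
  map_sum (AddMonoidHom.mk' (fun v => G.norm5 v a b c d e) fun v w => G.norm5_add v w a b c d e) v s

theorem ext5 {v w : Hom Γ 0 5}
    (h : ∀ a b c d e, Γ.adj a b = true → Γ.adj b c = true → Γ.adj c d = true →
      Γ.adj d e = true → Γ.adj e a = true → G.norm5 v a b c d e = G.norm5 w a b c d e) :
    v = w := by
  refine hom_ext fun p q hpq => ?_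
  obtain ⟨⟨h1, -⟩, ⟨h2, h3⟩, h4, h5⟩ := hpq
  obtain ⟨x, rfl⟩ := List.length_eq_one_iff.1 h1
  match q, h2 with
  | [a, b, c, d, e, z], _ =>
    simp only [List.head?_cons, Option.some_inj, List.getLast?_cons_cons,
      List.getLast?_singleton] at h4 h5
    subst h4 h5
    simp only [List.isChain_cons_cons, List.isChain_singleton, and_true] at h3
    obtain ⟨e0, e1, e2, e3, e4⟩ := h3
    have := h _ _ _ _ _ e0 e1 e2 e3 e4
    simp only [norm5] at this
    refine mul_left_cancel₀ (pow_ne_zero 2 (G.rt_ne x)) (mul_right_cancel₀ ?_ this)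
    simp [G.k_ne]

theorem norm5_right5 (v : Hom Γ 0 5) (a b c d e : V) :
    G.norm5 (right5 v) a b c d e = G.norm5 v b c d e a := by
  rw [norm5, norm5, lval_right5]
  by_cases hv : lval v [b] [b, c, d, e, a, b] = 0
  · rw [hv]; ring
  · have h := (isPair_of_lval_ne_zero hv).2.1.2
    simp only [List.isChain_cons_cons] at h
    rw [G.edge a b h.2.2.2.2.1]
    have := G.rt_ne a
    field_simp

theorem norm3_bend21 (T : Hom Γ 2 1) (a b c : V) : G.norm3 (bend21 T) a b c = G.tri T a b c := by
  rw [norm3, tri, lval_bend21]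
  by_cases hT : lval T [a, c, b] [a, b] = 0
  · rw [hT]; ring
  · have h := (isPair_of_lval_ne_zero hT).1.2
    simp only [List.isChain_cons_cons] at h
    rw [G.edge _ _ h.1, G.edge _ _ h.2.1]
    have := G.rt_ne a
    have := G.rt_ne c
    field_simp

/-- Grafting a tree onto a leg multiplies the normalised coordinates and the weight of the new inner
edge. -/
theorem norm4_graft (v u : Hom Γ 0 3) (a b c d : V) :
    G.norm4 (v ⨾ (idm 2 ⊠ split u :)) a b c d = G.norm3 v a b c * G.wt a c * G.norm3 u a c d := by
  rw [norm4, lval_graft4, lval_split, norm3, norm3, wt]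
  by_cases hv : lval v [a] [a, b, c, a] = 0
  · rw [hv]; ring
  · have h := (isPair_of_lval_ne_zero hv).2.1.2
    simp only [List.isChain_cons_cons] at h
    have h' : Γ.adj a c = true := by rw [Γ.symm]; exact h.2.2.1
    rw [G.edge _ _ h.2.2.1, if_pos h']
    have := G.rt_ne a
    have := G.rt_ne c
    have := G.k_ne a c
    have := G.k_ne c a
    field_simp

theorem norm5_graft (v : Hom Γ 0 4) (u : Hom Γ 0 3) (a b c d e : V) :
    G.norm5 (v ⨾ (idm 3 ⊠ split u :)) a b c d e =
      G.norm4 v a b c d * G.wt a d * G.norm3 u a d e := by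
  rw [norm5, lval_graft5, lval_split, norm4, norm3, wt]
  by_cases hv : lval v [a] [a, b, c, d, a] = 0
  · rw [hv]; ring
  · have h := (isPair_of_lval_ne_zero hv).2.1.2
    simp only [List.isChain_cons_cons] at h
    have h' : Γ.adj a d = true := by rw [Γ.symm]; exact h.2.2.2.1
    rw [G.edge _ _ h.2.2.2.1, if_pos h']
    have := G.rt_ne a
    have := G.rt_ne d
    have := G.k_ne a d
    have := G.k_ne d a
    field_simp

theorem norm4_treeI (T : Hom Γ 2 1) (a b c d : V) :
    G.norm4 (treeI T) a b c d = G.tri T a b c * G.wt a c * G.tri T a c d := by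
  rw [treeI, norm4_graft, norm3_bend21, norm3_bend21]

theorem norm5_tree5 (T : Hom Γ 2 1) (a b c d e : V) :
    G.norm5 (tree5 T) a b c d e =
      G.tri T a b c * G.wt a c * G.tri T a c d * G.wt a d * G.tri T a d e := by
  rw [tree5, norm5_graft, norm4_treeI, norm3_bend21]

theorem norm4_coev_coev (a b c d : V) : G.norm4 (coev ⊠ coev : Hom Γ 0 4) a b c d =
    if c = a then G.iwt a b * G.iwt a d / G.rt a ^ 2 else 0 := by
  rw [norm4, lval_coev_tensor_coev]
  by_cases hc : c = a
  · subst hc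
    rw [if_pos rfl, if_pos rfl, iwt, iwt]
    by_cases h1 : Γ.adj c b = true
    · by_cases h2 : Γ.adj c d = true
      · rw [G.edge _ _ h1, G.edge _ _ h2, if_pos h1, if_pos h2]
        have := G.rt_ne c
        field_simp
      · simp [edgeWeight, h2]
    · simp [edgeWeight, h1]
  · simp [hc]

theorem norm4_nest (a b c d : V) : G.norm4 (nest : Hom Γ 0 4) a b c d =
    if d = b then G.iwt a b * G.iwt b c / G.rt b ^ 2 else 0 := by
  rw [norm4, lval_nest]
  by_cases hc : d = b
  · subst hc
    rw [if_pos rfl, if_pos rfl, iwt, iwt]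
    by_cases h1 : Γ.adj a d = true
    · by_cases h2 : Γ.adj d c = true
      · rw [G.edge _ _ h1, G.edge _ _ h2, if_pos h1, if_pos h2]
        have := G.rt_ne a
        have := G.rt_ne d
        field_simp
      · simp [edgeWeight, h2]
    · simp [edgeWeight, h1]
  · simp [hc]

theorem norm5_coev_tensor (u : Hom Γ 0 3) (a b c d e : V) :
    G.norm5 (coev ⊠ u : Hom Γ 0 5) a b c d e =
      if c = a then G.iwt a b * G.norm3 u a d e / G.rt a ^ 2 else 0 := by
  rw [norm5, norm3, lval_coev_tensor]
  by_cases hc : c = a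
  · subst hc
    rw [if_pos rfl, if_pos rfl, iwt]
    by_cases h1 : Γ.adj c b = true
    · rw [G.edge _ _ h1, if_pos h1]
      have := G.rt_ne c
      field_simp
    · simp [edgeWeight, h1]
  · simp [hc]

theorem norm5_forest5 (T : Hom Γ 2 1) (a b c d e : V) : G.norm5 (forest5 T) a b c d e =
    if c = a then G.iwt a b * G.tri T a d e / G.rt a ^ 2 else 0 := by
  rw [forest5, norm5_coev_tensor, norm3_bend21]

theorem norm4_bend22 (R : Hom Γ 2 2) {σ : V → V}
    (hR : ∀ a x b c, x ≠ σ b → lval R [a, x, c] [a, b, c] = 0) (a b c d : V) :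
    G.norm4 (bend22 R) a b c d =
      if d = σ b then G.red R σ a b c * G.iwt a d * G.iwt d c / G.rt d ^ 2 else 0 := by
  rw [norm4, lval_bend22]
  by_cases hd : d = σ b
  · subst hd
    rw [if_pos rfl, red, iwt, iwt]
    by_cases h1 : Γ.adj a (σ b) = true
    · by_cases h2 : Γ.adj (σ b) c = true
      · rw [G.edge _ _ h1, G.edge _ _ h2, if_pos h1, if_pos h2]
        have := G.rt_ne a
        have := G.rt_ne (σ b)
        have := G.k_ne a (σ b)
        have := G.k_ne (σ b) c
        field_simp
      · simp [edgeWeight, h2]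
    · simp [edgeWeight, h1]
  · rw [if_neg hd, hR _ _ _ _ hd]; ring

/-- A red strand that crosses the region `b` acts by a factor and by the permutation `σ` of the
regions. -/
theorem norm3_act1 (R : Hom Γ 2 2) {σ : V → V}
    (hR : ∀ a x b c, x ≠ σ b → lval R [a, x, c] [a, b, c] = 0) (v : Hom Γ 0 3) (a b c : V) :
    G.norm3 (v ⨾ (R ⊠ idm 1)) a b c = G.red R σ a b c * G.norm3 v a (σ b) c := by
  rw [norm3, norm3, red, lval_act3_1, Finset.sum_eq_single (σ b)]
  · have := G.k_ne a (σ b)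
    have := G.k_ne (σ b) c
    field_simp
  · intro x _ hx
    rw [hR _ _ _ _ hx, mul_zero]
  · simp

theorem norm3_act2 (R : Hom Γ 2 2) {σ : V → V}
    (hR : ∀ a x b c, x ≠ σ b → lval R [a, x, c] [a, b, c] = 0) (v : Hom Γ 0 3) (a b c : V) :
    G.norm3 (v ⨾ (idm 1 ⊠ R)) a b c = G.red R σ b c a * G.norm3 v a b (σ c) := by
  rw [norm3, norm3, red, lval_act3_2, Finset.sum_eq_single (σ c)]
  · have := G.k_ne b (σ c)
    have := G.k_ne (σ c) a
    field_simp
  · intro x _ hx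
    rw [hR _ _ _ _ hx, mul_zero]
  · simp

theorem norm4_act1 (R : Hom Γ 2 2) {σ : V → V}
    (hR : ∀ a x b c, x ≠ σ b → lval R [a, x, c] [a, b, c] = 0) (v : Hom Γ 0 4) (a b c d : V) :
    G.norm4 (v ⨾ (R ⊠ idm 2)) a b c d = G.red R σ a b c * G.norm4 v a (σ b) c d := by
  rw [norm4, norm4, red, lval_act4_1, Finset.sum_eq_single (σ b)]
  · have := G.k_ne a (σ b)
    have := G.k_ne (σ b) c
    field_simp
  · intro x _ hx
    rw [hR _ _ _ _ hx, mul_zero]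
  · simp

theorem norm4_act2 (R : Hom Γ 2 2) {σ : V → V}
    (hR : ∀ a x b c, x ≠ σ b → lval R [a, x, c] [a, b, c] = 0) (v : Hom Γ 0 4) (a b c d : V) :
    G.norm4 (v ⨾ (idm 1 ⊠ R ⊠ idm 1)) a b c d = G.red R σ b c d * G.norm4 v a b (σ c) d := by
  rw [norm4, norm4, red, lval_act4_2, Finset.sum_eq_single (σ c)]
  · have := G.k_ne b (σ c)
    have := G.k_ne (σ c) d
    field_simp
  · intro x _ hx
    rw [hR _ _ _ _ hx, mul_zero]
  · simp

theorem norm5_act1 (R : Hom Γ 2 2) {σ : V → V}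
    (hR : ∀ a x b c, x ≠ σ b → lval R [a, x, c] [a, b, c] = 0) (v : Hom Γ 0 5) (a b c d e : V) :
    G.norm5 (v ⨾ (R ⊠ idm 3)) a b c d e = G.red R σ a b c * G.norm5 v a (σ b) c d e := by
  rw [norm5, norm5, red, lval_act5_1, Finset.sum_eq_single (σ b)]
  · have := G.k_ne a (σ b)
    have := G.k_ne (σ b) c
    field_simp
  · intro x _ hx
    rw [hR _ _ _ _ hx, mul_zero]
  · simp

theorem norm5_act2 (R : Hom Γ 2 2) {σ : V → V}
    (hR : ∀ a x b c, x ≠ σ b → lval R [a, x, c] [a, b, c] = 0) (v : Hom Γ 0 5) (a b c d e : V) :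
    G.norm5 (v ⨾ (idm 1 ⊠ R ⊠ idm 2)) a b c d e = G.red R σ b c d * G.norm5 v a b (σ c) d e := by
  rw [norm5, norm5, red, lval_act5_2, Finset.sum_eq_single (σ c)]
  · have := G.k_ne b (σ c)
    have := G.k_ne (σ c) d
    field_simp
  · intro x _ hx
    rw [hR _ _ _ _ hx, mul_zero]
  · simp

theorem norm5_act3 (R : Hom Γ 2 2) {σ : V → V}
    (hR : ∀ a x b c, x ≠ σ b → lval R [a, x, c] [a, b, c] = 0) (v : Hom Γ 0 5) (a b c d e : V) :
    G.norm5 (v ⨾ (idm 2 ⊠ R ⊠ idm 1)) a b c d e = G.red R σ c d e * G.norm5 v a b c (σ d) e := by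
  rw [norm5, norm5, red, lval_act5_3, Finset.sum_eq_single (σ d)]
  · have := G.k_ne c (σ d)
    have := G.k_ne (σ d) e
    field_simp
  · intro x _ hx
    rw [hR _ _ _ _ hx, mul_zero]
  · simp

theorem norm5_act4 (R : Hom Γ 2 2) {σ : V → V}
    (hR : ∀ a x b c, x ≠ σ b → lval R [a, x, c] [a, b, c] = 0) (v : Hom Γ 0 5) (a b c d e : V) :
    G.norm5 (v ⨾ (idm 3 ⊠ R)) a b c d e = G.red R σ d e a * G.norm5 v a b c d (σ e) := by
  rw [norm5, norm5, red, lval_act5_4, Finset.sum_eq_single (σ e)]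
  · have := G.k_ne d (σ e)
    have := G.k_ne (σ e) a
    field_simp
  · intro x _ hx
    rw [hR _ _ _ _ hx, mul_zero]
  · simp

theorem norm3_dec3_1 (R : Hom Γ 2 2) {σ : V → V}
    (hR : ∀ a x b c, x ≠ σ b → lval R [a, x, c] [a, b, c] = 0) (v : Hom Γ 0 3) (a b c : V) :
    G.norm3 (dec3 R 1 v) a b c =
      G.red R σ a b c * G.norm3 v a (σ b) c :=
  G.norm3_act1 R hR v a b c

theorem norm3_dec3_2 (R : Hom Γ 2 2) {σ : V → V}
    (hR : ∀ a x b c, x ≠ σ b → lval R [a, x, c] [a, b, c] = 0) (v : Hom Γ 0 3) (a b c : V) :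
    G.norm3 (dec3 R 2 v) a b c =
      G.red R σ b c a * G.norm3 v a b (σ c) :=
  G.norm3_act2 R hR v a b c

theorem norm3_dec3_3 (R : Hom Γ 2 2) {σ : V → V}
    (hR : ∀ a x b c, x ≠ σ b → lval R [a, x, c] [a, b, c] = 0) (v : Hom Γ 0 3) (a b c : V) :
    G.norm3 (dec3 R 3 v) a b c =
      G.red R σ c a b * G.norm3 v (σ a) b c := by
  have h : dec3 R 3 v = right3^[2] (right3 v ⨾ (R ⊠ idm 1)) := rfl
  rw [h]
  simp only [Function.iterate_succ, Function.iterate_zero, Function.comp_apply, id_eq,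
    norm3_right3, G.norm3_act1 R hR]

theorem norm4_dec4_1 (R : Hom Γ 2 2) {σ : V → V}
    (hR : ∀ a x b c, x ≠ σ b → lval R [a, x, c] [a, b, c] = 0) (v : Hom Γ 0 4) (a b c d : V) :
    G.norm4 (dec4 R 1 v) a b c d =
      G.red R σ a b c * G.norm4 v a (σ b) c d :=
  G.norm4_act1 R hR v a b c d

theorem norm4_dec4_2 (R : Hom Γ 2 2) {σ : V → V}
    (hR : ∀ a x b c, x ≠ σ b → lval R [a, x, c] [a, b, c] = 0) (v : Hom Γ 0 4) (a b c d : V) :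
    G.norm4 (dec4 R 2 v) a b c d =
      G.red R σ b c d * G.norm4 v a b (σ c) d :=
  G.norm4_act2 R hR v a b c d

theorem norm5_dec5_zero (R : Hom Γ 2 2) (v : Hom Γ 0 5) (a b c d e : V) :
    G.norm5 (dec5 R 0 v) a b c d e = G.norm5 v a b c d e := rfl

theorem norm5_dec5_1 (R : Hom Γ 2 2) {σ : V → V}
    (hR : ∀ a x b c, x ≠ σ b → lval R [a, x, c] [a, b, c] = 0) (v : Hom Γ 0 5) (a b c d e : V) :
    G.norm5 (dec5 R 1 v) a b c d e =
      G.red R σ a b c * G.norm5 v a (σ b) c d e :=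
  G.norm5_act1 R hR v a b c d e

theorem norm5_dec5_2 (R : Hom Γ 2 2) {σ : V → V}
    (hR : ∀ a x b c, x ≠ σ b → lval R [a, x, c] [a, b, c] = 0) (v : Hom Γ 0 5) (a b c d e : V) :
    G.norm5 (dec5 R 2 v) a b c d e =
      G.red R σ b c d * G.norm5 v a b (σ c) d e :=
  G.norm5_act2 R hR v a b c d e

theorem norm5_dec5_3 (R : Hom Γ 2 2) {σ : V → V}
    (hR : ∀ a x b c, x ≠ σ b → lval R [a, x, c] [a, b, c] = 0) (v : Hom Γ 0 5) (a b c d e : V) :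
    G.norm5 (dec5 R 3 v) a b c d e =
      G.red R σ c d e * G.norm5 v a b c (σ d) e :=
  G.norm5_act3 R hR v a b c d e

theorem norm5_dec5_4 (R : Hom Γ 2 2) {σ : V → V}
    (hR : ∀ a x b c, x ≠ σ b → lval R [a, x, c] [a, b, c] = 0) (v : Hom Γ 0 5) (a b c d e : V) :
    G.norm5 (dec5 R 4 v) a b c d e =
      G.red R σ d e a * G.norm5 v a b c d (σ e) :=
  G.norm5_act4 R hR v a b c d e

theorem norm5_dec5_5 (R : Hom Γ 2 2) {σ : V → V}
    (hR : ∀ a x b c, x ≠ σ b → lval R [a, x, c] [a, b, c] = 0) (v : Hom Γ 0 5) (a b c d e : V) :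
    G.norm5 (dec5 R 5 v) a b c d e =
      G.red R σ e a b * G.norm5 v (σ a) b c d e := by
  have h : dec5 R 5 v = right5^[4] (right5 v ⨾ (R ⊠ idm 3)) := rfl
  rw [h]
  simp only [Function.iterate_succ, Function.iterate_zero, Function.comp_apply, id_eq,
    norm5_right5, G.norm5_act1 R hR]

/-- A polygon is the sum over its inner region of the product of its vertices and of the weights of
its inner edges. -/
theorem norm3_trigon (T : Hom Γ 2 1) (v : Hom Γ 0 3) (a b c : V) :
    G.norm3 (trigon T v) a b c = ∑ x, G.rt x ^ 2 * G.norm3 v x a b *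
      (G.tri T x b c * G.tri T c a x) * (G.wt a x * G.wt b x * G.wt c x) := by
  rw [norm3, lval_trigon, Finset.mul_sum, Finset.sum_mul]
  refine Finset.sum_congr rfl fun x _ => ?_
  have ht : G.tri T c a x = G.rt c * G.rt a * lval T [c, x, a] [c, a] *
      (G.k c a * G.k a x * G.k x c) := rfl
  rw [ht]
  by_cases hT : lval T [c, x, a] [c, a] = 0
  · rw [hT]; ring
  have h := (isPair_of_lval_ne_zero hT).1.2
  simp only [List.isChain_cons_cons] at h
  have h1 : Γ.adj a x = true := by rw [Γ.symm]; exact h.2.1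
  simp only [← G.norm3_bend21, norm3, lval_split, wt, h.1, h1, if_true]
  by_cases hb : Γ.adj b x = true
  swap
  · simp [edgeWeight, hb]
  rw [G.edge a x h1, G.edge b x hb, if_pos hb]
  have := G.rt_ne x
  have := G.rt_ne a
  have := G.k_ne a x
  have := G.k_ne x a
  have := G.rt_ne b
  have := G.k_ne b x
  have := G.k_ne x b
  have := G.rt_ne c
  have := G.k_ne c x
  have := G.k_ne x c
  field_simp

theorem norm4_tetragon (T : Hom Γ 2 1) (v : Hom Γ 0 3) (a b c d : V) :
    G.norm4 (tetragon T v) a b c d = ∑ x, G.rt x ^ 2 * G.norm3 v x a b *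
      (G.tri T x b c * G.tri T x c d * G.tri T d a x) * (G.wt a x * G.wt b x * G.wt c x *
          G.wt d x) := by
  rw [norm4, lval_tetragon, Finset.mul_sum, Finset.sum_mul]
  refine Finset.sum_congr rfl fun x _ => ?_
  have ht : G.tri T d a x = G.rt d * G.rt a * lval T [d, x, a] [d, a] *
      (G.k d a * G.k a x * G.k x d) := rfl
  rw [ht]
  by_cases hT : lval T [d, x, a] [d, a] = 0
  · rw [hT]; ring
  have h := (isPair_of_lval_ne_zero hT).1.2
  simp only [List.isChain_cons_cons] at h
  have h1 : Γ.adj a x = true := by rw [Γ.symm]; exact h.2.1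
  simp only [← G.norm3_bend21, norm3, lval_split, wt, h.1, h1, if_true]
  by_cases hb : Γ.adj b x = true
  swap
  · simp [edgeWeight, hb]
  by_cases hc : Γ.adj c x = true
  swap
  · simp [edgeWeight, hc]
  rw [G.edge a x h1, G.edge b x hb, G.edge c x hc, if_pos hb, if_pos hc]
  have := G.rt_ne x
  have := G.rt_ne a
  have := G.k_ne a x
  have := G.k_ne x a
  have := G.rt_ne b
  have := G.k_ne b x
  have := G.k_ne x b
  have := G.rt_ne c
  have := G.k_ne c x
  have := G.k_ne x c
  have := G.rt_ne d
  have := G.k_ne d x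
  have := G.k_ne x d
  field_simp

theorem norm5_pentagon (T : Hom Γ 2 1) (v : Hom Γ 0 3) (a b c d e : V) :
    G.norm5 (pentagon T v) a b c d e = ∑ x, G.rt x ^ 2 * G.norm3 v x a b *
      (G.tri T x b c * G.tri T x c d * G.tri T x d e * G.tri T e a x) * (G.wt a x * G.wt b x *
          G.wt c x * G.wt d x * G.wt e x) := by
  rw [norm5, lval_pentagon, Finset.mul_sum, Finset.sum_mul]
  refine Finset.sum_congr rfl fun x _ => ?_
  have ht : G.tri T e a x = G.rt e * G.rt a * lval T [e, x, a] [e, a] *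
      (G.k e a * G.k a x * G.k x e) := rfl
  rw [ht]
  by_cases hT : lval T [e, x, a] [e, a] = 0
  · rw [hT]; ring
  have h := (isPair_of_lval_ne_zero hT).1.2
  simp only [List.isChain_cons_cons] at h
  have h1 : Γ.adj a x = true := by rw [Γ.symm]; exact h.2.1
  simp only [← G.norm3_bend21, norm3, lval_split, wt, h.1, h1, if_true]
  by_cases hb : Γ.adj b x = true
  swap
  · simp [edgeWeight, hb]
  by_cases hc : Γ.adj c x = true
  swap
  · simp [edgeWeight, hc]
  by_cases hd : Γ.adj d x = true
  swap
  · simp [edgeWeight, hd]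
  rw [G.edge a x h1, G.edge b x hb, G.edge c x hc, G.edge d x hd, if_pos hb, if_pos hc, if_pos hd]
  have := G.rt_ne x
  have := G.rt_ne a
  have := G.k_ne a x
  have := G.k_ne x a
  have := G.rt_ne b
  have := G.k_ne b x
  have := G.k_ne x b
  have := G.rt_ne c
  have := G.k_ne c x
  have := G.k_ne x c
  have := G.rt_ne d
  have := G.k_ne d x
  have := G.k_ne x d
  have := G.rt_ne e
  have := G.k_ne e x
  have := G.k_ne x e
  field_simp

/-- A bigon in terms of normalised vertices; its own coordinates need no normalisation, since
both ends of the strand carry the same regions. -/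
theorem lval_bigon_eq (T : Hom Γ 2 1) (v : Hom Γ 0 3) {a b : V} (hab : Γ.adj a b = true) :
    lval (bigon T v) [a, b] [a, b] =
      ∑ c, G.rt c ^ 2 * G.norm3 v b a c * G.tri T a b c * (G.wt a b * G.wt b c * G.wt c a) := by
  rw [lval_bigon]
  refine Finset.sum_congr rfl fun c _ => ?_
  rw [tri]
  by_cases hT : lval T [a, c, b] [a, b] = 0
  · rw [hT]; ring
  have h := (isPair_of_lval_ne_zero hT).1.2
  simp only [List.isChain_cons_cons] at h
  have h1 : Γ.adj b c = true := by rw [Γ.symm]; exact h.2.1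
  have h2 : Γ.adj c a = true := by rw [Γ.symm]; exact h.1
  simp only [norm3, lval_split, wt, hab, h1, h2, if_true, G.edge a b hab]
  have := G.rt_ne a
  have := G.rt_ne b
  have := G.rt_ne c
  have := G.k_ne a b
  have := G.k_ne b a
  have := G.k_ne a c
  have := G.k_ne c a
  have := G.k_ne b c
  have := G.k_ne c b
  field_simp

end Gauge

end

/-! ### Sums of few monomials in a ring with a root of unity and a square root -/

/-- The relations of the ring `ℤ[x, t]` in which `x` is a primitive `24`-th root of unity and
`t ^ 2 = (√2 - 1) (√3 - √2)` with `√2 = x ^ 3 + x ^ (-3)` and `√3 = x ^ 2 + x ^ (-2)`. -/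
structure IsGen {R : Type*} [CommRing R] (x t : R) : Prop where
  cyc : x ^ 8 = x ^ 4 - 1
  sq : t ^ 2 = -2 + 2 * x - 2 * x ^ 2 + 2 * x ^ 3 + x ^ 6 - 2 * x ^ 7

/-- `r` is a sum of at most `M` monomials `x ^ k` or `x ^ k * t`. -/
inductive IsSmall {R : Type*} [CommRing R] (x t : R) : ℕ → R → Prop
  | zero (M : ℕ) : IsSmall x t M 0
  | pow (k : ℕ) : IsSmall x t 1 (x ^ k)
  | powMul (k : ℕ) : IsSmall x t 1 (x ^ k * t)
  | add {M M' : ℕ} {r r' : R} : IsSmall x t M r → IsSmall x t M' r' → IsSmall x t (M + M') (r + r')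

section

variable {R : Type*} [CommRing R] {x t : R}

theorem IsGen.pow_twelve (h : IsGen x t) : x ^ 12 = -1 := by
  linear_combination (x ^ 4 + 1) * h.cyc

theorem IsGen.pow_twentyfour (h : IsGen x t) : x ^ 24 = 1 := by
  linear_combination (x ^ 12 - 1) * h.pow_twelve

theorem IsSmall.mono {M M' : ℕ} {r : R} (hr : IsSmall x t M r) (hM : M ≤ M') :
    IsSmall x t M' r := by
  obtain ⟨d, rfl⟩ := Nat.exists_eq_add_of_le hM
  simpa using hr.add (IsSmall.zero d)

theorem IsSmall.pow_mul {M : ℕ} {r : R} (hr : IsSmall x t M r) (k : ℕ) :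
    IsSmall x t M (x ^ k * r) := by
  induction hr with
  | zero M => rw [mul_zero]; exact .zero _
  | pow l => rw [← pow_add]; exact .pow _
  | powMul l => rw [← mul_assoc, ← pow_add]; exact .powMul _
  | add _ _ h1 h2 => rw [mul_add]; exact h1.add h2

theorem IsSmall.t_mul (h : IsGen x t) {M : ℕ} {r : R} (hr : IsSmall x t M r) :
    IsSmall x t (11 * M) (t * r) := by
  induction hr with
  | zero M => rw [mul_zero]; exact .zero _
  | pow k => rw [mul_comm t]; exact IsSmall.mono (M := 1) (.powMul k) (by omega)
  | powMul k =>
    have e : t * (x ^ k * t) = x ^ k * (x ^ 12 + x ^ 12 + x ^ 1 + x ^ 1 + x ^ 14 + x ^ 14 + x ^ 3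
        + x ^ 3 + x ^ 6 + x ^ 19 + x ^ 19) := by
      linear_combination x ^ k * h.sq - (2 + 2 * x ^ 2 + 2 * x ^ 7) * x ^ k * h.pow_twelve
    rw [e]
    apply IsSmall.pow_mul
    have p := fun k => IsSmall.pow (x := x) (t := t) k
    exact ((((((((((p 12).add (p 12)).add (p 1)).add (p 1)).add (p 14)).add (p 14)).add (p 3)).add
      (p 3)).add (p 6)).add (p 19)).add (p 19)
  | add _ _ h1 h2 => rw [mul_add, mul_add]; exact h1.add h2

/-- The expression for `t ^ 2` in `IsGen.sq` has `11` monomials, so `11` is the factor by which the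
product of two monomials that contain `t` increases the count. -/
theorem IsSmall.mul (h : IsGen x t) {M M' : ℕ} {r r' : R} (hr : IsSmall x t M r)
    (hr' : IsSmall x t M' r') : IsSmall x t (11 * M * M') (r * r') := by
  induction hr with
  | zero M => rw [zero_mul]; exact .zero _
  | pow k => exact IsSmall.mono (M := M') (hr'.pow_mul k) (by omega)
  | powMul k =>
    rw [mul_assoc (x ^ k)]
    exact IsSmall.mono (M := 11 * M') ((hr'.t_mul h).pow_mul k) (by omega)
  | add _ _ h1 h2 => rw [add_mul, mul_add, add_mul]; exact h1.add h2

/-- `128 r` is a polynomial of degree at most `7` in `u` with coefficients of size at most `C`. -/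
def HasCoeffs (u : R) (C : ℕ) (r : R) : Prop :=
  ∃ c : Fin 8 → ℤ, (∀ i, |c i| ≤ C) ∧ 128 * r = ∑ i, (c i : R) * u ^ (i : ℕ)

theorem HasCoeffs.zero (u : R) (C : ℕ) : HasCoeffs u C 0 :=
  ⟨0, fun i => by simp, by simp⟩

theorem HasCoeffs.add {u : R} {C C' : ℕ} {r r' : R} (h : HasCoeffs u C r) (h' : HasCoeffs u C' r') :
    HasCoeffs u (C + C') (r + r') := by
  obtain ⟨c, h1, h2⟩ := h
  obtain ⟨c', h1', h2'⟩ := h'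
  refine ⟨c + c', fun i => ?_, ?_⟩
  · push_cast
    exact (abs_add_le _ _).trans (add_le_add (h1 i) (h1' i))
  · rw [mul_add, h2, h2', ← Finset.sum_add_distrib]
    refine Finset.sum_congr rfl fun i _ => ?_
    rw [Pi.add_apply]; push_cast; ring

theorem HasCoeffs.neg {u : R} {C : ℕ} {r : R} (h : HasCoeffs u C r) : HasCoeffs u C (-r) := by
  obtain ⟨c, h1, h2⟩ := h
  refine ⟨-c, fun i => by simpa using h1 i, ?_⟩
  rw [mul_neg, h2, ← Finset.sum_neg_distrib]
  refine Finset.sum_congr rfl fun i _ => ?_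
  rw [Pi.neg_apply]; push_cast; ring

theorem HasCoeffs.mono {u : R} {C C' : ℕ} {r : R} (h : HasCoeffs u C r) (hC : C ≤ C') :
    HasCoeffs u C' r := by
  obtain ⟨c, h1, h2⟩ := h
  exact ⟨c, fun i => (h1 i).trans (by exact_mod_cast hC), h2⟩

/-- The powers of `x` are polynomials in `u = x ^ 6 * t ^ 2 = (x ^ 3 * t) ^ 2` with coefficients
in `ℤ[1/2]`. -/
theorem IsGen.hasCoeffs_pow_lt (h : IsGen x t) (k : ℕ) (hk : k < 8) :
    HasCoeffs (x ^ 6 * t ^ 2) 2444 (x ^ k) := by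
  have hx := h.cyc
  obtain ⟨u, hu'⟩ : ∃ u, u = x ^ 6 * t ^ 2 := ⟨_, rfl⟩
  rw [← hu']
  have hu : u = x ^ 6 * (-2 + 2 * x - 2 * x ^ 2 + 2 * x ^ 3 + x ^ 6 - 2 * x ^ 7) := by
    rw [hu', h.sq]
  -- The powers of `u` in the basis `1, x, …, x ^ 7`; the coefficients below come from the inverse
  -- of the resulting matrix, whose denominators divide `128`.
  have h1 : u = 1 - 2 * x ^ 4 + 2 * x ^ 5 - 2 * x ^ 6 + 2 * x ^ 7 := by
    rw [hu]; linear_combination (-1 + x ^ 4 - 2 * x ^ 5) * hx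
  have h2 : u ^ 2 = -15 + 16 * x - 16 * x ^ 2 + 16 * x ^ 3 - 4 * x ^ 5 + 8 * x ^ 6 - 12 * x ^ 7 := by
    linear_combination u * h1 + (1 - 2 * x ^ 4 + 2 * x ^ 5 - 2 * x ^ 6 + 2 * x ^ 7) * h1 +
        (16 - 16 * x + 16 * x ^ 2 - 16 * x ^ 3 + 12 * x ^ 4 - 8 * x ^ 5 + 4 * x ^ 6) * hx
  have h3 : u ^ 3 = -63 + 32 * x - 32 * x ^ 3 + 126 * x ^ 4 - 122 * x ^ 5 + 110 * x ^ 6 -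
      90 * x ^ 7 := by
    linear_combination u * h2 + (-15 + 16 * x - 16 * x ^ 2 + 16 * x ^ 3 - 4 * x ^ 5 +
        8 * x ^ 6 - 12 * x ^ 7) * h1 + (48 - 16 * x - 16 * x ^ 2 + 48 * x ^ 3 - 48 * x ^ 4 +
        40 * x ^ 5 - 24 * x ^ 6) * hx
  have h4 : u ^ 4 = 833 - 928 * x + 960 * x ^ 2 - 928 * x ^ 3 + 248 * x ^ 5 - 480 * x ^ 6 +
      680 * x ^ 7 := by
    linear_combination u * h3 + (-63 + 32 * x - 32 * x ^ 3 + 126 * x ^ 4 - 122 * x ^ 5 +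
        110 * x ^ 6 - 90 * x ^ 7) * h1 + (-896 + 960 * x - 960 * x ^ 2 + 896 * x ^ 3 - 644 * x ^ 4 +
        400 * x ^ 5 - 180 * x ^ 6) * hx
  have h5 : u ^ 5 = 3649 - 1888 * x + 1888 * x ^ 3 - 7298 * x ^ 4 + 7050 * x ^ 5 - 6322 * x ^ 6 +
      5162 * x ^ 7 := by
    linear_combination u * h4 + (833 - 928 * x + 960 * x ^ 2 - 928 * x ^ 3 + 248 * x ^ 5 -
        480 * x ^ 6 + 680 * x ^ 7) * h1 + (-2816 + 960 * x + 960 * x ^ 2 - 2816 * x ^ 3 +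
        2816 * x ^ 4 - 2320 * x ^ 5 + 1360 * x ^ 6) * hx
  have h6 : u ^ 6 = -48015 + 53552 * x - 55440 * x ^ 2 + 53552 * x ^ 3 - 14348 * x ^ 5 +
      27720 * x ^ 6 - 39204 * x ^ 7 := by
    linear_combination u * h5 + (3649 - 1888 * x + 1888 * x ^ 3 - 7298 * x ^ 4 + 7050 * x ^ 5 -
        6322 * x ^ 6 + 5162 * x ^ 7) * h1 + (51664 - 55440 * x + 55440 * x ^ 2 - 51664 * x ^ 3 +
        37068 * x ^ 4 - 22968 * x ^ 5 + 10324 * x ^ 6) * hx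
  have h7 : u ^ 7 = -210559 + 108992 * x - 108992 * x ^ 3 + 421118 * x ^ 4 - 406770 * x ^ 5 +
      364702 * x ^ 6 - 297778 * x ^ 7 := by
    linear_combination u * h6 + (-48015 + 53552 * x - 55440 * x ^ 2 + 53552 * x ^ 3 -
        14348 * x ^ 5 + 27720 * x ^ 6 - 39204 * x ^ 7) * h1 + (162544 - 55440 * x - 55440 * x ^ 2 +
        162544 * x ^ 3 - 162544 * x ^ 4 + 133848 * x ^ 5 - 78408 * x ^ 6) * hx
  interval_cases k
  · refine ⟨![128, 0, 0, 0, 0, 0, 0, 0], fun i => by fin_cases i <;> simp, ?_⟩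
    simp only [Fin.sum_univ_eight]
    simp
  · refine ⟨![127, 255, 195, 195, 61, 61, 1, 1], fun i => by fin_cases i <;> simp, ?_⟩
    simp only [Fin.sum_univ_eight]
    simp
    linear_combination -((255) * h1 + (195) * h2 + (195) * h3 + (61) * h4 + (61) * h5 + (1) * h6 +
        (1) * h7)
  · refine ⟨![120, 502, 532, 922, 240, 362, 4, 6], fun i => by fin_cases i <;> simp, ?_⟩
    simp only [Fin.sum_univ_eight]
    simp
    linear_combination -((502) * h1 + (532) * h2 + (922) * h3 + (240) * h4 + (362) * h5 + (4) * h6 +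
        (6) * h7)
  · refine ⟨![99, 721, 495, 1949, 297, 899, 5, 15], fun i => by fin_cases i <;> simp, ?_⟩
    simp only [Fin.sum_univ_eight]
    simp
    linear_combination -((721) * h1 + (495) * h2 + (1949) * h3 + (297) * h4 + (899) * h5 +
        (5) * h6 + (15) * h7)
  · refine ⟨![64, 884, 0, 2444, 0, 1196, 0, 20], fun i => by fin_cases i <;> simp, ?_⟩
    simp only [Fin.sum_univ_eight]
    simp
    linear_combination -((884) * h1 + (2444) * h3 + (1196) * h5 + (20) * h7)
  · refine ⟨![28, 976, -300, 2144, -236, 960, -4, 16], fun i => by fin_cases i <;> simp, ?_⟩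
    simp only [Fin.sum_univ_eight]
    simp
    linear_combination -((976) * h1 + (-300) * h2 + (2144) * h3 + (-236) * h4 + (960) * h5 +
        (-4) * h6 + (16) * h7)
  · refine ⟨![0, 1004, 0, 1844, 0, 724, 0, 12], fun i => by fin_cases i <;> simp, ?_⟩
    simp only [Fin.sum_univ_eight]
    simp
    linear_combination -((1004) * h1 + (1844) * h3 + (724) * h5 + (12) * h7)
  · refine ⟨![-28, 976, 300, 2144, 236, 960, 4, 16], fun i => by fin_cases i <;> simp, ?_⟩
    simp only [Fin.sum_univ_eight]
    simp
    linear_combination -((976) * h1 + (300) * h2 + (2144) * h3 + (236) * h4 + (960) * h5 +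
        (4) * h6 + (16) * h7)

theorem IsGen.hasCoeffs_pow (h : IsGen x t) (k : ℕ) : HasCoeffs (x ^ 6 * t ^ 2) 4888 (x ^ k) := by
  have key : ∀ k < 12, HasCoeffs (x ^ 6 * t ^ 2) 4888 (x ^ k) := by
    intro k hk
    by_cases h8 : k < 8
    · exact (h.hasCoeffs_pow_lt k h8).mono (by norm_num)
    · obtain ⟨j, rfl⟩ := Nat.exists_eq_add_of_le (not_lt.1 h8)
      have e : x ^ (8 + j) = x ^ (4 + j) + -x ^ j := by
        linear_combination x ^ j * h.cyc
      rw [e]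
      exact (h.hasCoeffs_pow_lt _ (by omega)).add (h.hasCoeffs_pow_lt _ (by omega)).neg
  induction k using Nat.strong_induction_on with
  | _ k ih =>
    by_cases hk : k < 12
    · exact key k hk
    · obtain ⟨j, rfl⟩ := Nat.exists_eq_add_of_le (not_lt.1 hk)
      have e : x ^ (12 + j) = -x ^ j := by linear_combination x ^ j * h.pow_twelve
      rw [e]
      exact (ih j (by omega)).neg

/-- A sum of `M` monomials is a polynomial of degree at most `15` in `x ^ 3 * t` with small
coefficients, up to the factor `128`. -/
theorem IsSmall.exists_coeffs (h : IsGen x t) {M : ℕ} {r : R} (hr : IsSmall x t M r) :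
    ∃ a b : R, HasCoeffs (x ^ 6 * t ^ 2) (4888 * M) a ∧ HasCoeffs (x ^ 6 * t ^ 2) (4888 * M) b ∧
      r = a + x ^ 3 * t * b := by
  induction hr with
  | zero M => exact ⟨0, 0, .zero _ _, .zero _ _, by ring⟩
  | pow k => exact ⟨x ^ k, 0, h.hasCoeffs_pow k, .zero _ _, by ring⟩
  | powMul k =>
    refine ⟨0, x ^ (k + 21), .zero _ _, h.hasCoeffs_pow _, ?_⟩
    linear_combination -x ^ k * t * h.pow_twentyfour
  | add _ _ h1 h2 =>
    obtain ⟨a, b, ha, hb, rfl⟩ := h1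
    obtain ⟨a', b', ha', hb', rfl⟩ := h2
    refine ⟨a + a', b + b', ?_, ?_, by ring⟩
    · rw [mul_add]; exact ha.add ha'
    · rw [mul_add]; exact hb.add hb'

end

/-! ### Reduction modulo a large integer -/

/-- An integer determines its digits in base `B` if these are small compared with `B`; they may be
negative. -/
theorem digits_eq_zero {B : ℤ} (n : ℕ) (c : Fin n → ℤ) (hc : ∀ i, 4 * |c i| ≤ B) (hB : 0 < B)
    (h : ∑ i, c i * B ^ (i : ℕ) = 0) : c = 0 := by
  induction n with
  | zero => exact Subsingleton.elim _ _
  | succ n ih =>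
    rw [Fin.sum_univ_succ] at h
    simp only [Fin.val_zero, pow_zero, mul_one, Fin.val_succ] at h
    have e : ∑ i : Fin n, c i.succ * B ^ ((i : ℕ) + 1) = B * ∑ i : Fin n, c i.succ * B ^ (i : ℕ) := by
      rw [Finset.mul_sum]
      exact Finset.sum_congr rfl fun i _ => by ring
    rw [e] at h
    have h0 : c 0 = 0 := by
      have hd : B ∣ c 0 := ⟨-∑ i : Fin n, c i.succ * B ^ (i : ℕ), by linarith⟩
      refine Int.eq_zero_of_abs_lt_dvd hd ?_
      have := hc 0
      have := abs_nonneg (c 0)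
      linarith
    rw [h0, zero_add] at h
    have h1 := ih (fun i => c i.succ) (fun i => hc _) ((mul_eq_zero.1 h).resolve_left hB.ne')
    funext i
    refine Fin.cases h0 (fun i => ?_) i
    exact congrFun h1 i

theorem abs_digits_lt {B : ℤ} (n : ℕ) (c : Fin n → ℤ) (hc : ∀ i, 4 * |c i| ≤ B) (hB : 2 ≤ B) :
    |∑ i, c i * B ^ (i : ℕ)| < B ^ n := by
  induction n with
  | zero => simp
  | succ n ih =>
    rw [Fin.sum_univ_castSucc]
    have h1 := ih (fun i => c i.castSucc) (fun i => hc _)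
    have h2 : |c (Fin.last n) * B ^ n| ≤ (B - 1) * B ^ n := by
      rw [abs_mul, abs_of_pos (pow_pos (by linarith) n : 0 < B ^ n)]
      refine mul_le_mul_of_nonneg_right ?_ (pow_pos (by linarith) n).le
      have := hc (Fin.last n)
      have := abs_nonneg (c (Fin.last n))
      linarith
    calc _ ≤ _ := abs_add_le _ _
      _ < B ^ n + (B - 1) * B ^ n := add_lt_add_of_lt_of_le h1 h2
      _ = B ^ (n + 1) := by ring

/-- The base of the positional system. It is chosen to exceed all coefficients that arise; see
`IsSmall.fst_eq_zero`. -/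
def base : ℕ := 2 ^ 256

/-- The value at `base` of the minimal polynomial of `x ^ 3 * t`. -/
def modN : ℕ := base ^ 16 + 60 * base ^ 12 + 134 * base ^ 8 + 60 * base ^ 4 + 1

/-- If a sum of few monomials vanishes modulo `modN`, then it vanishes in `ℂ`. Up to the factor `128`
it is the value of an integral polynomial of degree at most `15` in `x ^ 3 * t`. The residue of
`x ^ 3 * t` is `base`, so this polynomial takes at `base` a value that is divisible by `modN`. Since
the coefficients are small, the value is less than `modN` and hence `0`, and the coefficients, which
are its digits, are `0`. -/
theorem IsSmall.fst_eq_zero {x t : ℂ × ZMod modN} (h : IsGen x t)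
    (hx : (x ^ 3 * t).2 = (base : ℕ)) {M : ℕ} (hM : 4 * (4888 * M) ≤ base) {r : ℂ × ZMod modN}
    (hr : IsSmall x t M r) (h0 : r.2 = 0) : r.1 = 0 := by
  obtain ⟨a, b, ⟨c, hc, ha⟩, ⟨d, hd, hb⟩, rfl⟩ := hr.exists_coeffs h
  have hu : x ^ 6 * t ^ 2 = (x ^ 3 * t) ^ 2 := by ring
  rw [hu] at ha hb
  generalize x ^ 3 * t = y at *
  have ha2 := congrArg Prod.snd ha
  have hb2 := congrArg Prod.snd hb
  rw [Prod.snd_sum] at ha2 hb2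
  simp only [Prod.snd_mul, Prod.snd_intCast, Prod.pow_snd, Prod.snd_ofNat, hx] at ha2 hb2
  simp only [Prod.snd_add, Prod.snd_mul, hx] at h0
  have key : ((∑ i, (Fin.append ![c 0, d 0, c 1, d 1, c 2, d 2, c 3, d 3]
      ![c 4, d 4, c 5, d 5, c 6, d 6, c 7, d 7] : Fin 16 → ℤ) i * (base : ℤ) ^ (i : ℕ) : ℤ) :
      ZMod modN) = 0 := by
    rw [Fin.sum_univ_add (a := 8) (b := 8)]
    simp only [Fin.append_left, Fin.append_right, Fin.sum_univ_eight] at ha2 hb2 ⊢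
    simp at ha2 hb2 ⊢
    linear_combination 128 * h0 - ha2 - (base : ZMod modN) * hb2
  have hN : ((modN : ℕ) : ℤ) = (base : ℤ) ^ 16 + 60 * (base : ℤ) ^ 12 + 134 * (base : ℤ) ^ 8 +
    60 * (base : ℤ) ^ 4 + 1 := by rw [modN]; push_cast; rfl
  have hB : (2 : ℤ) ≤ (base : ℤ) := by rw [base]; norm_num
  set e : Fin 16 → ℤ := Fin.append ![c 0, d 0, c 1, d 1, c 2, d 2, c 3, d 3]
      ![c 4, d 4, c 5, d 5, c 6, d 6, c 7, d 7] with he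
  have hM' : (4 : ℤ) * (4888 * M) ≤ (base : ℤ) := by exact_mod_cast hM
  have hc' : ∀ i, 4 * |c i| ≤ (base : ℤ) := fun i => by
    have := hc i
    push_cast at this
    linarith
  have hd' : ∀ i, 4 * |d i| ≤ (base : ℤ) := fun i => by
    have := hd i
    push_cast at this
    linarith
  have hle : ∀ i, 4 * |e i| ≤ (base : ℤ) := by
    intro i
    refine Fin.addCases (m := 8) (n := 8) (fun i => ?_) (fun i => ?_) i
    · rw [he, Fin.append_left]
      fin_cases i <;> simp [hc', hd']
    · rw [he, Fin.append_right]
      fin_cases i <;> simp [hc', hd']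
  rw [ZMod.intCast_zmod_eq_zero_iff_dvd] at key
  have hz : ∑ i, e i * (base : ℤ) ^ (i : ℕ) = 0 := by
    refine Int.eq_zero_of_abs_lt_dvd key ((abs_digits_lt 16 e hle hB).trans_le ?_)
    rw [hN]
    have : (0 : ℤ) < base := by linarith
    have := pow_pos this 12
    have := pow_pos ‹(0 : ℤ) < base› 8
    have := pow_pos ‹(0 : ℤ) < base› 4
    linarith
  have he0 := digits_eq_zero 16 e hle (by linarith) hz
  have hcd : c = 0 ∧ d = 0 := by
    have q := fun i : Fin 16 => congrFun he0 i
    have q1 : ∀ i : Fin 8, e (Fin.castAdd 8 i) = 0 := fun i => q _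
    have q2 : ∀ i : Fin 8, e (Fin.natAdd 8 i) = 0 := fun i => q _
    simp only [he, Fin.append_left, Fin.append_right] at q1 q2
    have r1 := q1 0; have r2 := q1 1; have r3 := q1 2; have r4 := q1 3
    have r5 := q1 4; have r6 := q1 5; have r7 := q1 6; have r8 := q1 7
    have s1 := q2 0; have s2 := q2 1; have s3 := q2 2; have s4 := q2 3
    have s5 := q2 4; have s6 := q2 5; have s7 := q2 6; have s8 := q2 7
    constructor <;> funext i <;> fin_cases i <;> assumption
  rw [hcd.1] at ha
  rw [hcd.2] at hb
  have ha1 := congrArg Prod.fst ha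
  have hb1 := congrArg Prod.fst hb
  simp at ha1 hb1
  simp [ha1, hb1]

/-! ### The structure constants over the number field -/

/-- A value of the normalised trivalent vertex. A number is encoded by four times its coordinates with
respect to the products of `1, √2, √3, √6` by `1, i, θ, i θ`, where `θ = √((√2 - 1) (√3 - √2))`;
trailing zeros are omitted. -/
def v1 : List ℤ := [-4, 0, 0, 2, 0, 0, 0, 0, -2, -2, 2, 2]

/-- A value of the normalised trivalent vertex. -/
def v2 : List ℤ := [-4, 0, 0, 2, 0, 0, 0, 0, 2, 2, -2, -2]

/-- A value of the normalised trivalent vertex. -/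
def v3 : List ℤ := [-2, 1, 0, -1]

/-- A value of the normalised trivalent vertex. -/
def v4 : List ℤ := [-2, 2, 2]

/-- A value of the normalised trivalent vertex. -/
def v5 : List ℤ := [0, -3, -2, 1]

/-- A value of the normalised trivalent vertex. -/
def v6 : List ℤ := [0, 0, 0, 0, 0, 0, 0, 0, -2, 0, -2, -2]

/-- A value of the normalised trivalent vertex. -/
def v7 : List ℤ := [0, 0, 0, 0, 0, 0, 0, 0, 2, 0, 2, 2]

/-- A value of the normalised trivalent vertex. -/
def v8 : List ℤ := [2, 0, 0, 0, 0, 0, 0, 0, -4, -1, 0, -1]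

/-- A value of the normalised trivalent vertex. -/
def v9 : List ℤ := [2, 0, 0, 0, 0, 0, 0, 0, 4, 1, 0, 1]

/-- A value of the normalised trivalent vertex. -/
def v10 : List ℤ := [2, 2, 2]

/-- The normalised trivalent vertex of `Γ₄`. A number is encoded by four times its coordinates with
respect to the products of `1, √2, √3, √6` by `1, i, θ, i θ`. -/
def triLit : Fin 6 → Matrix (Fin 6) (Fin 6) (List ℤ) := ![
  !![[], [], [], [], [], [];
       [], v10, [], [], [], v4;
       [], [], [], [], [], [];
       [], [], [], [], [], [];
       [], [], [], [], [], [];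
       [], v4, [], [], [], v10],
  !![[], v10, [], [], [], v4;
       v10, v5, v8, [], v1, v3;
       [], v8, v9, [], v7, v6;
       [], [], [], [], [], [];
       [], v1, v7, [], v2, v6;
       v4, v3, v6, [], v6, v3],
  !![[], [], [], [], [], [];
       [], v8, v9, [], v7, v6;
       [], v9, v5, v10, v3, v2;
       [], [], v10, [], v4, [];
       [], v7, v3, v4, v3, v6;
       [], v6, v2, [], v6, v1],
  !![[], [], [], [], [], [];
       [], [], [], [], [], [];
       [], [], v10, [], v4, [];
       [], [], [], [], [], [];
       [], [], v4, [], v10, [];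
       [], [], [], [], [], []],
  !![[], [], [], [], [], [];
       [], v1, v7, [], v2, v6;
       [], v7, v3, v4, v3, v6;
       [], [], v4, [], v10, [];
       [], v2, v3, v10, v5, v9;
       [], v6, v6, [], v9, v8],
  !![[], v4, [], [], [], v10;
       v4, v3, v6, [], v6, v3;
       [], v6, v2, [], v6, v1;
       [], [], [], [], [], [];
       [], v6, v6, [], v9, v8;
       v10, v3, v1, [], v8, v5]]

/-- The weights of the inner edges. -/
def wtLit : Matrix (Fin 6) (Fin 6) (List ℤ) :=
  !![[], [4], [], [], [], [4];
     [4], [-4, 2, 0, 2], [4], [], [4, 0, 0, 2], [-4, 2, 0, 2];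
     [], [4], [-4, 2, 0, 2], [4], [-4, 2, 0, 2], [4, 0, 0, 2];
     [], [], [4], [], [4], [];
     [], [4, 0, 0, 2], [-4, 2, 0, 2], [4], [-4, 2, 0, 2], [4];
     [4], [-4, 2, 0, 2], [4, 0, 0, 2], [], [4], [-4, 2, 0, 2]]

/-- The inverses of the weights of the inner edges. -/
def iwtLit : Matrix (Fin 6) (Fin 6) (List ℤ) :=
  !![[], [4], [], [], [], [4];
     [4], [-2, 2, 2], [4], [], [-8, 0, 0, 4], [-2, 2, 2];
     [], [4], [-2, 2, 2], [4], [-2, 2, 2], [-8, 0, 0, 4];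
     [], [], [4], [], [4], [];
     [], [-8, 0, 0, 4], [-2, 2, 2], [4], [-2, 2, 2], [4];
     [4], [-2, 2, 2], [-8, 0, 0, 4], [], [4], [-2, 2, 2]]

/-- The left factor of the normalised red strand through the region `b`, with the region `a` on its
left. -/
def redLitL : Matrix (Fin 6) (Fin 6) (List ℤ) :=
  !![[], [4], [], [], [], [-4];
     [4], [0, 2, 0, 0, 0, 2], [0, 0, 0, 0, 2, 1, 0, 1, -2, 1, 0, -1], [],
         [0, 0, 0, 0, -2, 2, -2, 0, -2, -2, 2], [0, 2, 0, 0, 0, -2];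
     [], [0, 0, 0, 0, 2, 1, 0, 1, 2, -1, 0, 1], [0, 2, 0, 0, 0, 2], [4], [0, 2, 0, 0, 0, -2],
         [0, 0, 0, 0, 2, -2, 2, 0, -2, -2, 2];
     [], [], [4], [], [-4], [];
     [], [0, 0, 0, 0, -2, 2, -2, 0, 2, 2, -2], [0, 2, 0, 0, 0, -2], [4], [0, 2, 0, 0, 0, 2],
         [0, 0, 0, 0, -2, -1, 0, -1, -2, 1, 0, -1];
     [4], [0, 2, 0, 0, 0, -2], [0, 0, 0, 0, -2, 2, -2, 0, -2, -2, 2], [],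
         [0, 0, 0, 0, 2, 1, 0, 1, -2, 1, 0, -1], [0, 2, 0, 0, 0, 2]]

/-- The right factor of the normalised red strand. -/
def redLitR : Matrix (Fin 6) (Fin 6) (List ℤ) :=
  !![[], [4], [], [], [], [-4];
     [4], [0, 2, 0, 0, 0, -2], [0, 0, 0, 0, -2, -1, 0, -1, -2, 1, 0, -1], [],
         [0, 0, 0, 0, 2, -2, 2, 0, -2, -2, 2], [0, 2, 0, 0, 0, 2];
     [], [0, 0, 0, 0, -2, -1, 0, -1, 2, -1, 0, 1], [0, 2, 0, 0, 0, -2], [4], [0, 2, 0, 0, 0, 2],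
         [0, 0, 0, 0, -2, 2, -2, 0, -2, -2, 2];
     [], [], [4], [], [-4], [];
     [], [0, 0, 0, 0, 2, -2, 2, 0, 2, 2, -2], [0, 2, 0, 0, 0, 2], [4], [0, 2, 0, 0, 0, -2],
         [0, 0, 0, 0, 2, 1, 0, 1, -2, 1, 0, -1];
     [4], [0, 2, 0, 0, 0, 2], [0, 0, 0, 0, 2, -2, 2, 0, -2, -2, 2], [],
         [0, 0, 0, 0, -2, -1, 0, -1, -2, 1, 0, -1], [0, 2, 0, 0, 0, -2]]

/-- The Frobenius–Perron weights up to a common factor. -/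
def lamLit : Fin 6 → List ℤ := ![[-8, 0, 0, 4], [4], [4], [-8, 0, 0, 4], [4], [4]]

/-- The inverses of the Frobenius–Perron weights. -/
def ilamLit : Fin 6 → List ℤ := ![[4, 0, 0, 2], [4], [4], [4, 0, 0, 2], [4], [4]]

/-- The coefficients of the trees in (decPentagon): lists of exponents of `q ^ 2`, where
`-1 = q ^ 24`. -/
def treeExp : Fin 6 → Fin 5 → List ℕ := ![
  ![[4, 14, 22, 23], [15, 14], [], [], [14]],
  ![[9], [15, 13, 10], [], [16, 14, 10], [10]],
  ![[3], [], [4, 9], [21], []],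
  ![[14], [3, 1], [20], [4, 2, 13], []],
  ![[8], [], [7], [], []],
  ![[17, 2, 0], [1, 23], [23], [0, 23, 22], []]]

/-- The coefficients of the forests in (decPentagon): lists of exponents of `q ^ 2`, where
`-1 = q ^ 24`. -/
def forestExp : Fin 6 → Fin 5 → List ℕ := ![
  ![[0], [14, 13, 8], [14, 0, 9], [21], [14, 12, 10]],
  ![[], [6, 16], [23], [10], [6, 4, 10]],
  ![[11, 10], [], [3, 2, 0], [9], []],
  ![[18], [2, 21], [], [6, 13, 11, 7], [16, 14]],
  ![[7], [23], [16, 15, 14, 13], [], [0]],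
  ![[6, 4, 9], [12], [16, 10], [6, 13, 13, 11, 8], []]]

/-- The involution of the vertices by which the red strand acts on the region that it crosses. -/
def invol : Fin 6 → Fin 6 := ![0, 5, 4, 3, 2, 1]

/-! ### Formulas for the coordinates of diagrams -/

/-- The operations in which the coordinates of diagrams are expressed: sums, products and the
constants with given coordinates or exponents. No laws are assumed: the formulas below are evaluated
in `ℂ`, in the natural numbers modulo `modN`, and, to measure the size of their values, in the
natural numbers with the operations `sizeOps`. -/
structure Ops (R : Type) where
  /-- The sum. -/
  add : R → R → R
  /-- The product. -/
  mul : R → R → R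
  /-- The number with given coordinates. -/
  lit : List ℤ → R
  /-- The sum of the powers of `q ^ 2` with given exponents. -/
  root : List ℕ → R
  /-- The product with the truth value of a condition. -/
  guard : Bool → R → R

namespace Ops
variable {R : Type} (O : Ops R)

/-- The normalised trivalent vertex. -/
def y (a b c : Fin 6) : R := O.lit (triLit a b c)

/-- The weight of an inner edge. -/
def w (a b : Fin 6) : R := O.lit (wtLit a b)

/-- The inverse weight of an edge. -/
def iw (a b : Fin 6) : R := O.lit (iwtLit a b)

/-- The Frobenius–Perron weight. -/
def lam (a : Fin 6) : R := O.lit (lamLit a)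

/-- The inverse Frobenius–Perron weight. -/
def ilam (a : Fin 6) : R := O.lit (ilamLit a)

/-- The normalised coefficient of a red strand through the region `b` between `a` and `c`. -/
def rho (a b c : Fin 6) : R := O.mul (O.lit (redLitL b a)) (O.lit (redLitR b c))

/-- The sum over the vertices; the summand also depends on the image of the vertex under `invol`. -/
def sum6 (f : Fin 6 → Fin 6 → R) : R :=
  O.add (f 0 0) (O.add (f 1 5) (O.add (f 2 4) (O.add (f 3 3) (O.add (f 4 2) (f 5 1)))))

/-- The sum of five terms. -/
def sum5 (f : Fin 5 → R) : R :=
  O.add (f 0) (O.add (f 1) (O.add (f 2) (O.add (f 3) (f 4))))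

/-- The value of `f` at the `j`-th rotation of five regions. -/
def rot5 (f : Fin 6 → Fin 6 → Fin 6 → Fin 6 → Fin 6 → R) (a b c d e : Fin 6) : Fin 5 → R
  | 0 => f a b c d e
  | 1 => f b c d e a
  | 2 => f c d e a b
  | 3 => f d e a b c
  | 4 => f e a b c d

/-- The tree with two vertices. -/
def tree4 (a b c d : Fin 6) : R := O.mul (O.y a b c) (O.mul (O.w a c) (O.y a c d))

/-- The tree with three vertices. -/
def tree5 (a b c d e : Fin 6) : R :=
  O.mul (O.y a b c) (O.mul (O.w a c) (O.mul (O.y a c d) (O.mul (O.w a d) (O.y a d e))))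

/-- Two arcs side by side. -/
def arcs (a b c d : Fin 6) : R := O.guard (c == a) (O.mul (O.iw a b) (O.mul (O.iw a d) (O.ilam a)))

/-- Two nested arcs. -/
def nest (a b c d : Fin 6) : R := O.guard (d == b) (O.mul (O.iw a b) (O.mul (O.iw b c) (O.ilam b)))

/-- An arc next to a vertex. -/
def forest5 (a b c d e : Fin 6) : R :=
  O.guard (c == a) (O.mul (O.iw a b) (O.mul (O.y a d e) (O.ilam a)))

/-- Two arcs joined by a red strand. -/
def ladder (a b b' c d : Fin 6) : R :=
  O.guard (d == b') (O.mul (O.rho a b c) (O.mul (O.iw a d) (O.mul (O.iw d c) (O.ilam d))))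

/-- The bigon whose first vertex has the coordinates `v`. -/
def gon2 (v : Fin 6 → Fin 6 → R) (a b : Fin 6) : R :=
  O.sum6 fun x x' => O.mul (v x x') (O.mul (O.lam x) (O.mul (O.y a b x)
    (O.mul (O.w a b) (O.mul (O.w b x) (O.w x a)))))

/-- The trigon whose first vertex has the coordinates `v`. -/
def gon3 (v : Fin 6 → Fin 6 → R) (a b c : Fin 6) : R :=
  O.sum6 fun x x' => O.mul (v x x') (O.mul (O.y x b c) (O.mul (O.y c a x)
    (O.mul (O.lam x) (O.mul (O.w a x) (O.mul (O.w b x) (O.w c x))))))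

/-- The tetragon whose first vertex has the coordinates `v`. -/
def gon4 (v : Fin 6 → Fin 6 → R) (a b c d : Fin 6) : R :=
  O.sum6 fun x x' => O.mul (v x x') (O.mul (O.y x b c) (O.mul (O.y x c d) (O.mul (O.y d a x)
    (O.mul (O.lam x) (O.mul (O.w a x) (O.mul (O.w b x) (O.mul (O.w c x) (O.w d x))))))))

/-- The pentagon whose first vertex has the coordinates `v`. -/
def gon5 (v : Fin 6 → Fin 6 → R) (a b c d e : Fin 6) : R :=
  O.sum6 fun x x' => O.mul (v x x') (O.mul (O.y x b c) (O.mul (O.y x c d) (O.mul (O.y x d e)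
    (O.mul (O.y e a x) (O.mul (O.lam x) (O.mul (O.w a x) (O.mul (O.w b x) (O.mul (O.w c x)
      (O.mul (O.w d x) (O.w e x))))))))))

/-- The vertex with a red strand in its first region; the three arguments that follow the involved
region and its image are the regions around the vertex. -/
def dec1 (a b b' c : Fin 6) : R := O.mul (O.rho a b c) (O.y a b' c)

/-- The vertex with a red strand in its second region. -/
def dec2 (a b c c' : Fin 6) : R := O.mul (O.rho b c a) (O.y a b c')

/-- The vertex with a red strand in its third region. -/
def dec3 (a a' b c : Fin 6) : R := O.mul (O.rho c a b) (O.y a' b c)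

/-- The right-hand side of (Tetragon). -/
def tetR (a b c d : Fin 6) : R :=
  O.add (O.mul (O.root [1, 23]) (O.add (O.tree4 a b c d) (O.tree4 b c d a)))
    (O.mul (O.root [1, 0, 23]) (O.add (O.arcs a b c d) (O.nest a b c d)))

/-- The right-hand side of (Pentagon). -/
def pentR (a b c d e : Fin 6) : R :=
  O.mul (O.root [12]) (O.add (O.sum5 (rot5 O.tree5 a b c d e)) (O.sum5 (rot5 O.forest5 a b c d e)))

/-- The right-hand side of the three relations (decTrigon), where `v` is the decorated vertex. -/
def decTriR (v : R) (a b c : Fin 6) : R :=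
  O.add (O.mul (O.root [12]) (O.y a b c)) (O.mul (O.root [12]) v)

/-- The right-hand side of (decTetragon). -/
def decTetR (a a' b b' c c' d : Fin 6) : R :=
  O.add (O.mul (O.root [1]) (O.tree4 a b c d)) (O.add (O.mul (O.root [1]) (O.tree4 b c d a))
  (O.add (O.mul (O.root [4, 3, 2, 1]) (O.arcs a b c d)) (O.add (O.mul (O.root [1]) (O.nest a b c d))
  (O.add (O.mul (O.root [23, 22, 22, 21]) (O.ladder d a a' b c))
  (O.add (O.mul (O.root [18, 17]) (O.ladder a b b' c d))
  (O.add (O.mul (O.root [17]) (O.mul (O.rho a b c) (O.tree4 a b' c d)))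
  (O.add (O.mul (O.root [18, 17]) (O.mul (O.rho a b c) (O.tree4 b' c d a)))
    (O.mul (O.root [12]) (O.mul (O.rho b c d) (O.tree4 b c' d a))))))))))

/-- The rotations of the tree and of the forest with the coefficients of row `i`. -/
def pentRow (i a b c d e : Fin 6) : R :=
  O.add (O.sum5 fun j => O.mul (O.root (treeExp i j)) (rot5 O.tree5 a b c d e j))
    (O.sum5 fun j => O.mul (O.root (forestExp i j)) (rot5 O.forest5 a b c d e j))

/-- The right-hand side of (decPentagon). -/
def decPentR (a a' b b' c c' d d' e e' : Fin 6) : R :=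
  O.add (O.pentRow 0 a b c d e)
    (O.add (O.mul (O.rho a b c) (O.pentRow 1 a b' c d e))
    (O.add (O.mul (O.rho b c d) (O.pentRow 2 a b c' d e))
    (O.add (O.mul (O.rho c d e) (O.pentRow 3 a b c d' e))
    (O.add (O.mul (O.rho d e a) (O.pentRow 4 a b c d e'))
      (O.mul (O.rho e a b) (O.pentRow 5 a' b c d e))))))

end Ops

/-! ### Evaluation modulo an integer -/

/-- The image of the primitive `24`-th root of unity in `ZMod modN`. -/
def rootN : ℕ :=
  (127 + 255 * base ^ 2 + 195 * base ^ 4 + 195 * base ^ 6 + 61 * base ^ 8 + 61 * base ^ 10 +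
    base ^ 12 + base ^ 14) * ((modN + 1) / 2) ^ 7 % modN

/-- The image of the square root of `(√2 - 1) (√3 - √2)` in `ZMod modN`. -/
def sqrtN : ℕ := base * rootN ^ 21 % modN

/-- The residue of an integer. -/
def natInt : ℤ → ℕ
  | .ofNat n => n
  | .negSucc n => Nat.sub modN (Nat.succ n)

/-- The images of the products of `1, √2, √3, √6` by `1, i, θ, i θ`. -/
def basisN : List ℕ :=
  let l := [1, (rootN ^ 3 + rootN ^ 21) % modN, (rootN ^ 2 + rootN ^ 22) % modN,
    (rootN ^ 3 + rootN ^ 21) * (rootN ^ 2 + rootN ^ 22) % modN]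
  l ++ l.map (fun b => b * rootN ^ 6) ++ l.map (fun b => b * sqrtN) ++
    l.map (fun b => b * rootN ^ 6 * sqrtN)

/-- The operations of the natural numbers modulo `modN`. The definitions are chosen for fast
reduction; in particular a product whose first factor is `0` does not evaluate the second one. -/
def natOps : Ops ℕ where
  add := Nat.add
  mul a b := Nat.rec 0 (fun _ _ => Nat.mod (Nat.mul a b) modN) a
  lit l := (List.zipWith (fun z b => natInt z * b) l basisN).sum * ((modN + 1) / 2) ^ 2 % modN
  root l := (l.map fun k => rootN ^ k % modN).sum % modN
  guard b n := cond b n 0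

/-- Conjunction over the vertices, together with their images under `invol`. -/
def all6 (f : Fin 6 → Fin 6 → Bool) : Bool :=
  f 0 0 && (f 1 5 && (f 2 4 && (f 3 3 && (f 4 2 && f 5 1))))

/-- Conjunction over the neighbours of a vertex. -/
def allAdj (a : Fin 6) (f : Fin 6 → Fin 6 → Bool) : Bool :=
  all6 fun b b' => cond (adj4 a b) (f b b') true

/-- Equality modulo `modN`. -/
def eqN (m n : ℕ) : Bool := Nat.beq (Nat.mod m modN) (Nat.mod n modN)

theorem all6_spec {f : Fin 6 → Fin 6 → Bool} (h : all6 f = true) (a : Fin 6) :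
    f a (invol a) = true := by
  simp only [all6, Bool.and_eq_true] at h
  obtain ⟨h0, h1, h2, h3, h4, h5⟩ := h
  fin_cases a <;> assumption

theorem allAdj_spec {a : Fin 6} {f : Fin 6 → Fin 6 → Bool} (h : allAdj a f = true) {b : Fin 6}
    (hab : adj4 a b = true) : f b (invol b) = true := by
  have := all6_spec h b
  simpa [hab] using this

theorem cond_spec {p b : Bool} (hp : p = true) (h : cond p b true = true) : b = true := by
  subst hp; exact h

theorem eqN_spec {m n : ℕ} (h : eqN m n = true) : (m : ZMod modN) = n :=
  (ZMod.natCast_eq_natCast_iff _ _ _).2 (Nat.eq_of_beq_eq_true h)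

/-! ### From residues to complex numbers -/

/-- `√((√2 - 1) (√3 - √2))`. -/
def theta : ℂ := ((√((√2 - 1) * (√3 - √2)) : ℝ) : ℂ)

/-- The number encoded by a list of integers, where `x` is a primitive `24`-th root of unity, `t` is
`θ` and `h` is `1 / 2`: a quarter of the combination of the products of `1, √2, √3, √6` by
`1, i, θ, i θ` with these coefficients. -/
def ringLit {R : Type*} [CommRing R] (x t h : R) (l : List ℤ) : R :=
  h ^ 2 * (List.zipWith (fun (z : ℤ) b => (z : R) * b) l
    (let l := [1, x ^ 3 + x ^ 21, x ^ 2 + x ^ 22, (x ^ 3 + x ^ 21) * (x ^ 2 + x ^ 22)]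
     l ++ l.map (fun b => b * x ^ 6) ++ l.map (fun b => b * t) ++
      l.map (fun b => b * x ^ 6 * t))).sum

theorem ringLit_eq {R : Type*} [CommRing R] (x t h : R) (l : List ℤ) :
    ringLit x t h l = h ^ 2 * (List.zipWith (fun (z : ℤ) b => (z : R) * b) l
    [1, x ^ 3 + x ^ 21, x ^ 2 + x ^ 22, (x ^ 3 + x ^ 21) * (x ^ 2 + x ^ 22),
     1 * x ^ 6, (x ^ 3 + x ^ 21) * x ^ 6, (x ^ 2 + x ^ 22) * x ^ 6,
     (x ^ 3 + x ^ 21) * (x ^ 2 + x ^ 22) * x ^ 6,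
     1 * t, (x ^ 3 + x ^ 21) * t, (x ^ 2 + x ^ 22) * t, (x ^ 3 + x ^ 21) * (x ^ 2 + x ^ 22) * t,
     1 * x ^ 6 * t, (x ^ 3 + x ^ 21) * x ^ 6 * t, (x ^ 2 + x ^ 22) * x ^ 6 * t,
     (x ^ 3 + x ^ 21) * (x ^ 2 + x ^ 22) * x ^ 6 * t]).sum := rfl

theorem map_zipWith_sum {R S : Type*} [CommRing R] [CommRing S] (f : R →+* S) (l : List ℤ)
    (b : List R) : f (List.zipWith (fun (z : ℤ) b => (z : R) * b) l b).sum =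
      (List.zipWith (fun (z : ℤ) b => (z : S) * b) l (b.map f)).sum := by
  induction l generalizing b with
  | nil => simp
  | cons z l ih => cases b <;> simp [ih]

theorem map_ringLit {R S : Type*} [CommRing R] [CommRing S] (f : R →+* S) (x t h : R) (l : List ℤ) :
    f (ringLit x t h l) = ringLit (f x) (f t) (f h) l := by
  rw [ringLit_eq, ringLit_eq, map_mul, map_zipWith_sum]
  simp only [List.map_cons, List.map_nil, map_mul, map_add, map_pow, map_one]

/-- The sum of the powers of `x` with given exponents. -/
def ringRoot {R : Type*} [CommRing R] (x : R) (l : List ℕ) : R := (l.map fun k => x ^ k).sum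

theorem map_ringRoot {R S : Type*} [CommRing R] [CommRing S] (f : R →+* S) (x : R) (l : List ℕ) :
    f (ringRoot x l) = ringRoot (f x) l := by
  simp [ringRoot, map_list_sum, Function.comp_def]

/-- The operations of the complex numbers. -/
def cOps : Ops ℂ where
  add := (· + ·)
  mul := (· * ·)
  lit := ringLit (q4 ^ 2) theta (1 / 2)
  root := ringRoot (q4 ^ 2)
  guard b z := if b then z else 0

/-- The operations that keep track of the size of the values; see `IsBounded`. -/
def sizeOps : Ops ℕ where
  add m n := max m n + 1
  mul m n := m + n + 1
  lit _ := 2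
  root _ := 1
  guard _ n := n

section

variable {R : Type*} [CommRing R] {x t : R}

theorem IsSmall.nsmul {M : ℕ} {r : R} (hr : IsSmall x t M r) (k : ℕ) :
    IsSmall x t (k * M) (k * r) := by
  induction k with
  | zero => simpa using IsSmall.zero 0
  | succ k ih =>
    rw [Nat.cast_succ, Nat.succ_mul, add_mul, one_mul]
    exact ih.add hr

/-- Up to the denominator `2 ^ n`, `r` is a sum of at most `2 ^ (5 * n)` monomials. The exponent `5`
absorbs the factor `11` of `IsSmall.mul` into one additional unit of `n`. -/
def IsBounded (x t : R) (n : ℕ) (r : R) : Prop := IsSmall x t (2 ^ (5 * n)) (2 ^ n * r)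

theorem IsSmall.isBounded {M n : ℕ} {r : R} (hr : IsSmall x t M (2 ^ n * r)) (hM : M ≤ 2 ^ (5 * n)) :
    IsBounded x t n r := hr.mono hM

theorem IsBounded.mono {m n : ℕ} {r : R} (hr : IsBounded x t m r) (h : m ≤ n) :
    IsBounded x t n r := by
  obtain ⟨d, rfl⟩ := Nat.exists_eq_add_of_le h
  refine IsSmall.isBounded (M := 2 ^ d * 2 ^ (5 * m)) ?_ ?_
  · have := IsSmall.nsmul hr (2 ^ d)
    push_cast at this
    convert this using 1
    ring
  · rw [← pow_add]; exact Nat.pow_le_pow_right (by norm_num) (by omega)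

theorem IsBounded.add {m n : ℕ} {r s : R} (hr : IsBounded x t m r) (hs : IsBounded x t n s) :
    IsBounded x t (max m n + 1) (r + s) := by
  have h := (IsSmall.add (hr.mono (le_max_left m n)) (hs.mono (le_max_right m n))).nsmul 2
  refine IsSmall.isBounded (M := 2 * (2 ^ (5 * max m n) + 2 ^ (5 * max m n))) ?_ ?_
  · convert h using 1
    push_cast; ring
  · rw [mul_add 5, pow_add 2 (5 * max m n)]; omega

theorem IsBounded.mul (h : IsGen x t) {m n : ℕ} {r s : R} (hr : IsBounded x t m r)
    (hs : IsBounded x t n s) : IsBounded x t (m + n + 1) (r * s) := by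
  have h := (IsSmall.mul h hr hs).nsmul 2
  refine IsSmall.isBounded (M := 2 * (11 * 2 ^ (5 * m) * 2 ^ (5 * n))) ?_ ?_
  · convert h using 1
    push_cast; ring
  · rw [mul_add 5, pow_add 2 (5 * (m + n)), mul_add 5, pow_add, mul_assoc 11]; omega

theorem IsBounded.neg (h : IsGen x t) {n : ℕ} {r : R} (hr : IsBounded x t n r) :
    IsBounded x t n (-r) := by
  have := IsSmall.pow_mul hr 12
  rw [h.pow_twelve] at this
  simpa [IsBounded] using this

theorem IsSmall.zipWith_sum {M : ℕ} {l : List ℤ} {b : List R}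
    (hb : ∀ r ∈ b, IsSmall x t M r ∧ IsSmall x t M (-r)) :
    IsSmall x t ((l.map Int.natAbs).sum * M)
      (List.zipWith (fun (z : ℤ) b => (z : R) * b) l b).sum := by
  induction l generalizing b with
  | nil => simpa using IsSmall.zero 0
  | cons z l ih =>
    cases b with
    | nil => simpa using IsSmall.zero _
    | cons r b =>
      simp only [List.zipWith_cons_cons, List.sum_cons, List.map_cons, add_mul]
      refine IsSmall.add ?_ (ih fun r hr => hb r (List.mem_cons_of_mem _ hr))
      obtain ⟨h1, h2⟩ := hb r List.mem_cons_self
      obtain hz | hz := Int.natAbs_eq z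
      · have e : (z : R) = ((z.natAbs : ℤ) : R) := congrArg _ hz
        rw [e, Int.cast_natCast]
        exact h1.nsmul z.natAbs
      · have e : (z : R) = ((-(z.natAbs : ℤ) : ℤ) : R) := congrArg _ hz
        rw [e, Int.cast_neg, Int.cast_natCast, neg_mul, ← mul_neg]
        exact h2.nsmul z.natAbs

theorem IsBounded.ringLit (h : IsGen x t) {c : R} (hc : 2 * c = 1) {l : List ℤ}
    (hl : (l.map Int.natAbs).sum ≤ 256) : IsBounded x t 2 (ringLit x t c l) := by
  rw [ringLit_eq]
  refine IsSmall.isBounded (M := (l.map Int.natAbs).sum * 4) ?_ (by omega)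
  rw [← mul_assoc, ← mul_pow, hc, one_pow, one_mul]
  refine IsSmall.zipWith_sum fun r hr => ?_
  have key : ∀ r, IsSmall x t 4 r → IsSmall x t 4 r ∧ IsSmall x t 4 (-r) := fun r hr => by
    refine ⟨hr, ?_⟩
    have := hr.pow_mul 12
    rwa [h.pow_twelve, neg_one_mul] at this
  have p := fun k => IsSmall.pow (x := x) (t := t) k
  have p1 : IsSmall x t 1 1 := by simpa using p 0
  have h6 : (x ^ 3 + x ^ 21) * (x ^ 2 + x ^ 22) = x ^ 5 + x ^ 25 + x ^ 23 + x ^ 43 := by ring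
  -- the four products of square roots
  have q1 : IsSmall x t 4 1 := p1.mono (by omega)
  have q2 : IsSmall x t 4 (x ^ 3 + x ^ 21) := ((p 3).add (p 21)).mono (by omega)
  have q3 : IsSmall x t 4 (x ^ 2 + x ^ 22) := ((p 2).add (p 22)).mono (by omega)
  have q4 : IsSmall x t 4 ((x ^ 3 + x ^ 21) * (x ^ 2 + x ^ 22)) := by
    rw [h6]; exact (((p 5).add (p 25)).add (p 23)).add (p 43)
  have pt := fun k => IsSmall.powMul (x := x) (t := t) k
  have t1 : IsSmall x t 4 (1 * t) := by simpa using (pt 0).mono (show 1 ≤ 4 by omega)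
  have t2 : IsSmall x t 4 ((x ^ 3 + x ^ 21) * t) := by
    rw [add_mul]; exact ((pt 3).add (pt 21)).mono (by omega)
  have t3 : IsSmall x t 4 ((x ^ 2 + x ^ 22) * t) := by
    rw [add_mul]; exact ((pt 2).add (pt 22)).mono (by omega)
  have t4 : IsSmall x t 4 ((x ^ 3 + x ^ 21) * (x ^ 2 + x ^ 22) * t) := by
    rw [h6, add_mul, add_mul, add_mul]; exact (((pt 5).add (pt 25)).add (pt 23)).add (pt 43)
  have hi : ∀ r, IsSmall x t 4 r → IsSmall x t 4 (r * x ^ 6) := fun r hr => by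
    rw [mul_comm]; exact hr.pow_mul 6
  have hi' : ∀ r, IsSmall x t 4 (r * t) → IsSmall x t 4 (r * x ^ 6 * t) := fun r hr => by
    rw [mul_right_comm]; exact hi _ hr
  simp only [List.mem_cons, List.not_mem_nil, or_false] at hr
  rcases hr with rfl | rfl | rfl | rfl | rfl | rfl | rfl | rfl | rfl | rfl | rfl | rfl | rfl | rfl |
    rfl | rfl <;> apply key <;> first | assumption | exact hi _ ‹_› | exact hi' _ ‹_›

theorem IsBounded.ringRoot {l : List ℕ} (hl : l.length ≤ 16) :
    IsBounded x t 1 (ringRoot x l) := by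
  have : IsSmall x t l.length (GPA.ringRoot x l) := by
    clear hl
    induction l with
    | nil => exact .zero _
    | cons k l ih =>
      rw [GPA.ringRoot, List.map_cons, List.sum_cons, List.length_cons, add_comm l.length]
      exact IsSmall.add (.pow k) ih
  refine IsSmall.isBounded (M := 2 * l.length) ?_ (by omega)
  simpa using this.nsmul 2

theorem IsBounded.fst_eq_zero {x t : ℂ × ZMod modN} (h : IsGen x t)
    (hx : (x ^ 3 * t).2 = (base : ℕ)) {r : ℂ × ZMod modN} (hr : IsBounded x t 48 r)
    (h0 : r.2 = 0) : r.1 = 0 := by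
  have := IsSmall.fst_eq_zero h hx (by norm_num [base]) hr (by simp [h0])
  simpa using this

end

/-- The pair of the complex `24`-th root of unity and its residue. -/
def pairRoot : ℂ × ZMod modN := (q4 ^ 2, (rootN : ℕ))

/-- The pair of the complex number `theta` and its residue. -/
def pairSqrt : ℂ × ZMod modN := (theta, (sqrtN : ℕ))

/-- The pair of the two inverses of `2`. -/
def pairHalf : ℂ × ZMod modN := (1 / 2, ((modN + 1) / 2 : ℕ))

theorem q4_sq : q4 ^ 2 = Complex.exp ((Real.pi / 12 : ℝ) * Complex.I) := by
  rw [q4, ← Complex.exp_nat_mul]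
  congr 1
  push_cast; ring

theorem root_sq : (q4 ^ 2) ^ 2 = (√3 : ℝ) / 2 + Complex.I / 2 := by
  rw [q4_sq, ← Complex.exp_nat_mul]
  have : ((2 : ℕ) : ℂ) * ((Real.pi / 12 : ℝ) * Complex.I) = (Real.pi / 6 : ℝ) * Complex.I := by
    push_cast; ring
  rw [this, Complex.exp_mul_I, ← Complex.ofReal_cos, ← Complex.ofReal_sin, Real.cos_pi_div_six,
    Real.sin_pi_div_six]
  push_cast; ring

theorem root_cube : (q4 ^ 2) ^ 3 = (√2 : ℝ) / 2 + (√2 : ℝ) / 2 * Complex.I := by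
  rw [q4_sq, ← Complex.exp_nat_mul]
  have : ((3 : ℕ) : ℂ) * ((Real.pi / 12 : ℝ) * Complex.I) = (Real.pi / 4 : ℝ) * Complex.I := by
    push_cast; ring
  rw [this, Complex.exp_mul_I, ← Complex.ofReal_cos, ← Complex.ofReal_sin, Real.cos_pi_div_four,
    Real.sin_pi_div_four]
  push_cast; ring

theorem sqrt_two_sq : ((√2 : ℝ) : ℂ) ^ 2 = 2 := by
  rw [← Complex.ofReal_pow, Real.sq_sqrt (by norm_num)]; norm_num

theorem sqrt_three_sq : ((√3 : ℝ) : ℂ) ^ 2 = 3 := by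
  rw [← Complex.ofReal_pow, Real.sq_sqrt (by norm_num)]; norm_num

theorem root_six : (q4 ^ 2) ^ 6 = Complex.I := by
  have : (q4 ^ 2) ^ 6 = ((q4 ^ 2) ^ 3) ^ 2 := by ring
  rw [this, root_cube]
  linear_combination (1 + Complex.I) ^ 2 / 4 * sqrt_two_sq + (1 / 2) * Complex.I_sq

theorem root_eighteen : (q4 ^ 2) ^ 18 = -Complex.I := by
  have : (q4 ^ 2) ^ 18 = ((q4 ^ 2) ^ 6) ^ 3 := by ring
  rw [this, root_six]
  linear_combination Complex.I * Complex.I_sq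

theorem root_add_two : (q4 ^ 2) ^ 3 + (q4 ^ 2) ^ 21 = (√2 : ℝ) := by
  have : (q4 ^ 2) ^ 3 + (q4 ^ 2) ^ 21 = (q4 ^ 2) ^ 3 * (1 + (q4 ^ 2) ^ 18) := by ring
  rw [this, root_cube, root_eighteen]
  linear_combination (-(√2 : ℝ) / 2 : ℂ) * Complex.I_sq

theorem root_add_three : (q4 ^ 2) ^ 2 + (q4 ^ 2) ^ 22 = (√3 : ℝ) := by
  have : (q4 ^ 2) ^ 2 + (q4 ^ 2) ^ 22 =
    (q4 ^ 2) ^ 2 + ((q4 ^ 2) ^ 2) ^ 2 * (q4 ^ 2) ^ 18 := by ring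
  rw [this, root_eighteen, root_sq]
  linear_combination -Complex.I / 4 * sqrt_three_sq - ((√3 : ℝ) / 2 + Complex.I / 4) * Complex.I_sq

theorem root_cyc : (q4 ^ 2) ^ 8 = (q4 ^ 2) ^ 4 - 1 := by
  have h8 : (q4 ^ 2) ^ 8 = (q4 ^ 2) ^ 2 * (q4 ^ 2) ^ 6 := by ring
  have h4 : (q4 ^ 2) ^ 4 = ((q4 ^ 2) ^ 2) ^ 2 := by ring
  rw [h8, h4, root_six, root_sq]
  linear_combination -(1 / 4) * sqrt_three_sq + 1 / 4 * Complex.I_sq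

theorem theta_sq : theta ^ 2 = ((√2 : ℝ) - 1) * ((√3 : ℝ) - (√2 : ℝ)) := by
  have h : (0 : ℝ) ≤ (√2 - 1) * (√3 - √2) := by
    refine mul_nonneg (sub_nonneg.2 ?_) (sub_nonneg.2 (Real.sqrt_le_sqrt (by norm_num)))
    rw [Real.one_le_sqrt]; norm_num
  rw [theta, ← Complex.ofReal_pow, Real.sq_sqrt h]
  push_cast; rfl

/-- The residues `rootN` and `sqrtN` satisfy the relations of `IsGen`, and `base` is the residue of
`x ^ 3 * t`. -/
theorem rootN_spec : (Nat.beq ((rootN ^ 8 + 1) % modN) (rootN ^ 4 % modN) &&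
    Nat.beq (rootN ^ 3 * sqrtN % modN) (base % modN) && Nat.beq ((modN + 1) / 2 * 2 % modN)
        (1 % modN) &&
    Nat.beq ((sqrtN ^ 2 + 2 + 2 * rootN ^ 2 + 2 * rootN ^ 7) % modN)
      ((2 * rootN + 2 * rootN ^ 3 + rootN ^ 6) % modN)) = true := by
  decide +kernel

theorem pair_isGen : IsGen pairRoot pairSqrt where
  cyc := by
    have h := rootN_spec
    simp only [Bool.and_eq_true] at h
    have h1 := eqN_spec h.1.1.1
    push_cast at h1
    refine Prod.ext ?_ ?_
    · simpa [pairRoot] using root_cyc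
    · simp only [pairRoot, Prod.pow_snd, Prod.snd_sub, Prod.snd_one]
      linear_combination h1
  sq := by
    have h := rootN_spec
    simp only [Bool.and_eq_true] at h
    have h1 := eqN_spec h.2
    push_cast at h1
    refine Prod.ext ?_ ?_
    · simp only [pairRoot, pairSqrt, Prod.pow_fst, Prod.fst_add, Prod.fst_sub, Prod.fst_mul,
        Prod.fst_neg, Prod.fst_ofNat, theta_sq]
      rw [← root_add_two, ← root_add_three]
      linear_combination ((q4 ^ 2) ^ 35 + (-1) * (q4 ^ 2) ^ 34 + (q4 ^ 2) ^ 31 +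
          (-1) * (q4 ^ 2) ^ 30 + (-1) * (q4 ^ 2) ^ 23 + (q4 ^ 2) ^ 22 + (-1) * (q4 ^ 2) ^ 19 +
          (q4 ^ 2) ^ 18 + (q4 ^ 2) ^ 17 + (-2) * (q4 ^ 2) ^ 16 + (q4 ^ 2) ^ 15 +
          (-1) * (q4 ^ 2) ^ 14 + 2 * (q4 ^ 2) ^ 13 + (-2) * (q4 ^ 2) ^ 12 + 2 * (q4 ^ 2) ^ 11 +
          (-2) * (q4 ^ 2) ^ 10 + (q4 ^ 2) ^ 9 + (q4 ^ 2) ^ 7 + (-1) * (q4 ^ 2) ^ 6 +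
          (-1) * (q4 ^ 2) ^ 5 + 2 * (q4 ^ 2) ^ 4 + (-1) * (q4 ^ 2) ^ 3 + (q4 ^ 2) ^ 2 +
          (-2) * q4 ^ 2 + 2) * root_cyc
    · simp only [pairRoot, pairSqrt, Prod.pow_snd, Prod.snd_add, Prod.snd_sub, Prod.snd_mul,
        Prod.snd_neg, Prod.snd_ofNat]
      linear_combination h1

theorem pair_base : (pairRoot ^ 3 * pairSqrt).2 = (base : ℕ) := by
  have h := rootN_spec
  simp only [Bool.and_eq_true] at h
  have h1 := eqN_spec h.1.1.2
  push_cast at h1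
  simpa [pairRoot, pairSqrt] using h1

theorem pair_half : 2 * pairHalf = 1 := by
  have h := rootN_spec
  simp only [Bool.and_eq_true] at h
  have h1 := eqN_spec h.1.2
  rw [Nat.cast_mul] at h1
  refine Prod.ext ?_ ?_
  · simp [pairHalf]
  · simp only [pairHalf, Prod.snd_mul, Prod.snd_ofNat, Prod.snd_one]
    push_cast at h1 ⊢
    linear_combination h1

/-- The complex number `z` belongs to the number field, its residue is `n`, and its size is at most
`s`. -/
def Rep (z : ℂ) (n s : ℕ) : Prop :=
  ∃ d : ℂ × ZMod modN, d.1 = z ∧ d.2 = (n : ZMod modN) ∧ IsBounded pairRoot pairSqrt s d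

namespace Rep

theorem zero (s : ℕ) : Rep 0 0 s := ⟨0, rfl, by simp, by simpa [IsBounded] using IsSmall.zero _⟩

theorem add {z z' : ℂ} {n n' s s' : ℕ} (h : Rep z n s) (h' : Rep z' n' s') :
    Rep (cOps.add z z') (natOps.add n n') (sizeOps.add s s') := by
  obtain ⟨d, rfl, h1, h2⟩ := h
  obtain ⟨d', rfl, h1', h2'⟩ := h'
  exact ⟨d + d', rfl, by simp [h1, h1', natOps], h2.add h2'⟩

theorem natOps_mul (n n' : ℕ) : ((natOps.mul n n' : ℕ) : ZMod modN) = n * n' := by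
  cases n with
  | zero => simp [natOps]
  | succ n =>
    have : natOps.mul (n + 1) n' = (n + 1) * n' % modN := rfl
    rw [this, ZMod.natCast_mod, Nat.cast_mul]

theorem mul {z z' : ℂ} {n n' s s' : ℕ} (h : Rep z n s) (h' : Rep z' n' s') :
    Rep (cOps.mul z z') (natOps.mul n n') (sizeOps.mul s s') := by
  obtain ⟨d, rfl, h1, h2⟩ := h
  obtain ⟨d', rfl, h1', h2'⟩ := h'
  exact ⟨d * d', rfl, by rw [natOps_mul, Prod.snd_mul, h1, h1'], h2.mul pair_isGen h2'⟩

theorem guard {z : ℂ} {n s : ℕ} (b : Bool) (h : Rep z n s) :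
    Rep (cOps.guard b z) (natOps.guard b n) (sizeOps.guard b s) := by
  cases b
  · exact zero s
  · exact h

theorem cast_natInt (z : ℤ) : ((natInt z : ℕ) : ZMod modN) = z ∨ modN < z.natAbs := by
  cases z with
  | ofNat n => exact Or.inl (by simp [natInt])
  | negSucc n =>
    rcases le_or_gt (n + 1) modN with h | h
    · left
      have : natInt (.negSucc n) = modN - (n + 1) := rfl
      rw [this, Nat.cast_sub h, Int.cast_negSucc]
      simp
    · exact Or.inr h

theorem cast_zipWith (l : List ℤ) (hl : ∀ z ∈ l, z.natAbs ≤ modN) (b : List ℕ) :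
    (((List.zipWith (fun z b => natInt z * b) l b).sum : ℕ) : ZMod modN) =
      (List.zipWith (fun (z : ℤ) b => (z : ZMod modN) * b) l (b.map (Nat.cast))).sum := by
  induction l generalizing b with
  | nil => simp
  | cons z l ih =>
    cases b with
    | nil => simp
    | cons r b =>
      have h := (cast_natInt z).resolve_right (not_lt.2 (hl z List.mem_cons_self))
      simp [ih (fun z hz => hl z (List.mem_cons_of_mem _ hz)), h]

theorem lit {l : List ℤ} (hl : (l.map Int.natAbs).sum ≤ 256) :
    Rep (cOps.lit l) (natOps.lit l) (sizeOps.lit l) := by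
  have h1 := map_ringLit (RingHom.fst ℂ (ZMod modN)) pairRoot pairSqrt pairHalf l
  have h2 := map_ringLit (RingHom.snd ℂ (ZMod modN)) pairRoot pairSqrt pairHalf l
  simp only [RingHom.coe_fst, RingHom.coe_snd] at h1 h2
  refine ⟨ringLit pairRoot pairSqrt pairHalf l, h1, h2.trans ?_,
    IsBounded.ringLit pair_isGen pair_half hl⟩
  have h : ∀ z ∈ l, z.natAbs ≤ modN := fun z hz => by
    have := List.le_sum_of_mem (List.mem_map_of_mem (f := Int.natAbs) hz)
    exact (this.trans hl).trans (by norm_num [modN, base])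
  have e : natOps.lit l = (List.zipWith (fun z b => natInt z * b) l basisN).sum *
    ((modN + 1) / 2) ^ 2 % modN := rfl
  rw [e, ZMod.natCast_mod, Nat.cast_mul, cast_zipWith l h, ringLit_eq, mul_comm, Nat.cast_pow]
  simp only [basisN, List.map_cons, List.map_nil, List.cons_append, List.nil_append,
    ZMod.natCast_mod, Nat.cast_mul, Nat.cast_add, Nat.cast_pow, Nat.cast_one, pairRoot, pairSqrt,
    pairHalf, RingHom.coe_snd]

theorem root {l : List ℕ} (hl : l.length ≤ 16) :
    Rep (cOps.root l) (natOps.root l) (sizeOps.root l) := by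
  have h1 := map_ringRoot (RingHom.fst ℂ (ZMod modN)) pairRoot l
  have h2 := map_ringRoot (RingHom.snd ℂ (ZMod modN)) pairRoot l
  simp only [RingHom.coe_fst, RingHom.coe_snd] at h1 h2
  refine ⟨ringRoot pairRoot l, h1, h2.trans ?_, IsBounded.ringRoot hl⟩
  have e : natOps.root l = (l.map fun k => rootN ^ k % modN).sum % modN := rfl
  rw [e, ZMod.natCast_mod, Nat.cast_list_sum, List.map_map]
  simp [ringRoot, pairRoot, Function.comp_def]

/-- Numbers of moderate size are equal if their residues are. The difference of numbers of size at most
`47` has size at most `48`, the limit in `IsBounded.fst_eq_zero`. -/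
theorem eq {z z' : ℂ} {n n' s s' : ℕ} (h : Rep z n s) (h' : Rep z' n' s') (hn : eqN n n' = true)
    (hs : s ≤ 47 := by simp) (hs' : s' ≤ 47 := by simp) : z = z' := by
  obtain ⟨d, rfl, h1, h2⟩ := h
  obtain ⟨d', rfl, h1', h2'⟩ := h'
  have := IsBounded.fst_eq_zero pair_isGen pair_base
    ((h2.mono hs).add ((h2'.mono hs').neg pair_isGen)) (by simp [h1, h1', eqN_spec hn])
  exact sub_eq_zero.1 (by simpa [sub_eq_add_neg] using this)

end Rep

/-! ### Compatibility of the three evaluations -/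

/-- A relation between the elements of three domains that is respected by their operations. -/
structure OpsRel {A B C : Type} (O : Ops A) (O' : Ops B) (O'' : Ops C) (r : A → B → C → Prop) :
    Prop where
  add : ∀ {a b c a' b' c'}, r a b c → r a' b' c' → r (O.add a a') (O'.add b b') (O''.add c c')
  mul : ∀ {a b c a' b' c'}, r a b c → r a' b' c' → r (O.mul a a') (O'.mul b b') (O''.mul c c')
  lit : ∀ {l : List ℤ}, (l.map Int.natAbs).sum ≤ 256 → r (O.lit l) (O'.lit l) (O''.lit l)
  root : ∀ {l : List ℕ}, l.length ≤ 16 → r (O.root l) (O'.root l) (O''.root l)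
  guard : ∀ {a b c} (p : Bool), r a b c → r (O.guard p a) (O'.guard p b) (O''.guard p c)

theorem triLit_le (a b c : Fin 6) : ((triLit a b c).map Int.natAbs).sum ≤ 256 := by
  revert a b c; decide +kernel

theorem wtLit_le (a b : Fin 6) : ((wtLit a b).map Int.natAbs).sum ≤ 256 := by
  revert a b; decide +kernel

theorem iwtLit_le (a b : Fin 6) : ((iwtLit a b).map Int.natAbs).sum ≤ 256 := by
  revert a b; decide +kernel

theorem redLitL_le (a b : Fin 6) : ((redLitL a b).map Int.natAbs).sum ≤ 256 := by
  revert a b; decide +kernel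

theorem redLitR_le (a b : Fin 6) : ((redLitR a b).map Int.natAbs).sum ≤ 256 := by
  revert a b; decide +kernel

theorem lamLit_le (a : Fin 6) : ((lamLit a).map Int.natAbs).sum ≤ 256 := by
  revert a; decide +kernel

theorem ilamLit_le (a : Fin 6) : ((ilamLit a).map Int.natAbs).sum ≤ 256 := by
  revert a; decide +kernel

theorem treeExp_le (i : Fin 6) (j : Fin 5) : (treeExp i j).length ≤ 16 := by
  revert i j; decide +kernel

theorem forestExp_le (i : Fin 6) (j : Fin 5) : (forestExp i j).length ≤ 16 := by
  revert i j; decide +kernel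

namespace OpsRel

variable {A B C : Type} {O : Ops A} {O' : Ops B} {O'' : Ops C} {r : A → B → C → Prop}

theorem sum6 (H : OpsRel O O' O'' r) {f : Fin 6 → Fin 6 → A} {g : Fin 6 → Fin 6 → B}
    {k : Fin 6 → Fin 6 → C}
    (h : ∀ a b, r (f a b) (g a b) (k a b)) : r (O.sum6 f) (O'.sum6 g) (O''.sum6 k) :=
  H.add (h _ _) (H.add (h _ _) (H.add (h _ _) (H.add (h _ _) (H.add (h _ _) (h _ _)))))

theorem sum5 (H : OpsRel O O' O'' r) {f : Fin 5 → A} {g : Fin 5 → B} {k : Fin 5 → C}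
    (h : ∀ a, r (f a) (g a) (k a)) :
    r (O.sum5 f) (O'.sum5 g) (O''.sum5 k) :=
  H.add (h _) (H.add (h _) (H.add (h _) (H.add (h _) (h _))))

theorem rot5 {f : Fin 6 → Fin 6 → Fin 6 → Fin 6 → Fin 6 → A}
    {g : Fin 6 → Fin 6 → Fin 6 → Fin 6 → Fin 6 → B}
    {k : Fin 6 → Fin 6 → Fin 6 → Fin 6 → Fin 6 → C}
    (h : ∀ a b c d e, r (f a b c d e) (g a b c d e) (k a b c d e)) (a b c d e : Fin 6) (j : Fin 5) :
    r (Ops.rot5 f a b c d e j) (Ops.rot5 g a b c d e j) (Ops.rot5 k a b c d e j) := by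
  fin_cases j <;> exact h _ _ _ _ _

variable (a a' b b' c c' d d' e e' : Fin 6)

theorem y (H : OpsRel O O' O'' r) :
    r (O.y a b c) (O'.y a b c) (O''.y a b c) :=
  H.lit (triLit_le ..)

theorem w (H : OpsRel O O' O'' r) :
    r (O.w a b) (O'.w a b) (O''.w a b) :=
  H.lit (wtLit_le ..)

theorem iw (H : OpsRel O O' O'' r) :
    r (O.iw a b) (O'.iw a b) (O''.iw a b) :=
  H.lit (iwtLit_le ..)

theorem lam (H : OpsRel O O' O'' r) :
    r (O.lam a) (O'.lam a) (O''.lam a) :=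
  H.lit (lamLit_le ..)

theorem ilam (H : OpsRel O O' O'' r) :
    r (O.ilam a) (O'.ilam a) (O''.ilam a) :=
  H.lit (ilamLit_le ..)

theorem rho (H : OpsRel O O' O'' r) :
    r (O.rho a b c) (O'.rho a b c) (O''.rho a b c) :=
  H.mul (H.lit (redLitL_le ..)) (H.lit (redLitR_le ..))

theorem tree4 (H : OpsRel O O' O'' r) :
    r (O.tree4 a b c d) (O'.tree4 a b c d) (O''.tree4 a b c d) :=
  H.mul (H.y ..) (H.mul (H.w ..) (H.y ..))

theorem tree5 (H : OpsRel O O' O'' r) :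
    r (O.tree5 a b c d e) (O'.tree5 a b c d e) (O''.tree5 a b c d e) :=
  H.mul (H.y ..) (H.mul (H.w ..) (H.mul (H.y ..) (H.mul (H.w ..) (H.y ..))))

theorem arcs (H : OpsRel O O' O'' r) :
    r (O.arcs a b c d) (O'.arcs a b c d) (O''.arcs a b c d) :=
  H.guard _ (H.mul (H.iw ..) (H.mul (H.iw ..) (H.ilam ..)))

theorem nest (H : OpsRel O O' O'' r) :
    r (O.nest a b c d) (O'.nest a b c d) (O''.nest a b c d) :=
  H.guard _ (H.mul (H.iw ..) (H.mul (H.iw ..) (H.ilam ..)))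

theorem forest5 (H : OpsRel O O' O'' r) :
    r (O.forest5 a b c d e) (O'.forest5 a b c d e) (O''.forest5 a b c d e) :=
  H.guard _ (H.mul (H.iw ..) (H.mul (H.y ..) (H.ilam ..)))

theorem ladder (H : OpsRel O O' O'' r) :
    r (O.ladder a b b' c d) (O'.ladder a b b' c d) (O''.ladder a b b' c d) :=
  H.guard _ (H.mul (H.rho ..) (H.mul (H.iw ..) (H.mul (H.iw ..) (H.ilam ..))))

theorem gon2 (H : OpsRel O O' O'' r) {f : Fin 6 → Fin 6 → A}
    {g : Fin 6 → Fin 6 → B} {k : Fin 6 → Fin 6 → C}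
    (h : ∀ a b, r (f a b) (g a b) (k a b)) :
    r (O.gon2 f a b) (O'.gon2 g a b) (O''.gon2 k a b) :=
  H.sum6 fun _ _ => H.mul (h _ _)
      (H.mul (H.lam ..) (H.mul (H.y ..) (H.mul (H.w ..) (H.mul (H.w ..) (H.w ..)))))

theorem gon3 (H : OpsRel O O' O'' r) {f : Fin 6 → Fin 6 → A}
    {g : Fin 6 → Fin 6 → B} {k : Fin 6 → Fin 6 → C}
    (h : ∀ a b, r (f a b) (g a b) (k a b)) :
    r (O.gon3 f a b c) (O'.gon3 g a b c) (O''.gon3 k a b c) :=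
  H.sum6 fun _ _ => H.mul (h _ _)
      (H.mul (H.y ..) (H.mul (H.y ..)
      (H.mul (H.lam ..) (H.mul (H.w ..) (H.mul (H.w ..) (H.w ..))))))

theorem gon4 (H : OpsRel O O' O'' r) {f : Fin 6 → Fin 6 → A}
    {g : Fin 6 → Fin 6 → B} {k : Fin 6 → Fin 6 → C}
    (h : ∀ a b, r (f a b) (g a b) (k a b)) :
    r (O.gon4 f a b c d) (O'.gon4 g a b c d) (O''.gon4 k a b c d) :=
  H.sum6 fun _ _ => H.mul (h _ _)
      (H.mul (H.y ..) (H.mul (H.y ..)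
      (H.mul (H.y ..) (H.mul (H.lam ..)
      (H.mul (H.w ..) (H.mul (H.w ..) (H.mul (H.w ..) (H.w ..))))))))

theorem gon5 (H : OpsRel O O' O'' r) {f : Fin 6 → Fin 6 → A}
    {g : Fin 6 → Fin 6 → B} {k : Fin 6 → Fin 6 → C}
    (h : ∀ a b, r (f a b) (g a b) (k a b)) :
    r (O.gon5 f a b c d e) (O'.gon5 g a b c d e) (O''.gon5 k a b c d e) :=
  H.sum6 fun _ _ => H.mul (h _ _)
      (H.mul (H.y ..) (H.mul (H.y ..)
      (H.mul (H.y ..) (H.mul (H.y ..)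
      (H.mul (H.lam ..) (H.mul (H.w ..)
      (H.mul (H.w ..) (H.mul (H.w ..) (H.mul (H.w ..) (H.w ..))))))))))

theorem dec1 (H : OpsRel O O' O'' r) :
    r (O.dec1 a b b' c) (O'.dec1 a b b' c) (O''.dec1 a b b' c) :=
  H.mul (H.rho ..) (H.y ..)

theorem dec2 (H : OpsRel O O' O'' r) :
    r (O.dec2 a b c c') (O'.dec2 a b c c') (O''.dec2 a b c c') :=
  H.mul (H.rho ..) (H.y ..)

theorem dec3 (H : OpsRel O O' O'' r) :
    r (O.dec3 a a' b c) (O'.dec3 a a' b c) (O''.dec3 a a' b c) :=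
  H.mul (H.rho ..) (H.y ..)

theorem tetR (H : OpsRel O O' O'' r) :
    r (O.tetR a b c d) (O'.tetR a b c d) (O''.tetR a b c d) :=
  H.add (H.mul (H.root (by decide)) (H.add (H.tree4 ..) (H.tree4 ..)))
      (H.mul (H.root (by decide)) (H.add (H.arcs ..) (H.nest ..)))

theorem pentR (H : OpsRel O O' O'' r) :
    r (O.pentR a b c d e) (O'.pentR a b c d e) (O''.pentR a b c d e) :=
  H.mul (H.root (by decide)) (H.add (H.sum5 fun _ => rot5 H.tree5 ..)
      (H.sum5 fun _ => rot5 H.forest5 ..))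

theorem decTriR (H : OpsRel O O' O'' r) {z : A} {n : B} {s : C} (h : r z n s) :
    r (O.decTriR z a b c) (O'.decTriR n a b c) (O''.decTriR s a b c) :=
  H.add (H.mul (H.root (by decide)) (H.y ..)) (H.mul (H.root (by decide)) h)

theorem decTetR (H : OpsRel O O' O'' r) :
    r (O.decTetR a a' b b' c c' d) (O'.decTetR a a' b b' c c' d) (O''.decTetR a a' b b' c c' d) :=
    H.add (H.mul (H.root (by decide)) (H.tree4 ..)) (H.add (H.mul (H.root (by decide)) (H.tree4 ..))
    (H.add (H.mul (H.root (by decide)) (H.arcs ..)) (H.add (H.mul (H.root (by decide)) (H.nest ..))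
    (H.add (H.mul (H.root (by decide)) (H.ladder ..))
        (H.add (H.mul (H.root (by decide)) (H.ladder ..))
    (H.add (H.mul (H.root (by decide)) (H.mul (H.rho ..) (H.tree4 ..))) (H.add (H.mul (H.root (by
    decide)) (H.mul (H.rho ..) (H.tree4 ..))) (H.mul (H.root (by decide)) (H.mul (H.rho ..) (H.tree4
    ..))))))))))

theorem pentRow (H : OpsRel O O' O'' r) (i : Fin 6) :
    r (O.pentRow i a b c d e) (O'.pentRow i a b c d e) (O''.pentRow i a b c d e) :=
  H.add (H.sum5 fun _ => H.mul (H.root (treeExp_le ..)) (rot5 H.tree5 ..))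
    (H.sum5 fun _ => H.mul (H.root (forestExp_le ..)) (rot5 H.forest5 ..))

theorem decPentR (H : OpsRel O O' O'' r) :
    r (O.decPentR a a' b b' c c' d d' e e') (O'.decPentR a a' b b' c c' d d' e e')
        (O''.decPentR a a' b b' c c' d d' e e') :=
    H.add (H.pentRow ..) (H.add (H.mul (H.rho ..) (H.pentRow ..)) (H.add (H.mul (H.rho ..)
    (H.pentRow ..)) (H.add (H.mul (H.rho ..) (H.pentRow ..)) (H.add (H.mul (H.rho ..) (H.pentRow
    ..)) (H.mul (H.rho ..) (H.pentRow ..))))))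

end OpsRel

namespace Size

@[simp] theorem add (m n : ℕ) : sizeOps.add m n = max m n + 1 := (rfl)

@[simp] theorem mul (m n : ℕ) : sizeOps.mul m n = m + n + 1 := (rfl)

@[simp] theorem root (l : List ℕ) : sizeOps.root l = 1 := (rfl)

variable (a a' b b' c c' d d' e e' : Fin 6)

@[simp] theorem y : sizeOps.y a b c = 2 := (rfl)

@[simp] theorem w : sizeOps.w a b = 2 := (rfl)

@[simp] theorem lam : sizeOps.lam a = 2 := (rfl)

@[simp] theorem rho : sizeOps.rho a b c = 5 := (rfl)

@[simp] theorem tree4 : sizeOps.tree4 a b c d = 8 := (rfl)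

@[simp] theorem tree5 : sizeOps.tree5 a b c d e = 14 := (rfl)

@[simp] theorem arcs : sizeOps.arcs a b c d = 8 := (rfl)

@[simp] theorem nest : sizeOps.nest a b c d = 8 := (rfl)

@[simp] theorem forest5 : sizeOps.forest5 a b c d e = 8 := (rfl)

@[simp] theorem ladder : sizeOps.ladder a b b' c d = 14 := (rfl)

@[simp] theorem dec1 : sizeOps.dec1 a b b' c = 8 := (rfl)

@[simp] theorem dec2 : sizeOps.dec2 a b = fun _ _ => 8 := (rfl)

@[simp] theorem dec3 : sizeOps.dec3 a a' b c = 8 := (rfl)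

@[simp] theorem sum6 (n : ℕ) : sizeOps.sum6 (fun _ _ => n) = n + 5 := by
  simp only [Ops.sum6, add]
  omega

@[simp] theorem sum5 (f : Fin 5 → ℕ) : sizeOps.sum5 f =
    max (f 0) (max (f 1) (max (f 2) (max (f 3) (f 4) + 1) + 1) + 1) + 1 := (rfl)

@[simp] theorem gon2 (n : ℕ) : sizeOps.gon2 (fun _ _ => n) a b = n + 20 := by simp [Ops.gon2]

@[simp] theorem gon3 (n : ℕ) : sizeOps.gon3 (fun _ _ => n) a b c = n + 23 := by simp [Ops.gon3]

@[simp] theorem gon4 (n : ℕ) : sizeOps.gon4 (fun _ _ => n) a b c d = n + 29 := by simp [Ops.gon4]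

@[simp] theorem gon5 (n : ℕ) : sizeOps.gon5 (fun _ _ => n) a b c d e = n + 35 := by
  simp [Ops.gon5]

@[simp] theorem tetR : sizeOps.tetR a b c d = 12 := by simp [Ops.tetR]

@[simp] theorem pentR : sizeOps.pentR a b c d e = 21 := by simp [Ops.pentR, Ops.rot5]

@[simp] theorem decTriR (n : ℕ) : sizeOps.decTriR n a b c = max 4 (n + 2) + 1 := by
  simp only [Ops.decTriR, add, mul, root, y]
  omega

@[simp] theorem decTetR : sizeOps.decTetR a a' b b' c c' d = 24 := by simp [Ops.decTetR]

@[simp] theorem pentRow (i : Fin 6) : sizeOps.pentRow i a b c d e = 21 := by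
  simp [Ops.pentRow, Ops.rot5]

@[simp] theorem decPentR : sizeOps.decPentR a a' b b' c c' d d' e e' = 32 := by
  simp [Ops.decPentR]

end Size

theorem Rep.opsRel : OpsRel cOps natOps sizeOps Rep :=
  ⟨Rep.add, Rep.mul, Rep.lit, Rep.root, Rep.guard⟩

/-! ### The identities between the coordinates -/

set_option maxRecDepth 100000 in
theorem bigon_check : (all6 fun a _ => allAdj a fun b _ =>
    eqN (natOps.gon2 (fun x _ => natOps.y b a x) a b)
      (natOps.root [3, 2, 1, 23, 22, 21])) = true := by
  decide +kernel

/-- The relation (Bigon). -/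
theorem bigon_eq {a b : Fin 6}
    (hab : adj4 a b = true) :
    cOps.gon2 (fun x _ => cOps.y b a x) a b =
      cOps.root [3, 2, 1, 23, 22, 21] := by
  have h := allAdj_spec (all6_spec bigon_check a) hab
  refine Rep.eq (Rep.opsRel.gon2 _ _ (fun _ _ => Rep.opsRel.y ..))
      (Rep.opsRel.root (l := [3, 2, 1, 23, 22, 21]) (by decide)) ?_
  exact h

set_option maxRecDepth 100000 in
theorem decBigon1_check : (all6 fun a a' => allAdj a fun b _ =>
    eqN (natOps.gon2 (fun x _ => natOps.dec1 b a a' x) a b)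
      (natOps.root [1, 0, 23])) = true := by
  decide +kernel

/-- The relation (decBigon), with the red strand in the first region. -/
theorem decBigon1_eq {a b : Fin 6}
    (hab : adj4 a b = true) :
    cOps.gon2 (fun x _ => cOps.dec1 b a (invol a) x) a b =
      cOps.root [1, 0, 23] := by
  have h := allAdj_spec (all6_spec decBigon1_check a) hab
  refine Rep.eq (Rep.opsRel.gon2 _ _ (fun _ _ => Rep.opsRel.dec1 ..))
      (Rep.opsRel.root (l := [1, 0, 23]) (by decide)) ?_
  exact h

set_option maxRecDepth 100000 in
theorem decBigon2_check : (all6 fun a _ => allAdj a fun b _ =>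
    eqN (natOps.gon2 (natOps.dec2 b a) a b)
      (natOps.root [1, 0, 23])) = true := by
  decide +kernel

/-- The relation (decBigon), with the red strand in the second region. -/
theorem decBigon2_eq {a b : Fin 6}
    (hab : adj4 a b = true) :
    cOps.gon2 (cOps.dec2 b a) a b =
      cOps.root [1, 0, 23] := by
  have h := allAdj_spec (all6_spec decBigon2_check a) hab
  refine Rep.eq (Rep.opsRel.gon2 _ _ (fun _ _ => Rep.opsRel.dec2 ..))
      (Rep.opsRel.root (l := [1, 0, 23]) (by decide)) ?_
  exact h

set_option maxRecDepth 100000 in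
theorem decBigon3_check : (all6 fun a _ => allAdj a fun b b' =>
    eqN (natOps.gon2 (fun x _ => natOps.dec3 b b' a x) a b)
      (natOps.root [1, 0, 23])) = true := by
  decide +kernel

/-- The relation (decBigon), with the red strand in the third region. -/
theorem decBigon3_eq {a b : Fin 6}
    (hab : adj4 a b = true) :
    cOps.gon2 (fun x _ => cOps.dec3 b (invol b) a x) a b =
      cOps.root [1, 0, 23] := by
  have h := allAdj_spec (all6_spec decBigon3_check a) hab
  refine Rep.eq (Rep.opsRel.gon2 _ _ (fun _ _ => Rep.opsRel.dec3 ..))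
      (Rep.opsRel.root (l := [1, 0, 23]) (by decide)) ?_
  exact h

set_option maxRecDepth 100000 in
theorem trigon_check : (all6 fun a _ => allAdj a fun b _ =>
    allAdj b fun c _ =>
    cond (adj4 c a) (eqN (natOps.gon3 (fun x _ => natOps.y x a b) a b c)
      (natOps.mul (natOps.root [14, 12, 10]) (natOps.y a b c))) true) = true := by
  decide +kernel

/-- The relation (Trigon). -/
theorem trigon_eq {a b c : Fin 6}
    (hab : adj4 a b = true) (hbc : adj4 b c = true) (hca : adj4 c a = true) :
    cOps.gon3 (fun x _ => cOps.y x a b) a b c =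
      cOps.mul (cOps.root [14, 12, 10]) (cOps.y a b c) := by
  have h := cond_spec hca (allAdj_spec (allAdj_spec (all6_spec trigon_check a) hab) hbc)
  refine Rep.eq (Rep.opsRel.gon3 _ _ _ (fun _ _ => Rep.opsRel.y ..))
      (Rep.opsRel.mul (Rep.opsRel.root (l := [14, 12, 10]) (by decide)) (Rep.opsRel.y ..)) ?_
  exact h

set_option maxRecDepth 100000 in
theorem decTrigon_check : (all6 fun a _ => allAdj a fun b b' =>
    allAdj b fun c _ =>
    cond (adj4 c a) (eqN (natOps.gon3 (fun x _ => natOps.dec2 x a b b') a b c)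
      (natOps.decTriR (natOps.dec1 a b b' c) a b c)) true) = true := by
  decide +kernel

/-- The relation (decTrigon), with the red strand after leg `1`. -/
theorem decTrigon_eq {a b c : Fin 6}
    (hab : adj4 a b = true) (hbc : adj4 b c = true) (hca : adj4 c a = true) :
    cOps.gon3 (fun x _ => cOps.dec2 x a b (invol b)) a b c =
      cOps.decTriR (cOps.dec1 a b (invol b) c) a b c := by
  have h := cond_spec hca (allAdj_spec (allAdj_spec (all6_spec decTrigon_check a) hab) hbc)
  refine Rep.eq (Rep.opsRel.gon3 _ _ _ (fun _ _ => Rep.opsRel.dec2 ..))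
      (Rep.opsRel.decTriR _ _ _ (Rep.opsRel.dec1 ..)) ?_
  exact h

set_option maxRecDepth 100000 in
theorem decTrigon'_check : (all6 fun a a' => allAdj a fun b _ =>
    allAdj b fun c _ =>
    cond (adj4 c a) (eqN (natOps.gon3 (fun x _ => natOps.dec1 x a a' b) a b c)
      (natOps.decTriR (natOps.dec3 a a' b c) a b c)) true) = true := by
  decide +kernel

/-- The relation (decTrigon), with the red strand before leg `1`. -/
theorem decTrigon'_eq {a b c : Fin 6}
    (hab : adj4 a b = true) (hbc : adj4 b c = true) (hca : adj4 c a = true) :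
    cOps.gon3 (fun x _ => cOps.dec1 x a (invol a) b) a b c =
      cOps.decTriR (cOps.dec3 a (invol a) b c) a b c := by
  have h := cond_spec hca (allAdj_spec (allAdj_spec (all6_spec decTrigon'_check a) hab) hbc)
  refine Rep.eq (Rep.opsRel.gon3 _ _ _ (fun _ _ => Rep.opsRel.dec1 ..))
      (Rep.opsRel.decTriR _ _ _ (Rep.opsRel.dec3 ..)) ?_
  exact h

set_option maxRecDepth 100000 in
theorem decTrigonInner_check : (all6 fun a _ => allAdj a fun b _ =>
    allAdj b fun c c' =>
    cond (adj4 c a) (eqN (natOps.gon3 (fun x x' => natOps.dec3 x x' a b) a b c)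
      (natOps.decTriR (natOps.dec2 a b c c') a b c)) true) = true := by
  decide +kernel

/-- The relation (decTrigon), with the red strand inside the trigon. -/
theorem decTrigonInner_eq {a b c : Fin 6}
    (hab : adj4 a b = true) (hbc : adj4 b c = true) (hca : adj4 c a = true) :
    cOps.gon3 (fun x x' => cOps.dec3 x x' a b) a b c =
      cOps.decTriR (cOps.dec2 a b c (invol c)) a b c := by
  have h := cond_spec hca (allAdj_spec (allAdj_spec (all6_spec decTrigonInner_check a) hab) hbc)
  refine Rep.eq (Rep.opsRel.gon3 _ _ _ (fun _ _ => Rep.opsRel.dec3 ..))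
      (Rep.opsRel.decTriR _ _ _ (Rep.opsRel.dec2 ..)) ?_
  exact h

set_option maxRecDepth 100000 in
theorem changeOfBasis_check : (all6 fun a a' => allAdj a fun b b' =>
    allAdj b fun c _ =>
    cond (adj4 c a) (eqN (natOps.dec3 a a' b c)
      (natOps.add (natOps.mul (natOps.root [22]) (natOps.y a b c))
          (natOps.mul (natOps.root [8]) (natOps.dec1 a b b' c)))) true) = true := by
  decide +kernel

/-- The relation (Change of Basis). -/
theorem changeOfBasis_eq {a b c : Fin 6}
    (hab : adj4 a b = true) (hbc : adj4 b c = true) (hca : adj4 c a = true) :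
    cOps.dec3 a (invol a) b c =
      cOps.add (cOps.mul (cOps.root [22]) (cOps.y a b c))
          (cOps.mul (cOps.root [8]) (cOps.dec1 a b (invol b) c)) := by
  have h := cond_spec hca (allAdj_spec (allAdj_spec (all6_spec changeOfBasis_check a) hab) hbc)
  refine Rep.eq (Rep.opsRel.dec3 ..)
      (Rep.opsRel.add (Rep.opsRel.mul (Rep.opsRel.root (l := [22]) (by decide)) (Rep.opsRel.y ..))
    (Rep.opsRel.mul (Rep.opsRel.root (l := [8]) (by decide)) (Rep.opsRel.dec1 ..))) ?_
  exact h

set_option maxRecDepth 100000 in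
theorem tetragon_check : (all6 fun a _ => allAdj a fun b _ =>
    allAdj b fun c _ =>
    allAdj c fun d _ =>
    cond (adj4 d a) (eqN (natOps.gon4 (fun x _ => natOps.y x a b) a b c d)
      (natOps.tetR a b c d)) true) = true := by
  decide +kernel

/-- The relation (Tetragon). -/
theorem tetragon_eq {a b c d : Fin 6}
    (hab : adj4 a b = true) (hbc : adj4 b c = true) (hcd : adj4 c d = true) (hda : adj4 d a = true) :
    cOps.gon4 (fun x _ => cOps.y x a b) a b c d =
      cOps.tetR a b c d := by
  have h := cond_spec hda
    (allAdj_spec (allAdj_spec (allAdj_spec (all6_spec tetragon_check a) hab) hbc) hcd)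
  refine Rep.eq (Rep.opsRel.gon4 _ _ _ _ (fun _ _ => Rep.opsRel.y ..)) (Rep.opsRel.tetR ..) ?_
  exact h

set_option maxRecDepth 100000 in
theorem decTetragon_check : (all6 fun a a' => allAdj a fun b b' =>
    allAdj b fun c c' =>
    allAdj c fun d _ =>
    cond (adj4 d a) (eqN (natOps.gon4 (fun x _ => natOps.dec2 x b c c') b c d a)
      (natOps.decTetR a a' b b' c c' d)) true) = true := by
  decide +kernel

/-- The relation (decTetragon). -/
theorem decTetragon_eq {a b c d : Fin 6}
    (hab : adj4 a b = true) (hbc : adj4 b c = true) (hcd : adj4 c d = true) (hda : adj4 d a = true) :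
    cOps.gon4 (fun x _ => cOps.dec2 x b c (invol c)) b c d a =
      cOps.decTetR a (invol a) b (invol b) c (invol c) d := by
  have h := cond_spec hda
    (allAdj_spec (allAdj_spec (allAdj_spec (all6_spec decTetragon_check a) hab) hbc) hcd)
  refine Rep.eq (Rep.opsRel.gon4 _ _ _ _ (fun _ _ => Rep.opsRel.dec2 ..)) (Rep.opsRel.decTetR ..) ?_
  exact h

set_option maxRecDepth 100000 in
theorem pentagon_check : (all6 fun a _ => allAdj a fun b _ =>
    allAdj b fun c _ =>
    allAdj c fun d _ =>
    allAdj d fun e _ =>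
    cond (adj4 e a) (eqN (natOps.gon5 (fun x _ => natOps.y x a b) a b c d e)
      (natOps.pentR a b c d e)) true) = true := by
  decide +kernel

/-- The relation (Pentagon). -/
theorem pentagon_eq {a b c d e : Fin 6}
    (hab : adj4 a b = true) (hbc : adj4 b c = true) (hcd : adj4 c d = true) (hde : adj4 d e = true)
    (hea : adj4 e a = true) :
    cOps.gon5 (fun x _ => cOps.y x a b) a b c d e =
      cOps.pentR a b c d e := by
  have h := cond_spec hea
    (allAdj_spec (allAdj_spec (allAdj_spec (allAdj_spec (all6_spec pentagon_check a) hab) hbc) hcd) hde)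
  refine Rep.eq (Rep.opsRel.gon5 _ _ _ _ _ (fun _ _ => Rep.opsRel.y ..)) (Rep.opsRel.pentR ..) ?_
  exact h

set_option maxRecDepth 100000 in
theorem decPentagon_check : (all6 fun a a' => allAdj a fun b b' =>
    allAdj b fun c c' =>
    allAdj c fun d d' =>
    allAdj d fun e e' =>
    cond (adj4 e a) (eqN (natOps.gon5 (fun x _ => natOps.dec2 x a b b') a b c d e)
      (natOps.decPentR a a' b b' c c' d d' e e')) true) = true := by
  decide +kernel

/-- The relation (decPentagon). -/
theorem decPentagon_eq {a b c d e : Fin 6}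
    (hab : adj4 a b = true) (hbc : adj4 b c = true) (hcd : adj4 c d = true) (hde : adj4 d e = true)
    (hea : adj4 e a = true) :
    cOps.gon5 (fun x _ => cOps.dec2 x a b (invol b)) a b c d e =
      cOps.decPentR a (invol a) b (invol b) c (invol c) d (invol d) e (invol e) := by
  have h := cond_spec hea
    (allAdj_spec (allAdj_spec (allAdj_spec (allAdj_spec (all6_spec decPentagon_check a) hab) hbc) hcd) hde)
  refine Rep.eq (Rep.opsRel.gon5 _ _ _ _ _ (fun _ _ => Rep.opsRel.dec2 ..))
      (Rep.opsRel.decPentR ..) ?_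
  exact h

set_option maxRecDepth 100000 in
theorem swap_check : (all6 fun x _ => all6 fun a a' => all6 fun b b' => all6 fun z _ =>
    eqN (natOps.mul (natOps.rho x a b') (natOps.rho a b z))
      (natOps.mul (natOps.root [12]) (natOps.mul (natOps.rho a' b z) (natOps.rho x a b)))) = true := by
  decide +kernel

/-- The relation (Swap). -/
theorem swap_eq (x a b z : Fin 6) : cOps.mul (cOps.rho x a (invol b)) (cOps.rho a b z) =
    cOps.mul (cOps.root [12]) (cOps.mul (cOps.rho (invol a) b z) (cOps.rho x a b)) :=
  Rep.eq (Rep.opsRel.mul (Rep.opsRel.rho ..) (Rep.opsRel.rho ..))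
    (Rep.opsRel.mul (Rep.opsRel.root (by decide))
      (Rep.opsRel.mul (Rep.opsRel.rho ..) (Rep.opsRel.rho ..)))
    (all6_spec (all6_spec (all6_spec (all6_spec swap_check x) a) b) z)

/-! ### The numbers in the definitions of the two morphisms -/

theorem sqrt_six : √6 = √2 * √3 := by
  rw [← Real.sqrt_mul (by norm_num)]; norm_num

theorem sqrt_eq_of_sq {x y : ℝ} (hy : 0 ≤ y) (h : y ^ 2 = x) : √x = y := by
  rw [← h, Real.sqrt_sq hy]

theorem sqrt_two_gt : 1.41 < √2 := by rw [Real.lt_sqrt] <;> norm_num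
theorem sqrt_two_lt : √2 < 1.42 := by rw [Real.sqrt_lt'] <;> norm_num
theorem sqrt_three_gt : 1.73 < √3 := by rw [Real.lt_sqrt] <;> norm_num
theorem sqrt_three_lt : √3 < 1.74 := by rw [Real.sqrt_lt'] <;> norm_num
theorem sqrt_two_sq' : √2 ^ 2 = 2 := Real.sq_sqrt (by norm_num)
theorem sqrt_three_sq' : √3 ^ 2 = 3 := Real.sq_sqrt (by norm_num)

/-- `√(√6 - 2)`, as a real number. -/
def sR : ℝ := √(√6 - 2)

/-- `√((√2 - 1) (√3 - √2))`, as a real number. -/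
def thetaR : ℝ := √((√2 - 1) * (√3 - √2))

theorem sR_sq : sR ^ 2 = √2 * √3 - 2 := by
  rw [sR, sqrt_six, Real.sq_sqrt]
  nlinarith [sqrt_two_gt, sqrt_three_gt]

theorem thetaR_sq : thetaR ^ 2 = (√2 - 1) * (√3 - √2) := by
  rw [thetaR, Real.sq_sqrt]
  nlinarith [sqrt_two_gt, sqrt_three_gt, sqrt_two_lt]

theorem a2_sq : a2 ^ 2 = (-1 + √2 + √3) / 2 := by
  rw [a2, Real.sq_sqrt]
  nlinarith [sqrt_two_gt, sqrt_three_gt]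

theorem sR_pos : 0 < sR := by
  rw [sR, Real.sqrt_pos, sqrt_six]
  nlinarith [sqrt_two_gt, sqrt_three_gt]

theorem thetaR_pos : 0 < thetaR := by
  rw [thetaR, Real.sqrt_pos]
  nlinarith [sqrt_two_gt, sqrt_three_gt, sqrt_two_lt]

theorem a2_pos : 0 < a2 := by
  rw [a2, Real.sqrt_pos]
  nlinarith [sqrt_two_gt, sqrt_three_gt]

theorem sqrt_two_add_sqrt_three : √(2 + √3) = √2 * (1 + √3) / 2 :=
  sqrt_eq_of_sq (by positivity) (by grind [sqrt_two_sq', sqrt_three_sq'])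

theorem a1_eq : a1 = √2 * (1 + √3) / 2 * a2 :=
  sqrt_eq_of_sq (by have := a2_pos; positivity)
    (by rw [sqrt_six]; grind [sqrt_two_sq', sqrt_three_sq', a2_sq])

theorem bR_pos : 0 < √2 * (1 + √3) / 2 - 1 := by nlinarith [sqrt_two_gt, sqrt_three_gt]

theorem a3_eq : a3 = √2 * √3 / 2 * (√2 * (1 + √3) / 2 - 1) * a2 :=
  sqrt_eq_of_sq (by have := a2_pos; have := bR_pos; positivity)
    (by rw [sqrt_two_add_sqrt_three]; grind [sqrt_two_sq', sqrt_three_sq', a2_sq])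

theorem a5_eq : a5 = √2 / 2 * (√2 * (1 + √3) / 2 - 1) * a2 :=
  sqrt_eq_of_sq (by have := a2_pos; have := bR_pos; positivity)
    (by rw [sqrt_two_add_sqrt_three]; grind [sqrt_two_sq', sqrt_three_sq', a2_sq])

theorem a7_eq : a7 = sR * a2 := by
  refine sqrt_eq_of_sq (by have := a2_pos; have := sR_pos; positivity) ?_
  have h1 : √(3 / 2) = √2 * √3 / 2 := 
    sqrt_eq_of_sq (by positivity) (by grind [sqrt_two_sq', sqrt_three_sq'])
  have h2 : 1 / √2 = √2 / 2 := by
    rw [div_eq_div_iff (by positivity) (by norm_num)]; grind [sqrt_two_sq']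
  rw [h1, h2]
  grind [sqrt_two_sq', sqrt_three_sq', a2_sq, sR_sq]

theorem a4_eq : a4 = (3 - √2 + √3 - √2 * √3) * (1 + √2 * √3 / 2) * sR * a2 := by
  refine sqrt_eq_of_sq ?_ ?_
  · have := a2_pos
    have := sR_pos
    have : 0 < 3 - √2 + √3 - √2 * √3 := by
      nlinarith [sqrt_two_gt, sqrt_three_gt, sqrt_two_lt, sqrt_three_lt]
    positivity
  · rw [sqrt_two_add_sqrt_three]
    grind [sqrt_two_sq', sqrt_three_sq', a2_sq, sR_sq]

theorem a6_eq : a6 = (1 + √3 + √2 * √3) / 2 * (√2 * (1 + √3) / 2 - 1) * (1 + √2 * √3 / 2) *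
    thetaR * sR * a2 := by
  refine sqrt_eq_of_sq ?_ ?_
  · have := a2_pos
    have := sR_pos
    have := thetaR_pos
    have := bR_pos
    positivity
  · rw [sqrt_two_add_sqrt_three]
    grind [sqrt_two_sq', sqrt_three_sq', a2_sq, sR_sq, thetaR_sq]

theorem a89_aux : √(1 + √(6 - 3 * √3)) = thetaR * (√2 / 2 + √3 + √2 * √3 / 2) * a2 ∧
    √(√(2 + √3) - 1) = (√2 * (1 + √3) / 2 - 1) * a2 := by
  have h : √(6 - 3 * √3) = (3 * √2 - √2 * √3) / 2 := by
    refine sqrt_eq_of_sq ?_ (by grind [sqrt_two_sq', sqrt_three_sq'])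
    nlinarith [sqrt_two_gt, sqrt_three_lt]
  constructor
  · rw [h]
    refine sqrt_eq_of_sq (by have := a2_pos; have := thetaR_pos; positivity) ?_
    grind [sqrt_two_sq', sqrt_three_sq', a2_sq, thetaR_sq]
  · rw [sqrt_two_add_sqrt_three]
    refine sqrt_eq_of_sq (by have := a2_pos; have := bR_pos; positivity) ?_
    grind [sqrt_two_sq', sqrt_three_sq', a2_sq]

theorem a8_eq : a8 =
    (thetaR * (√2 / 2 + √3 + √2 * √3 / 2) - (√2 * (1 + √3) / 2 - 1)) / 2 * a2 := by
  rw [a8, a89_aux.1, a89_aux.2]; ring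

theorem a9_eq : a9 =
    (thetaR * (√2 / 2 + √3 + √2 * √3 / 2) + (√2 * (1 + √3) / 2 - 1)) / 2 * a2 := by
  rw [a9, a89_aux.1, a89_aux.2]; ring

/-! ### The two morphisms in the chosen gauge -/

theorem trivCoeff_eq_zero (a b c : Fin 6) (h : ¬ IsPair Γ₄ 2 1 [a, b, c] [a, c]) :
    trivCoeff a b c = 0 := by
  have h' : ¬ (adj4 a b = true ∧ adj4 b c = true ∧ adj4 a c = true) := fun h' =>
    h ⟨by simpa [IsPathList, Γ₄] using ⟨h'.1, h'.2.1⟩, by simpa [IsPathList, Γ₄] using h'.2.2,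
      rfl, rfl⟩
  revert h'
  clear h
  fin_cases a <;> fin_cases b <;> fin_cases c <;>
    first | exact fun h => absurd ⟨rfl, rfl, rfl⟩ h | exact fun _ => rfl

theorem lval_triv4 (a b c : Fin 6) : lval triv4 [a, b, c] [a, c] = (trivCoeff a b c : ℝ) := by
  by_cases h : IsPair Γ₄ 2 1 [a, b, c] [a, c]
  · obtain ⟨x, h1, h2⟩ := isPair_iff.1 h
    have e : ∀ i : Fin 3, some (x.1.1.1 i) = [a, b, c][(i : ℕ)]? := fun i => by
      rw [← h1]; fin_cases i <;> simp [verts]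
    rw [← h1, ← h2, lval_verts, triv4, Option.some_inj.1 (e 0), Option.some_inj.1 (e 1),
      Option.some_inj.1 (e 2)]
  · rw [lval_of_not_isPair _ h, trivCoeff_eq_zero a b c h, Complex.ofReal_zero]

theorem projVec_eq_zero (a x b : Fin 6) (h : ¬ (adj4 a x = true ∧ adj4 x b = true)) :
    projVec a b x = 0 := by
  revert h
  fin_cases a <;> fin_cases x <;> fin_cases b <;>
    first | exact fun h => absurd ⟨rfl, rfl⟩ h | exact fun _ => rfl

theorem lval_proj4 (a x b y : Fin 6) : lval proj4 [a, x, b] [a, y, b] =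
    projVec a b x * star (projVec a b y) := by
  by_cases h : IsPair Γ₄ 2 2 [a, x, b] [a, y, b]
  · obtain ⟨z, h1, h2⟩ := isPair_iff.1 h
    have e : ∀ i : Fin 3, some (z.1.1.1 i) = [a, x, b][(i : ℕ)]? := fun i => by
      rw [← h1]; fin_cases i <;> simp [verts]
    have e' : ∀ i : Fin 3, some (z.1.2.1 i) = [a, y, b][(i : ℕ)]? := fun i => by
      rw [← h2]; fin_cases i <;> simp [verts]
    rw [← h1, ← h2, lval_verts, proj4, Option.some_inj.1 (e 0), Option.some_inj.1 (e 1),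
      Option.some_inj.1 (e 2), Option.some_inj.1 (e' 1)]
  · rw [lval_of_not_isPair _ h]
    by_cases hx : adj4 a x = true ∧ adj4 x b = true
    · rw [projVec_eq_zero a y b, star_zero, mul_zero]
      intro hy
      exact h ⟨by simpa [IsPathList, Γ₄] using hx, by simpa [IsPathList, Γ₄] using hy, rfl, rfl⟩
    · rw [projVec_eq_zero a x b hx, zero_mul]

/-- Square roots of the Frobenius–Perron weights `2` and `δ`, divided by `√δ`. -/
def rt4 : Fin 6 → ℂ := ![s4, 1, 1, s4, 1, 1]

/-- The rescaling of the edges. The entries at pairs of vertices that are not adjacent do not matter. -/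
def k4 : Matrix (Fin 6) (Fin 6) ℂ :=
  !![1, s4⁻¹, 1, 1, 1, s4⁻¹;
     1, a2, 1, 1, s4, a2;
     1, 1, a2, 1, a2, s4;
     1, 1, s4⁻¹, 1, s4⁻¹, 1;
     1, s4, a2, 1, a2, 1;
     1, a2, s4, 1, 1, a2]

theorem s4_eq : s4 = (sR : ℝ) := rfl

theorem theta_eq : theta = (thetaR : ℝ) := rfl

theorem s4_ne : s4 ≠ 0 := by
  rw [s4_eq, Complex.ofReal_ne_zero]; exact sR_pos.ne'

theorem a2_ne : (a2 : ℂ) ≠ 0 := by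
  rw [Complex.ofReal_ne_zero]; exact a2_pos.ne'

theorem s4_sq : s4 ^ 2 = (√2 : ℝ) * (√3 : ℝ) - 2 := by
  rw [s4_eq]; exact_mod_cast congrArg (fun x : ℝ => (x : ℂ)) sR_sq

theorem a2_sq' : (a2 : ℂ) ^ 2 = (-1 + (√2 : ℝ) + (√3 : ℝ)) / 2 := by
  have := congrArg (fun x : ℝ => (x : ℂ)) a2_sq
  push_cast at this
  exact this

theorem s4_inv : s4⁻¹ = s4 * (1 + (√2 : ℝ) * (√3 : ℝ) / 2) := by
  apply inv_eq_of_mul_eq_one_right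
  linear_combination (1 + (√2 : ℝ) * (√3 : ℝ) / 2 : ℂ) * s4_sq + (√3 : ℝ) ^ 2 / 2 * sqrt_two_sq +
      sqrt_three_sq

/-- The gauge in which the coordinates of the trivalent vertex are cyclic and lie in the number
field. -/
def gauge4 : Gauge Γ₄ where
  rt := rt4
  k := k4
  rt_ne a := by fin_cases a <;> simp [rt4, s4_ne]
  k_ne a b := by fin_cases a <;> fin_cases b <;> simp [k4, s4_ne, a2_pos.ne']
  edge a b hab := by
    have h1 : √(delta4 / 2) = sR⁻¹ := by
      refine sqrt_eq_of_sq (inv_nonneg.2 sR_pos.le) ?_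
      rw [inv_pow, sR_sq, delta4, sqrt_six, inv_eq_iff_eq_inv, eq_comm, inv_eq_iff_eq_inv,
          inv_eq_of_mul_eq_one_right]
      grind [sqrt_two_sq', sqrt_three_sq']
    have h2 : √(2 / delta4) = sR := by
      rw [← inv_div, Real.sqrt_inv, h1, inv_inv]
    have hd : delta4 / delta4 = 1 := div_self (by unfold delta4; positivity)
    have key : ((√(lam4 b / lam4 a) : ℝ) : ℂ) = rt4 b / rt4 a := by
      revert hab
      fin_cases a <;> fin_cases b <;>
        simp [lam4, rt4, h1, h2, hd, adj4, Γ₄, s4_eq]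
    rw [edgeWeight, if_pos hab]
    exact key

/-! ### The tables of structure constants -/

theorem cOps_lit (l : List ℤ) : cOps.lit l = (List.zipWith (fun (z : ℤ) b => (z : ℂ) * b) l
    [1, ((√2 : ℝ) : ℂ), ((√3 : ℝ) : ℂ), ((√2 : ℝ) : ℂ) * ((√3 : ℝ) : ℂ),
     Complex.I, ((√2 : ℝ) : ℂ) * Complex.I, ((√3 : ℝ) : ℂ) * Complex.I,
     ((√2 : ℝ) : ℂ) * ((√3 : ℝ) : ℂ) * Complex.I,
     theta, ((√2 : ℝ) : ℂ) * theta, ((√3 : ℝ) : ℂ) * theta,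
     ((√2 : ℝ) : ℂ) * ((√3 : ℝ) : ℂ) * theta,
     Complex.I * theta, ((√2 : ℝ) : ℂ) * Complex.I * theta, ((√3 : ℝ) : ℂ) * Complex.I * theta,
     ((√2 : ℝ) : ℂ) * ((√3 : ℝ) : ℂ) * Complex.I * theta]).sum / 4 := by
  have h : cOps.lit l = ringLit (q4 ^ 2) theta (1 / 2) l := rfl
  rw [h, ringLit_eq, root_add_two, root_add_three, root_six]
  simp only [one_mul]
  ring

theorem ofReal_a1 : (a1 : ℂ) =
    (√2 : ℝ) * (1 + (√3 : ℝ)) / 2 * a2 := by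
  rw [a1_eq]; push_cast; ring

theorem ofReal_a3 : (a3 : ℂ) =
    (√2 : ℝ) * (√3 : ℝ) / 2 * ((√2 : ℝ) * (1 + (√3 : ℝ)) / 2 - 1) * a2 := by
  rw [a3_eq]; push_cast; ring

theorem ofReal_a4 : (a4 : ℂ) =
    (3 - (√2 : ℝ) + (√3 : ℝ) - (√2 : ℝ) * (√3 : ℝ)) * (1 + (√2 : ℝ) * (√3 : ℝ) / 2) * s4 * a2 := by
  rw [a4_eq, s4_eq]; push_cast; ring

theorem ofReal_a5 : (a5 : ℂ) =
    (√2 : ℝ) / 2 * ((√2 : ℝ) * (1 + (√3 : ℝ)) / 2 - 1) * a2 := by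
  rw [a5_eq]; push_cast; ring

theorem ofReal_a6 : (a6 : ℂ) =
    (1 + (√3 : ℝ) + (√2 : ℝ) * (√3 : ℝ)) / 2 * ((√2 : ℝ) * (1 + (√3 : ℝ)) / 2 - 1) * (1 +
        (√2 : ℝ) * (√3 : ℝ) / 2) * theta * s4 * a2 := by
  rw [a6_eq, s4_eq, theta_eq]; push_cast; ring

theorem ofReal_a7 : (a7 : ℂ) =
    s4 * a2 := by
  rw [a7_eq, s4_eq]; push_cast; ring

theorem ofReal_a8 : (a8 : ℂ) =
    (theta * ((√2 : ℝ) / 2 + (√3 : ℝ) + (√2 : ℝ) * (√3 : ℝ) / 2) - ((√2 : ℝ) * (1 + (√3 : ℝ)) / 2 -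
        1)) / 2 * a2 := by
  rw [a8_eq, theta_eq]; push_cast; ring

theorem ofReal_a9 : (a9 : ℂ) =
    (theta * ((√2 : ℝ) / 2 + (√3 : ℝ) + (√2 : ℝ) * (√3 : ℝ) / 2) + ((√2 : ℝ) * (1 + (√3 : ℝ)) / 2 -
        1)) / 2 * a2 := by
  rw [a9_eq, theta_eq]; push_cast; ring

theorem lit_nil : cOps.lit [] = 0 := by rw [cOps_lit]; simp

theorem lit_v1 : cOps.lit v1 =
    ((-4) + 2 * (√2 : ℝ) * (√3 : ℝ) + (-2) * theta + (-2) * (√2 : ℝ) * theta +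
        2 * (√3 : ℝ) * theta + 2 * (√2 : ℝ) * (√3 : ℝ) * theta) / 4 := by
  rw [cOps_lit, v1]; simp; ring

theorem lit_v2 : cOps.lit v2 =
    ((-4) + 2 * (√2 : ℝ) * (√3 : ℝ) + 2 * theta + 2 * (√2 : ℝ) * theta + (-2) * (√3 : ℝ) * theta +
        (-2) * (√2 : ℝ) * (√3 : ℝ) * theta) / 4 := by
  rw [cOps_lit, v2]; simp; ring

theorem lit_v3 : cOps.lit v3 =
    ((-2) + 1 * (√2 : ℝ) + (-1) * (√2 : ℝ) * (√3 : ℝ)) / 4 := by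
  rw [cOps_lit, v3]; simp; ring

theorem lit_v4 : cOps.lit v4 =
    ((-2) + 2 * (√2 : ℝ) + 2 * (√3 : ℝ)) / 4 := by
  rw [cOps_lit, v4]; simp; ring

theorem lit_v5 : cOps.lit v5 =
    ((-3) * (√2 : ℝ) + (-2) * (√3 : ℝ) + 1 * (√2 : ℝ) * (√3 : ℝ)) / 4 := by
  rw [cOps_lit, v5]; simp; ring

theorem lit_v6 : cOps.lit v6 =
    ((-2) * theta + (-2) * (√3 : ℝ) * theta + (-2) * (√2 : ℝ) * (√3 : ℝ) * theta) / 4 := by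
  rw [cOps_lit, v6]; simp; ring

theorem lit_v7 : cOps.lit v7 =
    (2 * theta + 2 * (√3 : ℝ) * theta + 2 * (√2 : ℝ) * (√3 : ℝ) * theta) / 4 := by
  rw [cOps_lit, v7]; simp; ring

theorem lit_v8 : cOps.lit v8 =
    (2 + (-4) * theta + (-1) * (√2 : ℝ) * theta + (-1) * (√2 : ℝ) * (√3 : ℝ) * theta) / 4 := by
  rw [cOps_lit, v8]; simp; ring

theorem lit_v9 : cOps.lit v9 =
    (2 + 4 * theta + 1 * (√2 : ℝ) * theta + 1 * (√2 : ℝ) * (√3 : ℝ) * theta) / 4 := by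
  rw [cOps_lit, v9]; simp; ring

theorem lit_v10 : cOps.lit v10 =
    (2 + 2 * (√2 : ℝ) + 2 * (√3 : ℝ)) / 4 := by
  rw [cOps_lit, v10]; simp; ring

/-- The coordinates of the trivalent vertex in the chosen gauge are the numbers of the table
`triLit`. -/
theorem tri4 (a b c : Fin 6) : gauge4.tri triv4 a b c = cOps.y a b c := by
  have ht : gauge4.tri triv4 a b c = rt4 a * rt4 b * (trivCoeff a c b : ℝ) *
    (k4 a b * k4 b c * k4 c a) := by rw [Gauge.tri, lval_triv4]; rfl
  have hy : cOps.y a b c = cOps.lit (triLit a b c) := rfl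
  rw [ht, hy]
  clear ht hy
  fin_cases a <;> fin_cases b <;> fin_cases c <;>
    simp only [trivCoeff, triLit, rt4, k4, Fin.zero_eta, Fin.mk_one, Fin.reduceFinMk, Fin.isValue,
      Matrix.of_apply, Matrix.cons_val, lit_nil, Complex.ofReal_zero, mul_zero, zero_mul]
  all_goals
    simp only [Complex.ofReal_neg, ofReal_a1, ofReal_a3, ofReal_a4, ofReal_a5, ofReal_a6, ofReal_a7,
      ofReal_a8, ofReal_a9, lit_v1, lit_v2, lit_v3, lit_v4, lit_v5, lit_v6, lit_v7, lit_v8, lit_v9,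
      lit_v10, s4_inv]
  all_goals grind [sqrt_two_sq, sqrt_three_sq, a2_sq', s4_sq, theta_sq]

theorem a2_inv : (a2 : ℂ)⁻¹ = a2 * (-1 + (√2 : ℝ) / 2 + (√2 : ℝ) * (√3 : ℝ) / 2) := by
  apply inv_eq_of_mul_eq_one_right
  grind [sqrt_two_sq, sqrt_three_sq, a2_sq']

theorem wt4 (a b : Fin 6) : gauge4.wt a b = cOps.w a b := by
  have h : gauge4.wt a b =
    if adj4 a b = true then 1 / (rt4 a * rt4 b * (k4 a b * k4 b a)) else 0 := rfl
  have hy : cOps.w a b = cOps.lit (wtLit a b) := rfl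
  rw [h, hy, cOps_lit]
  clear h hy
  fin_cases a <;> fin_cases b <;> simp [adj4, wtLit, rt4, k4, s4_ne]
  all_goals simp only [s4_inv, a2_inv]
  all_goals grind [sqrt_two_sq, sqrt_three_sq, a2_sq', s4_sq]

theorem iwt4 (a b : Fin 6) : gauge4.iwt a b = cOps.iw a b := by
  have h : gauge4.iwt a b =
    if adj4 a b = true then rt4 a * rt4 b * (k4 a b * k4 b a) else 0 := rfl
  have hy : cOps.iw a b = cOps.lit (iwtLit a b) := rfl
  rw [h, hy, cOps_lit]
  clear h hy
  fin_cases a <;> fin_cases b <;> simp [adj4, iwtLit, rt4, k4, s4_ne]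
  all_goals grind [sqrt_two_sq, sqrt_three_sq, a2_sq', s4_sq]

theorem lam4_lit (a : Fin 6) : rt4 a ^ 2 = cOps.lam a := by
  have hy : cOps.lam a = cOps.lit (lamLit a) := rfl
  rw [hy, cOps_lit]
  clear hy
  fin_cases a <;> simp [lamLit, rt4]
  all_goals grind [s4_sq]

theorem ilam4_lit (a : Fin 6) : (rt4 a ^ 2)⁻¹ = cOps.ilam a := by
  have hy : cOps.ilam a = cOps.lit (ilamLit a) := rfl
  rw [hy, cOps_lit]
  clear hy
  fin_cases a <;> simp [ilamLit, rt4]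
  all_goals rw [← inv_pow, s4_inv]; grind [s4_sq, sqrt_two_sq, sqrt_three_sq]

theorem h4_eq : h4 = s4⁻¹ := by
  have h1 : √(delta4 / 2) = sR⁻¹ := by
    refine sqrt_eq_of_sq (inv_nonneg.2 sR_pos.le) ?_
    rw [inv_pow, sR_sq, delta4, sqrt_six, inv_eq_iff_eq_inv, eq_comm, inv_eq_iff_eq_inv,
      inv_eq_of_mul_eq_one_right]
    grind [sqrt_two_sq', sqrt_three_sq']
  rw [h4, h1, Complex.ofReal_inv, s4_eq]

theorem e4_eq : e4 = (√2 : ℝ) / 2 * (1 + Complex.I) := by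
  have h : e4 = Complex.exp ((Real.pi / 4 : ℝ) * Complex.I) := by
    rw [e4]; congr 1; push_cast; ring
  rw [h, Complex.exp_mul_I, ← Complex.ofReal_cos, ← Complex.ofReal_sin, Real.cos_pi_div_four,
    Real.sin_pi_div_four]
  push_cast
  ring

theorem cos_pi_div_twelve_eq : Real.cos (Real.pi / 12) = √2 * (1 + √3) / 4 := by
  have h : Real.pi / 12 = Real.pi / 3 - Real.pi / 4 := by ring
  rw [h, Real.cos_sub, Real.cos_pi_div_three, Real.sin_pi_div_three, Real.cos_pi_div_four,
    Real.sin_pi_div_four]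
  ring

theorem z4_eq : z4 = s4 * (1 + (√2 : ℝ) * (√3 : ℝ) / 2) *
    (theta * ((1 + (√2 : ℝ) - (√3 : ℝ)) / 2) +
      (1 - (√2 : ℝ) + (√3 : ℝ)) / 2 * Complex.I) := by
  have h1 : √(1 - Real.cos (Real.pi / 12)) =
      sR * (1 + √2 * √3 / 2) * (thetaR * ((1 + √2 - √3) / 2)) := by
    refine sqrt_eq_of_sq ?_ ?_
    · have := sR_pos
      have := thetaR_pos
      have : 0 < 1 + √2 - √3 := by linarith [sqrt_two_gt, sqrt_three_lt]
      positivity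
    · rw [cos_pi_div_twelve_eq]
      grind [sqrt_two_sq', sqrt_three_sq', sR_sq, thetaR_sq]
  have h2 : √(Real.cos (Real.pi / 12)) = sR * (1 + √2 * √3 / 2) * ((1 - √2 + √3) / 2) := by
    refine sqrt_eq_of_sq ?_ ?_
    · have := sR_pos
      have : 0 < 1 - √2 + √3 := by linarith [sqrt_two_lt, sqrt_three_gt]
      positivity
    · rw [cos_pi_div_twelve_eq]
      grind [sqrt_two_sq', sqrt_three_sq', sR_sq]
  rw [z4, h1, h2, s4_eq, theta_eq]
  push_cast
  ring

theorem conj_e4 : (starRingEnd ℂ) e4 = (√2 : ℝ) / 2 * (1 - Complex.I) := by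
  rw [e4_eq]
  simp [sub_eq_add_neg, Complex.conj_ofNat]

theorem conj_z4 : (starRingEnd ℂ) z4 = s4 * (1 + (√2 : ℝ) * (√3 : ℝ) / 2) *
    (theta * ((1 + (√2 : ℝ) - (√3 : ℝ)) / 2) -
      (1 - (√2 : ℝ) + (√3 : ℝ)) / 2 * Complex.I) := by
  rw [z4_eq, s4_eq, theta_eq]
  simp [sub_eq_add_neg, Complex.conj_ofNat]

/-- The factors of the red strand at the two sides of a region, in the chosen gauge. -/
theorem redL4 (a b : Fin 6) : rt4 b / rt4 a * projVec b (invol b) a * (k4 a b / k4 a (invol b)) =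
    cOps.lit (redLitL b a) := by
  rw [cOps_lit]
  fin_cases a <;> fin_cases b <;> simp [redLitL, rt4, k4, projVec, invol, s4_ne, a2_ne, h4_eq]
  all_goals try simp only [conj_e4, conj_z4, mul_neg]
  all_goals try simp only [e4_eq, z4_eq]
  all_goals try simp only [s4_inv]
  all_goals grind [sqrt_two_sq, sqrt_three_sq, s4_sq, a2_ne]

theorem redR4 (b c : Fin 6) :
    rt4 b / rt4 c * star (projVec b (invol b) c) * (k4 b c / k4 (invol b) c) =
    cOps.lit (redLitR b c) := by
  rw [cOps_lit]
  have hs : (starRingEnd ℂ) s4 = s4 := Complex.conj_ofReal _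
  have hh : (starRingEnd ℂ) h4 = h4 := Complex.conj_ofReal _
  fin_cases b <;> fin_cases c <;>
    simp [redLitR, rt4, k4, projVec, invol, s4_ne, a2_ne, hs, hh, h4_eq]
  all_goals try simp only [conj_e4, conj_z4, mul_neg]
  all_goals try simp only [e4_eq, z4_eq]
  all_goals try simp only [s4_inv]
  all_goals grind [sqrt_two_sq, sqrt_three_sq, s4_sq, a2_ne]

theorem invol_invol (a : Fin 6) : invol (invol a) = a := by revert a; decide

theorem adj4_invol (a b : Fin 6) : adj4 a (invol b) = adj4 a b := by
  fin_cases a <;> fin_cases b <;> rfl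

theorem projVec_of_ne_invol {a b : Fin 6} (x : Fin 6) (h : b ≠ invol a) : projVec a b x = 0 := by
  revert h
  fin_cases a <;> fin_cases b <;> simp [projVec, invol]

theorem edgeWeight4 {a b : Fin 6} (h : adj4 a b = true) : edgeWeight Γ₄ a b = rt4 b / rt4 a :=
  gauge4.edge a b h

theorem rt4_ne (a : Fin 6) : rt4 a ≠ 0 := gauge4.rt_ne a

theorem rt4_invol (a : Fin 6) : rt4 (invol a) = rt4 a := by fin_cases a <;> rfl

/-- The edge weight may be evaluated as a quotient of square roots next to a component of a vector
`projVec`, since the latter vanishes at pairs of vertices that are not adjacent. -/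
theorem edgeWeight_mul_projVec (a b c : Fin 6) :
    edgeWeight Γ₄ a b * projVec b c a = rt4 b / rt4 a * projVec b c a := by
  by_cases h : adj4 a b = true
  · rw [edgeWeight4 h]
  · rw [projVec_eq_zero b a c (fun h' => h (by rw [adj4_symm]; exact h'.1)), mul_zero, mul_zero]

theorem edgeWeight_mul_star_projVec' (a b c : Fin 6) :
    edgeWeight Γ₄ a c * star (projVec b c a) = rt4 c / rt4 a * star (projVec b c a) := by
  by_cases h : adj4 a c = true
  · rw [edgeWeight4 h]
  · rw [projVec_eq_zero b a c (fun h' => h h'.2), star_zero, mul_zero, mul_zero]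

theorem lval_rotCW_proj4 (a x b c : Fin 6) : lval (rotCW proj4) [a, x, c] [a, b, c] =
    (rt4 b / rt4 a * projVec b x a) * (rt4 x / rt4 c * star (projVec b x c)) := by
  rw [lval_rotCW, lval_proj4, ← edgeWeight_mul_projVec, ← edgeWeight_mul_star_projVec']
  ring

theorem lval_rotCW_proj4_of_ne (a x b c : Fin 6) (h : x ≠ invol b) :
    lval (rotCW proj4) [a, x, c] [a, b, c] = 0 := by
  rw [lval_rotCW_proj4, projVec_of_ne_invol _ h, mul_zero, zero_mul]

theorem red4 (a b c : Fin 6) : gauge4.red (rotCW proj4) invol a b c = cOps.rho a b c := by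
  have h : cOps.rho a b c = cOps.lit (redLitL b a) * cOps.lit (redLitR b c) := rfl
  have hg : gauge4.red (rotCW proj4) invol a b c =
    lval (rotCW proj4) [a, invol b, c] [a, b, c] * (k4 a b * k4 b c) /
      (k4 a (invol b) * k4 (invol b) c) := rfl
  rw [h, hg, ← redL4, ← redR4, lval_rotCW_proj4, rt4_invol]
  field_simp

/-- Reversing the red strand conjugates and exchanges the two sides. -/
theorem projVec_symm (a b x : Fin 6) : projVec b a x = star (projVec a b x) := by
  have hs : (starRingEnd ℂ) s4 = s4 := Complex.conj_ofReal _
  have hh : (starRingEnd ℂ) h4 = h4 := Complex.conj_ofReal _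
  fin_cases a <;> fin_cases b <;> fin_cases x <;> simp [projVec, hs, hh]

/-! ### Coordinates of the diagrams in the relations of the red strand -/

section
variable {V : Type} [Fintype V] [DecidableEq V] {Γ : PFGraph V}

theorem lval_coev_comp {n : ℕ} (f : Hom Γ 2 n) (a : V) (u : List V)
    (hu : (a :: u).getLast (by simp) = a) :
    lval (coev ⨾ f) [a] (a :: u) = ∑ x, edgeWeight Γ a x * lval f [a, x, a] (a :: u) := by
  rw [lval_comp, sumL_three]
  simp [hu, lval_coev]

theorem lval_comp_ev (f : Hom Γ 2 2) (a x : V) :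
    lval (f ⨾ ev) [a, x, a] [a] = ∑ y, lval f [a, x, a] [a, y, a] * edgeWeight Γ a y := by
  rw [lval_comp, sumL_three]
  simp [lval_ev]

theorem lval_comp_two {n : ℕ} (f : Hom Γ n 2) (g : Hom Γ 2 1) (p : List V) (a b : V) :
    lval (f ⨾ g) p [a, b] = ∑ y, lval f p [a, y, b] * lval g [a, y, b] [a, b] := by
  rw [lval_comp, sumL_three]
  simp

theorem lval_comp_two' {n : ℕ} (f : Hom Γ n 2) (g : Hom Γ 2 2) (p : List V) (a y b : V) :
    lval (f ⨾ g) p [a, y, b] = ∑ x, lval f p [a, x, b] * lval g [a, x, b] [a, y, b] := by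
  rw [lval_comp, sumL_three]
  simp

theorem lval_closeRight (f : Hom Γ 2 2) {a b : V} (hab : Γ.adj a b = true) :
    lval ((idm 1 ⊠ coev) ⨾ (f ⊠ idm 1 :) ⨾ (idm 1 ⊠ (ev : Hom Γ 2 0) :) : Hom Γ 1 1) [a, b] [a, b] =
      ∑ x, edgeWeight Γ b x * edgeWeight Γ b x * lval f [a, b, x] [a, b, x] := by
  rw [lval_comp_idm_tensor (i := 1) (m := 2) (n := 0)]
  simp only [List.take, List.drop, List.cons_append, List.nil_append]
  rw [sumL_three]
  simp only [List.getLast]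
  refine Finset.sum_congr rfl fun x _ => ?_
  rw [lval_comp_tensor_idm (j := 1) (m := 2) (n := 2)]
  simp only [List.take, List.drop, List.cons_append, List.nil_append]
  rw [sumL_three]
  simp only [List.getLast]
  rw [Finset.sum_eq_single b]
  · rw [lval_tensor]
    simp [lval_idm_one, lval_coev, lval_ev, hab]
    ring
  · intro y _ hy
    rw [lval_tensor]
    simp [lval_idm_one, hy.symm]
  · simp

theorem lval_closeLeft (f : Hom Γ 2 2) {a b : V} (hab : Γ.adj a b = true) :
    lval ((coev ⊠ idm 1) ⨾ (idm 1 ⊠ f :) ⨾ ((ev : Hom Γ 2 0) ⊠ idm 1 :) : Hom Γ 1 1) [a, b] [a, b] =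
      ∑ x, edgeWeight Γ a x * edgeWeight Γ a x * lval f [x, a, b] [x, a, b] := by
  rw [lval_comp_tensor_idm (j := 1) (m := 2) (n := 0)]
  simp only [List.take, List.drop, List.cons_append, List.nil_append]
  rw [sumL_three]
  simp only [List.getLast]
  refine Finset.sum_congr rfl fun x _ => ?_
  rw [lval_comp_idm_tensor (i := 1) (m := 2) (n := 2)]
  simp only [List.take, List.drop, List.cons_append, List.nil_append]
  rw [sumL_three]
  simp only [List.getLast]
  rw [Finset.sum_eq_single a]
  · rw [lval_tensor]
    simp [lval_idm_one, lval_coev, lval_ev, hab]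
    ring
  · intro y _ hy
    rw [lval_tensor]
    simp [lval_idm_one, lval_coev, hy.symm, hy]
  · simp

theorem lval_act_left_right (f : Hom Γ 2 2) {x p q y z w : V} (h : Γ.adj q z = true) :
    lval ((f ⊠ idm 1 :) ⨾ (idm 1 ⊠ f :) : Hom Γ 3 3) [x, p, q, z] [x, y, w, z] =
      lval f [x, p, q] [x, y, q] * lval f [y, q, z] [y, w, z] := by
  rw [lval_comp_idm_tensor (i := 1) (m := 2) (n := 2)]
  simp only [List.take, List.drop, List.cons_append, List.nil_append]
  rw [sumL_three]
  simp only [List.getLast]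
  rw [Finset.sum_eq_single q]
  · rw [lval_tensor]
    simp [lval_idm_one, h]
  · intro u _ hu
    rw [lval_tensor]
    simp [lval_idm_one, hu.symm]
  · simp

theorem lval_act_right_left (f : Hom Γ 2 2) {x p q y z w : V} (h : Γ.adj x p = true) :
    lval ((idm 1 ⊠ f :) ⨾ (f ⊠ idm 1 :) : Hom Γ 3 3) [x, p, q, z] [x, y, w, z] =
      lval f [p, q, z] [p, w, z] * lval f [x, p, w] [x, y, w] := by
  rw [lval_comp_tensor_idm (j := 1) (m := 2) (n := 2)]
  simp only [List.take, List.drop, List.cons_append, List.nil_append]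
  rw [sumL_three]
  simp only [List.getLast]
  rw [Finset.sum_eq_single p]
  · rw [lval_tensor]
    simp [lval_idm_one, h]
  · intro u _ hu
    rw [lval_tensor]
    simp [lval_idm_one, hu.symm]
  · simp

theorem lval_caps (f : Hom Γ 2 2) {a x y z b : V} (hx : Γ.adj a x = true) (hz : Γ.adj z b = true) :
    lval ((idm 1 ⊠ f ⊠ idm 1 :) ⨾ (ev ⊠ (ev : Hom Γ 2 0) :) : Hom Γ 4 0) [a, x, y, z, b] [a] =
      if b = a then edgeWeight Γ a x * edgeWeight Γ a z * lval f [x, y, z] [x, a, z] else 0 := by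
  rw [lval_comp, sumL_single 5 [a, x, a, z, b] rfl]
  · rw [lval_tensor, lval_tensor, lval_tensor]
    split_ifs with h
    · subst h
      simp [lval_idm_one, lval_ev, hx, hz]
      ring
    · simp [lval_ev, h]
  · intro l hl hne
    match l, hl with
    | [t0, t1, t2, t3, t4], _ =>
      rw [lval_tensor, lval_tensor, lval_tensor]
      simp only [List.take, List.drop, lval_idm_one, lval_ev]
      by_contra hh
      simp only [mul_ite, mul_zero, ite_mul, zero_mul, ite_eq_right_iff, Classical.not_imp] at hh
      apply hne
      grind

theorem lval_cups (f : Hom Γ 2 2) (a x y z : V) :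
    lval ((coev ⊠ coev) ⨾ (idm 1 ⊠ f ⊠ idm 1 :) : Hom Γ 0 4) [a] [a, x, y, z, a] =
      edgeWeight Γ a x * edgeWeight Γ a z * lval f [x, a, z] [x, y, z] := by
  rw [lval_comp_idm_tensor_idm (i := 1) (j := 1) (m := 2) (n := 2)]
  simp only [List.take, List.drop, List.cons_append, List.nil_append]
  rw [sumL_three]
  simp only [List.getLast]
  rw [Finset.sum_eq_single a]
  · simp only [List.cons_append, List.nil_append]
    rw [lval_coev_tensor_coev]
    simp
  · intro u _ hu
    simp only [List.cons_append, List.nil_append]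
    rw [lval_coev_tensor_coev]
    simp [hu]
  · simp

end

/-! ### The relations that involve only the red strand -/

theorem lval_zero {m n : ℕ} (p q : List (Fin 6)) : lval (0 : Hom Γ₄ m n) p q = 0 := by
  have := lval_smul (0 : ℂ) (0 : Hom Γ₄ m n) p q
  rwa [zero_smul, zero_mul] at this

theorem lval_comp_zero {m n : ℕ} (f : Hom Γ₄ m 0) (g : Hom Γ₄ 0 n) (p : List (Fin 6)) (a : Fin 6)
    (u : List (Fin 6)) : lval (f ⨾ g) p (a :: u) = lval f p [a] * lval g [a] (a :: u) := by
  rw [lval_comp, sumL_one]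

theorem lval_proj4_of_ne {a b c d : Fin 6} (x y : Fin 6) (h : b ≠ invol a) :
    lval proj4 [a, x, b] [d, y, c] = 0 := by
  by_cases hd : d = a
  · by_cases hc : c = b
    · rw [hd, hc, lval_proj4, projVec_of_ne_invol _ h, zero_mul]
    · exact lval_eq_zero_of_ne (by simpa using Ne.symm hc)
  · exact lval_eq_zero_of_head_ne (by simpa using Ne.symm hd)

/-- A component of `projVec a (invol a)` has the modulus for which (decStick) holds. -/
theorem projVec_mul_star {a x : Fin 6} (h : adj4 a x = true) :
    projVec a (invol a) x * star (projVec a (invol a) x) = (rt4 x / rt4 a) ^ 2 := by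
  have hs : (starRingEnd ℂ) s4 = s4 := Complex.conj_ofReal _
  have hh : (starRingEnd ℂ) h4 = h4 := Complex.conj_ofReal _
  revert h
  fin_cases a <;> fin_cases x <;> simp [projVec, invol, adj4, rt4, hs, hh, h4_eq]
  all_goals try simp only [conj_e4, conj_z4]
  all_goals try simp only [e4_eq, z4_eq]
  all_goals grind [sqrt_two_sq, sqrt_three_sq, s4_sq, theta_sq, Complex.I_sq]

theorem reverse4 : rotCW (rotCW proj4) = proj4 := by
  refine hom_ext_2_2 fun a x y b hp => ?_
  have h1 := rt4_ne a
  have h2 := rt4_ne b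
  have h3 := rt4_ne x
  have h4 := rt4_ne y
  have e1 : adj4 a y = true ∧ adj4 y b = true := isPathList_two.1 hp.2.1
  have e2 : adj4 a x = true ∧ adj4 x b = true := isPathList_two.1 hp.1
  rw [lval_rotCW, lval_rotCW_proj4, lval_proj4, edgeWeight4 e1.1,
    edgeWeight4 (a := b) (b := x) (by rw [adj4_symm]; exact e2.2),
    projVec_symm a b, projVec_symm a b, star_star]
  field_simp

theorem rotCCW_proj4 : rotCCW proj4 = rotCW proj4 := by
  refine hom_ext_2_2 fun a x y b hp => ?_
  have e1 : adj4 a y = true ∧ adj4 y b = true := isPathList_two.1 hp.2.1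
  have e2 : adj4 a x = true ∧ adj4 x b = true := isPathList_two.1 hp.1
  rw [lval_rotCCW, lval_rotCW_proj4, lval_proj4, edgeWeight4 e2.1,
    edgeWeight4 (a := b) (b := y) (by rw [adj4_symm]; exact e1.2),
    projVec_symm y x, projVec_symm y x, star_star]
  by_cases h : x = invol y
  · subst h
    rw [rt4_invol]
    ring
  · rw [projVec_of_ne_invol _ h, projVec_of_ne_invol _ h]
    simp

theorem recouple4 : proj4 ⊠ rotCW (rotCW proj4) =
    (idm 1 ⊠ rotCW proj4 ⊠ idm 1 :) ⨾ (ev ⊠ (ev : Hom Γ₄ 2 0) :) ⨾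
      ((coev ⊠ coev) ⨾ (idm 1 ⊠ rotCCW proj4 ⊠ idm 1 :)) := by
  rw [reverse4, rotCCW_proj4]
  refine hom_ext_4_4 fun a x1 x2 x3 y1 y2 y3 b hp => ?_
  obtain ⟨e1, -, -, e4⟩ : Γ₄.adj a x1 = true ∧ Γ₄.adj x1 x2 = true ∧ Γ₄.adj x2 x3 = true ∧
    Γ₄.adj x3 b = true := by simpa [IsPathList] using hp.1
  obtain ⟨f1, -, -, f4⟩ : Γ₄.adj a y1 = true ∧ Γ₄.adj y1 y2 = true ∧ Γ₄.adj y2 y3 = true ∧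
    Γ₄.adj y3 b = true := by simpa [IsPathList] using hp.2.1
  rw [lval_comp_zero, lval_caps _ e1 e4]
  by_cases hab : b = a
  · subst hab
    have e4' : adj4 b x3 = true := by rw [adj4_symm]; exact e4
    have f4' : adj4 b y3 = true := by rw [adj4_symm]; exact f4
    rw [if_pos rfl, lval_cups, lval_rotCW_proj4, lval_rotCW_proj4, lval_tensor,
      edgeWeight4 e1, edgeWeight4 e4', edgeWeight4 f1, edgeWeight4 f4']
    simp only [List.take, List.drop]
    by_cases hx : x2 = invol b
    · by_cases hy : y2 = invol b
      · subst hx hy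
        simp only [lval_proj4, rt4_invol, projVec_symm b (invol b), star_star]
        have := rt4_ne b
        have := rt4_ne x1
        have := rt4_ne x3
        have := rt4_ne y1
        have := rt4_ne y3
        field_simp
      · rw [lval_eq_zero_of_ne (by simpa [hx] using Ne.symm hy), projVec_symm b y2,
          projVec_of_ne_invol _ hy]
        simp
    · rw [lval_proj4_of_ne _ _ hx, projVec_of_ne_invol _ hx]
      simp
  · rw [if_neg hab, zero_mul, lval_tensor]
    simp only [List.take, List.drop]
    by_cases hx : x2 = invol a
    · rw [lval_proj4_of_ne (a := x2) (b := b), mul_zero]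
      rw [hx, invol_invol]
      exact hab
    · rw [lval_proj4_of_ne _ _ hx, zero_mul]

/-- Only `u¹¹` and `u⁴⁴` contribute, and their two entries are opposite at vertices of equal weight. -/
theorem schur0_4 : coev ⨾ proj4 = 0 ∧ proj4 ⨾ ev = 0 := by
  have h01 : edgeWeight Γ₄ 0 1 = edgeWeight Γ₄ 0 5 := by rw [edgeWeight4 rfl, edgeWeight4 rfl]; rfl
  have h32 : edgeWeight Γ₄ 3 2 = edgeWeight Γ₄ 3 4 := by rw [edgeWeight4 rfl, edgeWeight4 rfl]; rfl
  constructor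
  · refine hom_ext_0_2 fun a x hp => ?_
    rw [lval_coev_comp _ _ _ (by simp), lval_zero]
    simp only [lval_proj4, ← mul_assoc]
    rw [← Finset.sum_mul, Fin.sum_univ_six]
    fin_cases a <;> simp [projVec, h01, h32]
  · refine hom_ext_2_0 fun a x hp => ?_
    rw [lval_comp_ev, lval_zero]
    simp only [lval_proj4, mul_assoc, mul_comm (star _)]
    rw [← Finset.mul_sum, Fin.sum_univ_six]
    fin_cases a <;> simp [projVec, h01, h32]

theorem decStick4 : (idm 1 ⊠ coev) ⨾ (proj4 ⊠ idm 1 :) ⨾ (idm 1 ⊠ (ev : Hom Γ₄ 2 0) :) =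
    (idm 1 : Hom Γ₄ 1 1) ∧
    (coev ⊠ idm 1) ⨾ (idm 1 ⊠ proj4 :) ⨾ ((ev : Hom Γ₄ 2 0) ⊠ idm 1 :) = (idm 1 : Hom Γ₄ 1 1) := by
  constructor
  · refine hom_ext_1_1 fun a b hp => ?_
    have h : Γ₄.adj a b = true := by simpa [IsPathList] using hp.1
    change adj4 a b = true at h
    rw [lval_closeRight _ h, lval_idm_one, if_pos ⟨h, rfl, rfl⟩, Finset.sum_eq_single (invol a)]
    · rw [lval_proj4, projVec_mul_star h, edgeWeight4 (by rw [adj4_invol, adj4_symm]; exact h),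
        rt4_invol]
      have h1 := rt4_ne a
      have h2 := rt4_ne b
      field_simp
    · intro x _ hx
      rw [lval_proj4, projVec_of_ne_invol _ hx, zero_mul, mul_zero]
    · simp
  · refine hom_ext_1_1 fun a b hp => ?_
    have h : Γ₄.adj a b = true := by simpa [IsPathList] using hp.1
    change adj4 a b = true at h
    rw [lval_closeLeft _ h, lval_idm_one, if_pos ⟨h, rfl, rfl⟩, Finset.sum_eq_single (invol b)]
    · have h' : adj4 b a = true := by rw [adj4_symm]; exact h
      rw [lval_proj4, projVec_symm b (invol b), star_star, mul_comm (star _), projVec_mul_star h',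
        edgeWeight4 (by rw [adj4_invol]; exact h), rt4_invol]
      have h1 := rt4_ne a
      have h2 := rt4_ne b
      field_simp
    · intro x _ hx
      rw [lval_proj4, projVec_of_ne_invol (b := b), zero_mul, mul_zero]
      rintro rfl
      exact hx (invol_invol x).symm
    · simp

/-- The trivalent vertex is orthogonal to the vectors that define `P₄`. -/
theorem trivCoeff_comp_projVec (a b : Fin 6) :
    ∑ y, (trivCoeff a y b : ℂ) * star (projVec a b y) = 0 := by
  rw [Fin.sum_univ_six]
  have hs : (starRingEnd ℂ) s4 = s4 := Complex.conj_ofReal _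
  fin_cases a <;> fin_cases b <;> simp [trivCoeff, projVec, hs]
  all_goals try simp only [conj_e4, conj_z4]
  all_goals try simp only [e4_eq, z4_eq]
  all_goals simp [a5_eq, a6_eq, a7_eq, a3_eq, a4_eq, a8_eq, a9_eq, ← s4_eq, ← theta_eq]
  all_goals grind [sqrt_two_sq, sqrt_three_sq, s4_sq, theta_sq, a2_sq', Complex.I_sq]

theorem schur1_4 : proj4 ⨾ triv4 = 0 ∧ split (bend21 triv4) ⨾ proj4 = 0 := by
  constructor
  · refine hom_ext_2_1 fun a x b hp => ?_
    rw [lval_comp_two, lval_zero]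
    simp only [lval_proj4, lval_triv4]
    have := congrArg (projVec a b x * ·) (trivCoeff_comp_projVec a b)
    simp only [Finset.mul_sum, mul_zero] at this
    rw [← this]
    exact Finset.sum_congr rfl fun y _ => by ring
  · refine hom_ext_1_2 fun a y b hp => ?_
    rw [lval_comp_two', lval_zero]
    have h : Γ₄.adj a b = true := by simpa [IsPathList] using hp.1
    have key : ∀ x, lval (split (bend21 triv4)) [a, b] [a, x, b] =
        (trivCoeff b x a : ℂ) := by
      intro x
      rw [lval_split, lval_bend21, lval_triv4]
      by_cases hx : adj4 b x = true ∧ adj4 x a = true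
      · rw [edgeWeight4 h, edgeWeight4 hx.1, edgeWeight4 hx.2]
        have := rt4_ne a
        have := rt4_ne b
        have := rt4_ne x
        field_simp
      · rw [trivCoeff_eq_zero b x a (fun hp => hx (isPathList_two.1 hp.1))]
        simp
    have := congrArg (fun z => star (projVec a b y) * z)
      (trivCoeff_comp_projVec b a)
    simp only [Finset.mul_sum, mul_zero] at this
    rw [← this]
    refine Finset.sum_congr rfl fun x _ => ?_
    rw [key, lval_proj4, projVec_symm b a x]
    ring

/-- The edge weights may be replaced by quotients of square roots, because the vertex vanishes at
non-edges; the sums that remain are evaluated vertex by vertex. -/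
theorem lollipop4 : coev ⨾ triv4 = 0 := by
  refine hom_ext_0_1 fun a => ?_
  rw [lval_coev_comp _ _ _ (by simp), lval_zero]
  simp only [lval_triv4]
  have : ∀ x, edgeWeight Γ₄ a x * (trivCoeff a x a : ℂ) = rt4 x / rt4 a * (trivCoeff a x a : ℂ) := by
    intro x
    by_cases h : adj4 a x = true
    · rw [edgeWeight4 h]
    · rw [trivCoeff_eq_zero a x a (fun hp => h (isPathList_two.1 hp.1).1)]; simp
  simp only [this]
  rw [Fin.sum_univ_six]
  fin_cases a <;> simp [trivCoeff, rt4, a3_eq, a4_eq, a5_eq, a7_eq, a8_eq, a9_eq, ← s4_eq,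
      ← theta_eq]
  all_goals grind [sqrt_two_sq, sqrt_three_sq, s4_sq, theta_sq, a2_sq']

/-- Both sides apply the involution to the regions `a` and `b`; the identity `swap_eq` compares the
factors. -/
theorem swap4 : (rotCW proj4 ⊠ idm 1 :) ⨾ (idm 1 ⊠ rotCW proj4 :) =
    (-1 : ℂ) • ((idm 1 ⊠ rotCW proj4 :) ⨾ (rotCW proj4 ⊠ idm 1 :)) := by
  have hk : ∀ a b c, lval (rotCW proj4) [a, invol b, c] [a, b, c] =
      cOps.rho a b c * (k4 a (invol b) * k4 (invol b) c) / (k4 a b * k4 b c) := by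
    intro a b c
    have h1 : k4 a b ≠ 0 := gauge4.k_ne _ _
    have h2 : k4 b c ≠ 0 := gauge4.k_ne _ _
    have h3 : k4 a (invol b) ≠ 0 := gauge4.k_ne _ _
    have h4 : k4 (invol b) c ≠ 0 := gauge4.k_ne _ _
    have hg : gauge4.red (rotCW proj4) invol a b c =
      lval (rotCW proj4) [a, invol b, c] [a, b, c] * (k4 a b * k4 b c) /
        (k4 a (invol b) * k4 (invol b) c) := rfl
    rw [← red4, hg]
    field_simp
  refine hom_ext_3_3 fun x p1 p2 a b z hp => ?_
  obtain ⟨e1, -, e3⟩ : Γ₄.adj x p1 = true ∧ Γ₄.adj p1 p2 = true ∧ Γ₄.adj p2 z = true := by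
    simpa [IsPathList] using hp.1
  rw [lval_smul, lval_act_left_right _ e3, lval_act_right_left _ e1]
  by_cases h1 : p1 = invol a
  · by_cases h2 : p2 = invol b
    · subst h1 h2
      have key : cOps.rho x a (invol b) * cOps.rho a b z =
        -1 * (cOps.rho (invol a) b z * cOps.rho x a b) := by
        have h12 : cOps.root [12] = -1 := by
          have : cOps.root [12] = (q4 ^ 2) ^ 12 + 0 := rfl
          rw [this, add_zero, show (12 : ℕ) = 6 * 2 from rfl, pow_mul, root_six, Complex.I_sq]
        rw [← h12]
        exact swap_eq x a b z
      rw [hk, hk, hk, hk]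
      have h1 : k4 a (invol b) ≠ 0 := gauge4.k_ne _ _
      have h2 : k4 (invol a) b ≠ 0 := gauge4.k_ne _ _
      have h3 : k4 x a ≠ 0 := gauge4.k_ne _ _
      have h4 : k4 a b ≠ 0 := gauge4.k_ne _ _
      have h5 : k4 b z ≠ 0 := gauge4.k_ne _ _
      field_simp
      linear_combination (k4 x (invol a) * k4 (invol a) (invol b) * k4 (invol b) z) * key
    · rw [lval_rotCW_proj4_of_ne _ _ _ _ h2, lval_rotCW_proj4_of_ne _ _ _ _ h2]
      simp
  · rw [lval_rotCW_proj4_of_ne _ _ _ _ h1, lval_rotCW_proj4_of_ne _ _ _ _ h1]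
    simp

/-! ### The relations that involve the trivalent vertex -/

theorem cOps_add (x y : ℂ) : cOps.add x y = x + y := rfl
theorem cOps_mul (x y : ℂ) : cOps.mul x y = x * y := rfl
theorem cOps_guard (p : Bool) (x : ℂ) : cOps.guard p x = if p = true then x else 0 := rfl
theorem cOps_root_nil : cOps.root [] = 0 := rfl
theorem cOps_root_cons (k : ℕ) (l : List ℕ) : cOps.root (k :: l) = (q4 ^ 2) ^ k + cOps.root l := rfl

theorem cOps_sum6 (f : Fin 6 → Fin 6 → ℂ) : cOps.sum6 f = ∑ x, f x (invol x) := by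
  rw [Fin.sum_univ_six, Ops.sum6]
  simp only [cOps_add, invol]
  simp only [add_assoc]
  rfl

theorem cOps_sum5 (f : Fin 5 → ℂ) : cOps.sum5 f = ∑ j, f j := by
  rw [Fin.sum_univ_five, Ops.sum5]
  simp only [cOps_add, add_assoc]

theorem rt_sq4 (a : Fin 6) : gauge4.rt a ^ 2 = cOps.lam a := lam4_lit a

theorem norm3_triv4 (a b c : Fin 6) : gauge4.norm3 (bend21 triv4) a b c = cOps.y a b c := by
  rw [Gauge.norm3_bend21, tri4]

theorem norm3_dec3_one4 (a b c : Fin 6) :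
    gauge4.norm3 (dec3 (rotCW proj4) 1 (bend21 triv4)) a b c = cOps.dec1 a b (invol b) c := by
  rw [gauge4.norm3_dec3_1 _ lval_rotCW_proj4_of_ne, red4, norm3_triv4]; rfl

theorem norm3_dec3_two4 (a b c : Fin 6) :
    gauge4.norm3 (dec3 (rotCW proj4) 2 (bend21 triv4)) a b c = cOps.dec2 a b c (invol c) := by
  rw [gauge4.norm3_dec3_2 _ lval_rotCW_proj4_of_ne, red4, norm3_triv4]; rfl

theorem norm3_dec3_three4 (a b c : Fin 6) :
    gauge4.norm3 (dec3 (rotCW proj4) 3 (bend21 triv4)) a b c = cOps.dec3 a (invol a) b c := by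
  rw [gauge4.norm3_dec3_3 _ lval_rotCW_proj4_of_ne, red4, norm3_triv4]; rfl

theorem lval_bigon4 (v : Hom Γ₄ 0 3) (W : Fin 6 → Fin 6 → ℂ) {a b : Fin 6} (hab : adj4 a b = true)
    (hW : ∀ x, gauge4.norm3 v b a x = W x (invol x)) :
    lval (bigon triv4 v) [a, b] [a, b] = cOps.gon2 W a b := by
  rw [gauge4.lval_bigon_eq triv4 v hab, Ops.gon2, cOps_sum6]
  refine Finset.sum_congr rfl fun x _ => ?_
  simp only [tri4, wt4, rt_sq4, cOps_mul, hW]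
  ring

theorem norm3_trigon4 (v : Hom Γ₄ 0 3) (W : Fin 6 → Fin 6 → ℂ) (a b c : Fin 6)
    (hW : ∀ x, gauge4.norm3 v x a b = W x (invol x)) :
    gauge4.norm3 (trigon triv4 v) a b c = cOps.gon3 W a b c := by
  rw [gauge4.norm3_trigon, Ops.gon3, cOps_sum6]
  refine Finset.sum_congr rfl fun x _ => ?_
  simp only [tri4, wt4, rt_sq4, cOps_mul, hW]
  ring

theorem norm4_tetragon4 (v : Hom Γ₄ 0 3) (W : Fin 6 → Fin 6 → ℂ) (a b c d : Fin 6)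
    (hW : ∀ x, gauge4.norm3 v x a b = W x (invol x)) :
    gauge4.norm4 (tetragon triv4 v) a b c d = cOps.gon4 W a b c d := by
  rw [gauge4.norm4_tetragon, Ops.gon4, cOps_sum6]
  refine Finset.sum_congr rfl fun x _ => ?_
  simp only [tri4, wt4, rt_sq4, cOps_mul, hW]
  ring

theorem norm5_pentagon4 (v : Hom Γ₄ 0 3) (W : Fin 6 → Fin 6 → ℂ) (a b c d e : Fin 6)
    (hW : ∀ x, gauge4.norm3 v x a b = W x (invol x)) :
    gauge4.norm5 (pentagon triv4 v) a b c d e = cOps.gon5 W a b c d e := by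
  rw [gauge4.norm5_pentagon, Ops.gon5, cOps_sum6]
  refine Finset.sum_congr rfl fun x _ => ?_
  simp only [tri4, wt4, rt_sq4, cOps_mul, hW]
  ring

theorem norm4_treeI4 (a b c d : Fin 6) : gauge4.norm4 (treeI triv4) a b c d =
    cOps.tree4 a b c d := by
  rw [gauge4.norm4_treeI, Ops.tree4]
  simp only [tri4, wt4, cOps_mul]
  ring

theorem norm5_tree54 (a b c d e : Fin 6) : gauge4.norm5 (tree5 triv4) a b c d e =
    cOps.tree5 a b c d e := by
  rw [gauge4.norm5_tree5, Ops.tree5]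
  simp only [tri4, wt4, cOps_mul]
  ring

theorem inv_rt_sq4 (a : Fin 6) : (gauge4.rt a ^ 2)⁻¹ = cOps.ilam a := ilam4_lit a

theorem norm4_arcs4 (a b c d : Fin 6) : gauge4.norm4 (coev ⊠ coev : Hom Γ₄ 0 4) a b c d =
    cOps.arcs a b c d := by
  rw [gauge4.norm4_coev_coev, Ops.arcs, cOps_guard]
  simp only [iwt4, div_eq_mul_inv, inv_rt_sq4, cOps_mul, beq_iff_eq, mul_assoc]

theorem norm4_nest4 (a b c d : Fin 6) : gauge4.norm4 (nest : Hom Γ₄ 0 4) a b c d =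
    cOps.nest a b c d := by
  rw [gauge4.norm4_nest, Ops.nest, cOps_guard]
  simp only [iwt4, div_eq_mul_inv, inv_rt_sq4, cOps_mul, beq_iff_eq, mul_assoc]

theorem norm5_forest54 (a b c d e : Fin 6) : gauge4.norm5 (forest5 triv4) a b c d e =
    cOps.forest5 a b c d e := by
  rw [gauge4.norm5_forest5, Ops.forest5, cOps_guard]
  simp only [iwt4, tri4, div_eq_mul_inv, inv_rt_sq4, cOps_mul, beq_iff_eq, mul_assoc]

theorem norm4_ladder4 (a b c d : Fin 6) : gauge4.norm4 (bend22 (rotCW proj4)) a b c d =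
    cOps.ladder a b (invol b) c d := by
  rw [gauge4.norm4_bend22 _ lval_rotCW_proj4_of_ne, Ops.ladder, cOps_guard]
  simp only [iwt4, red4, div_eq_mul_inv, inv_rt_sq4, cOps_mul, beq_iff_eq, mul_assoc]

/-- The diagram of two arcs joined by a red strand is the rotation of the one with the other two
arcs. -/
theorem bend22_proj4 : bend22 proj4 = right4^[3] (bend22 (rotCW proj4)) := by
  refine gauge4.ext4 fun a b c d hab hbc hcd hda => ?_
  simp only [Function.iterate_succ, Function.iterate_zero, Function.comp, id, gauge4.norm4_right4]
  rw [Gauge.norm4, Gauge.norm4, lval_bend22, lval_bend22, lval_rotCW, gauge4.edge a d (by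
    rw [Γ₄.symm]; exact hda), gauge4.edge d c (by rw [Γ₄.symm]; exact hcd),
    gauge4.edge c b (by rw [Γ₄.symm]; exact hbc), gauge4.edge b c hbc, gauge4.edge d a hda]
  have := gauge4.rt_ne a
  have := gauge4.rt_ne b
  have := gauge4.rt_ne c
  have := gauge4.rt_ne d
  field_simp

theorem norm4_ladder4' (a b c d : Fin 6) : gauge4.norm4 (bend22 proj4) a b c d =
    cOps.ladder d a (invol a) b c := by
  rw [bend22_proj4]
  simp only [Function.iterate_succ, Function.iterate_zero, Function.comp, id, gauge4.norm4_right4]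
  exact norm4_ladder4 d a b c

theorem q4_ne : q4 ≠ 0 := Complex.exp_ne_zero _

theorem q4_pow_24 : q4 ^ 24 = -1 := by
  have := root_six
  calc q4 ^ 24 = ((q4 ^ 2) ^ 6) ^ 2 := by ring
    _ = -1 := by rw [root_six, Complex.I_sq]

theorem q4_zpow_neg (k : ℕ) (hk : k ≤ 24) : q4 ^ (-k : ℤ) = -q4 ^ (24 - k) := by
  rw [zpow_neg, zpow_natCast, inv_eq_of_mul_eq_one_right]
  rw [mul_neg, ← pow_add, show k + (24 - k) = 24 by omega, q4_pow_24, neg_neg]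

theorem q4_zpow_neg_2 : q4 ^ (-2 : ℤ) = -q4 ^ 22 := q4_zpow_neg 2 (by norm_num)
theorem q4_zpow_neg_4 : q4 ^ (-4 : ℤ) = -q4 ^ 20 := q4_zpow_neg 4 (by norm_num)
theorem q4_zpow_neg_6 : q4 ^ (-6 : ℤ) = -q4 ^ 18 := q4_zpow_neg 6 (by norm_num)
theorem q4_zpow_neg_8 : q4 ^ (-8 : ℤ) = -q4 ^ 16 := q4_zpow_neg 8 (by norm_num)
theorem q4_zpow_neg_10 : q4 ^ (-10 : ℤ) = -q4 ^ 14 := q4_zpow_neg 10 (by norm_num)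
theorem q4_zpow_neg_14 : q4 ^ (-14 : ℤ) = -q4 ^ 10 := q4_zpow_neg 14 (by norm_num)
theorem q4_inv : q4⁻¹ = -q4 ^ 23 := by
  have := q4_zpow_neg 1 (by norm_num)
  simpa using this

theorem q4_pow_16 : q4 ^ 16 = q4 ^ 8 - 1 := by
  have := root_cyc
  rw [← pow_mul, ← pow_mul] at this
  exact this

theorem q4_sub_inv_ne : q4 - q4⁻¹ ≠ 0 := by
  intro h
  have h1 : q4 ^ 2 = 1 := by
    rw [sq]
    nth_rewrite 2 [sub_eq_zero.1 h]
    exact mul_inv_cancel₀ q4_ne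
  have h2 := root_six
  rw [h1, one_pow] at h2
  simpa using congrArg Complex.im h2

theorem qint_q4 (n : ℕ) (z : ℂ) (h : q4 ^ n - q4 ^ (-(n : ℤ)) = z * (q4 - q4⁻¹)) :
    qint q4 n = z := by
  rw [qint, h, mul_div_assoc, div_self q4_sub_inv_ne, mul_one]

theorem rotate4 : right3 (bend21 triv4) = bend21 triv4 := by
  refine gauge4.ext3 fun a b c _ _ _ => ?_
  rw [gauge4.norm3_right3, norm3_triv4, norm3_triv4]
  have h : triLit b c a = triLit a b c := by
    fin_cases a <;> fin_cases b <;> fin_cases c <;> rfl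
  exact congrArg cOps.lit h

/-! ### The coefficients as sums of powers of `q ^ 2` -/

theorem root_neg_one : cOps.root [12] = -1 := by
  simp only [cOps_root_cons, cOps_root_nil]
  grind [q4_pow_24]

theorem root_bigon : cOps.root [3, 2, 1, 23, 22, 21] = qint q4 7 - 1 := by
  rw [qint_q4 7 (cOps.root [3, 2, 1, 23, 22, 21] + 1)]
  · ring
  · rw [q4_zpow_neg 7 (by norm_num), q4_inv]
    simp only [cOps_root_cons, cOps_root_nil]
    grind [q4_pow_24]

theorem root_decBigon : cOps.root [1, 0, 23] = q4 ^ 2 + 1 + q4 ^ (-2 : ℤ) := by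
  simp only [cOps_root_cons, cOps_root_nil, q4_zpow_neg_2]
  grind [q4_pow_24]

theorem root_trigon : cOps.root [14, 12, 10] = -(q4 ^ 4 + 1 + q4 ^ (-4 : ℤ)) := by
  simp only [cOps_root_cons, cOps_root_nil, q4_zpow_neg_4]
  grind [q4_pow_24]

theorem root_tetragon : cOps.root [1, 23] = q4 ^ 2 + q4 ^ (-2 : ℤ) := by
  simp only [cOps_root_cons, cOps_root_nil, q4_zpow_neg_2]
  grind [q4_pow_24]

theorem root_neg_four : cOps.root [22] = q4 ^ (-4 : ℤ) := by
  simp only [cOps_root_cons, cOps_root_nil, q4_zpow_neg_4]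
  grind [q4_pow_24]

theorem root_sixteen : cOps.root [8] = q4 ^ 16 := by
  simp only [cOps_root_cons, cOps_root_nil]
  ring

theorem root_two : cOps.root [1] = q4 ^ 2 := by
  simp only [cOps_root_cons, cOps_root_nil]
  ring

theorem root_neg_fourteen : cOps.root [17] = q4 ^ (-14 : ℤ) := by
  simp only [cOps_root_cons, cOps_root_nil, q4_zpow_neg_14]
  grind [q4_pow_24]

theorem root_arcs : cOps.root [4, 3, 2, 1] = q4 ^ 17 / (q4 - q4⁻¹) := by
  rw [eq_div_iff q4_sub_inv_ne, q4_inv]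
  simp only [cOps_root_cons, cOps_root_nil]
  grind [q4_pow_24, q4_pow_16]

theorem root_ladder : cOps.root [23, 22, 22, 21] = (1 + qint q4 3) / q4 ^ 4 := by
  rw [qint_q4 3 (cOps.root [1, 0, 23]), eq_div_iff (pow_ne_zero _ q4_ne)]
  · simp only [cOps_root_cons, cOps_root_nil]
    grind [q4_pow_24]
  · rw [q4_zpow_neg 3 (by norm_num), q4_inv]
    simp only [cOps_root_cons, cOps_root_nil]
    grind [q4_pow_24]

theorem root_ladder' : cOps.root [18, 17] = qint q4 2 / q4 ^ 13 := by
  rw [qint_q4 2 (q4 - q4 ^ 23), eq_div_iff (pow_ne_zero _ q4_ne)]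
  · simp only [cOps_root_cons, cOps_root_nil]
    grind [q4_pow_24]
  · rw [q4_zpow_neg 2 (by norm_num), q4_inv]
    grind [q4_pow_24]

theorem root_treeExp (i : Fin 6) (j : Fin 5) : cOps.root (treeExp i j) = pentTree q4 i j := by
  unfold pentTree
  simp only [q4_zpow_neg_2, q4_zpow_neg_4, q4_zpow_neg_6, q4_zpow_neg_8, q4_zpow_neg_10]
  fin_cases i <;> fin_cases j <;> simp [treeExp, cOps_root_cons,
      cOps_root_nil] <;> grind [q4_pow_24]

theorem root_forestExp (i : Fin 6) (j : Fin 5) :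
    cOps.root (forestExp i j) = pentForest q4 i j := by
  unfold pentForest
  simp only [q4_zpow_neg_2, q4_zpow_neg_4, q4_zpow_neg_6, q4_zpow_neg_8, q4_zpow_neg_10]
  fin_cases i <;> fin_cases j <;> simp [forestExp, cOps_root_cons,
      cOps_root_nil] <;> grind [q4_pow_24]

/-! ### The relations of the polygons -/

theorem bigon4_eq {v : Hom Γ₄ 0 3} {W : Fin 6 → Fin 6 → Fin 6 → Fin 6 → ℂ} {z : ℂ}
    (hW : ∀ a b x, gauge4.norm3 v b a x = W a b x (invol x))
    (h : ∀ a b, adj4 a b = true → cOps.gon2 (W a b) a b = z) :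
    bigon triv4 v = z • idm 1 := by
  refine hom_ext_1_1 fun a b hp => ?_
  have hab : Γ₄.adj a b = true := by simpa [IsPathList] using hp.1
  rw [lval_bigon4 v (W a b) hab (hW a b), h a b hab, lval_smul, lval_idm_one,
    if_pos ⟨hab, rfl, rfl⟩, mul_one]

theorem bigon4 : bigon triv4 (bend21 triv4) = (qint q4 7 - 1) • idm 1 :=
  bigon4_eq (W := fun a b x _ => cOps.y b a x) (fun a b x => norm3_triv4 b a x)
    (fun _ _ hab => (bigon_eq hab).trans root_bigon)

theorem decBigon4 (i : Fin 4) (hi : i ≠ 0) :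
    bigon triv4 (dec3 (rotCW proj4) i (bend21 triv4)) = (q4 ^ 2 + 1 + q4 ^ (-2 : ℤ)) • idm 1 := by
  rw [← root_decBigon]
  fin_cases i
  · exact absurd rfl hi
  · exact bigon4_eq (W := fun a b x _ => cOps.dec1 b a (invol a) x)
      (fun a b x => norm3_dec3_one4 b a x) (fun a b hab => decBigon1_eq hab)
  · exact bigon4_eq (W := fun a b x x' => cOps.dec2 b a x x')
      (fun a b x => norm3_dec3_two4 b a x) (fun a b hab => decBigon2_eq hab)
  · exact bigon4_eq (W := fun a b x _ => cOps.dec3 b (invol b) a x)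
      (fun a b x => norm3_dec3_three4 b a x) (fun a b hab => decBigon3_eq hab)

theorem trigon4 : trigon triv4 (bend21 triv4) = (-(q4 ^ 4 + 1 + q4 ^ (-4 : ℤ))) • bend21 triv4 := by
  refine gauge4.ext3 fun a b c hab hbc hca => ?_
  rw [norm3_trigon4 _ (fun x _ => cOps.y x a b) a b c (fun x => norm3_triv4 x a b),
    gauge4.norm3_smul, norm3_triv4, trigon_eq hab hbc hca, cOps_mul, root_trigon]

theorem changeOfBasis4 : dec3 (rotCW proj4) 3 (bend21 triv4) =
    q4 ^ (-4 : ℤ) • bend21 triv4 + q4 ^ 16 • dec3 (rotCCW proj4) 1 (bend21 triv4) := by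
  rw [rotCCW_proj4]
  refine gauge4.ext3 fun a b c hab hbc hca => ?_
  rw [gauge4.norm3_add, gauge4.norm3_smul, gauge4.norm3_smul, norm3_dec3_one4, norm3_dec3_three4,
    norm3_triv4, changeOfBasis_eq hab hbc hca, root_neg_four, root_sixteen]
  rfl

theorem decTriR_eq (v a : ℂ) (x y z : Fin 6) (h : a = cOps.decTriR v x y z) :
    a = -1 * cOps.y x y z + -1 * v := by
  rw [h, Ops.decTriR, root_neg_one]; rfl

theorem decTrigon4 : trigon triv4 (dec3 (rotCW proj4) 2 (bend21 triv4)) =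
    (-1 : ℂ) • bend21 triv4 + (-1 : ℂ) • dec3 (rotCCW proj4) 1 (bend21 triv4) := by
  rw [rotCCW_proj4]
  refine gauge4.ext3 fun a b c hab hbc hca => ?_
  rw [gauge4.norm3_add, gauge4.norm3_smul, gauge4.norm3_smul, norm3_dec3_one4, norm3_triv4,
    norm3_trigon4 _ (fun x _ => cOps.dec2 x a b (invol b)) a b c (fun x => norm3_dec3_two4 x a b)]
  exact decTriR_eq _ _ _ _ _ (decTrigon_eq hab hbc hca)

theorem decTrigon'4 : trigon triv4 (dec3 (rotCW proj4) 1 (bend21 triv4)) =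
    (-1 : ℂ) • bend21 triv4 + (-1 : ℂ) • dec3 (rotCCW proj4) 3 (bend21 triv4) := by
  rw [rotCCW_proj4]
  refine gauge4.ext3 fun a b c hab hbc hca => ?_
  rw [gauge4.norm3_add, gauge4.norm3_smul, gauge4.norm3_smul, norm3_dec3_three4, norm3_triv4,
    norm3_trigon4 _ (fun x _ => cOps.dec1 x a (invol a) b) a b c (fun x => norm3_dec3_one4 x a b)]
  exact decTriR_eq _ _ _ _ _ (decTrigon'_eq hab hbc hca)

theorem decTrigonInner4 : trigon triv4 (dec3 (rotCW proj4) 3 (bend21 triv4)) =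
    (-1 : ℂ) • bend21 triv4 + (-1 : ℂ) • dec3 (rotCCW proj4) 2 (bend21 triv4) := by
  rw [rotCCW_proj4]
  refine gauge4.ext3 fun a b c hab hbc hca => ?_
  rw [gauge4.norm3_add, gauge4.norm3_smul, gauge4.norm3_smul, norm3_dec3_two4, norm3_triv4,
    norm3_trigon4 _ (fun x x' => cOps.dec3 x x' a b) a b c (fun x => norm3_dec3_three4 x a b)]
  exact decTriR_eq _ _ _ _ _ (decTrigonInner_eq hab hbc hca)

theorem tetragon4 : tetragon triv4 (bend21 triv4) =
    (q4 ^ 2 + q4 ^ (-2 : ℤ)) • (treeI triv4 + right4 (treeI triv4)) +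
      (q4 ^ 2 + 1 + q4 ^ (-2 : ℤ)) • (coev ⊠ coev + nest) := by
  refine gauge4.ext4 fun a b c d hab hbc hcd hda => ?_
  rw [norm4_tetragon4 _ (fun x _ => cOps.y x a b) a b c d (fun x => norm3_triv4 x a b),
    tetragon_eq hab hbc hcd hda, Ops.tetR, root_tetragon, root_decBigon]
  simp only [gauge4.norm4_add, gauge4.norm4_smul, gauge4.norm4_right4, norm4_treeI4, norm4_arcs4,
    norm4_nest4, cOps_add, cOps_mul]

theorem decTetragon4 : right4 (tetragon triv4 (dec3 (rotCW proj4) 2 (bend21 triv4))) =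
    q4 ^ 2 • treeI triv4 + q4 ^ 2 • right4 (treeI triv4) +
      (q4 ^ 17 / (q4 - q4⁻¹)) • (coev ⊠ coev) + q4 ^ 2 • nest +
      ((1 + qint q4 3) / q4 ^ 4) • bend22 proj4 + (qint q4 2 / q4 ^ 13) • bend22 (rotCW proj4) +
      q4 ^ (-14 : ℤ) • dec4 (rotCW proj4) 1 (treeI triv4) +
      (qint q4 2 / q4 ^ 13) • dec4 (rotCW proj4) 1 (right4 (treeI triv4)) +
      (-1 : ℂ) • dec4 (rotCW proj4) 2 (right4 (treeI triv4)) := by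
  refine gauge4.ext4 fun a b c d hab hbc hcd hda => ?_
  rw [gauge4.norm4_right4, norm4_tetragon4 _ (fun x _ => cOps.dec2 x b c (invol c)) b c d a
    (fun x => norm3_dec3_two4 x b c), decTetragon_eq hab hbc hcd hda, Ops.decTetR, root_two,
    root_arcs, root_ladder, root_ladder', root_neg_fourteen, root_neg_one]
  simp only [gauge4.norm4_add, gauge4.norm4_smul, gauge4.norm4_right4, norm4_treeI4, norm4_arcs4,
    norm4_nest4, norm4_ladder4, norm4_ladder4', cOps_add, cOps_mul,
    gauge4.norm4_dec4_1 _ lval_rotCW_proj4_of_ne, gauge4.norm4_dec4_2 _ lval_rotCW_proj4_of_ne,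
        red4]
  ring

theorem norm5_tree5_right (a b c d e : Fin 6) (j : Fin 5) :
    gauge4.norm5 (right5^[j] (tree5 triv4)) a b c d e = Ops.rot5 cOps.tree5 a b c d e j := by
  fin_cases j <;>
    simp only [Function.iterate_succ, Function.iterate_zero, Function.comp, id,
      gauge4.norm5_right5, norm5_tree54] <;> rfl

theorem norm5_forest5_right (a b c d e : Fin 6) (j : Fin 5) :
    gauge4.norm5 (right5^[j] (forest5 triv4)) a b c d e = Ops.rot5 cOps.forest5 a b c d e j := by
  fin_cases j <;>
    simp only [Function.iterate_succ, Function.iterate_zero, Function.comp, id,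
      gauge4.norm5_right5, norm5_forest54] <;> rfl

theorem pentagon4 : pentagon triv4 (bend21 triv4) =
    -(∑ j : Fin 5, right5^[j] (tree5 triv4)) - ∑ j : Fin 5, right5^[j] (forest5 triv4) := by
  have h : -(∑ j : Fin 5, right5^[j] (tree5 triv4)) - ∑ j : Fin 5, right5^[j] (forest5 triv4) =
      (-1 : ℂ) • ((∑ j : Fin 5, right5^[j] (tree5 triv4)) +
        ∑ j : Fin 5, right5^[j] (forest5 triv4)) := by
    rw [neg_smul, one_smul, neg_add, sub_eq_add_neg]
  rw [h]
  refine gauge4.ext5 fun a b c d e hab hbc hcd hde hea => ?_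
  rw [norm5_pentagon4 _ (fun x _ => cOps.y x a b) a b c d e (fun x => norm3_triv4 x a b),
    pentagon_eq hab hbc hcd hde hea, Ops.pentR, root_neg_one, gauge4.norm5_smul, gauge4.norm5_add,
    gauge4.norm5_sum, gauge4.norm5_sum, cOps_sum5, cOps_sum5]
  simp only [norm5_tree5_right, norm5_forest5_right, cOps_add, cOps_mul]

theorem mul_pentRow_eq (r : ℂ) (i a b c d e : Fin 6) : r * cOps.pentRow i a b c d e =
    (∑ j : Fin 5, pentTree q4 i j * (r * gauge4.norm5 (right5^[j] (tree5 triv4)) a b c d e)) +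
      ∑ j : Fin 5, pentForest q4 i j *
        (r * gauge4.norm5 (right5^[j] (forest5 triv4)) a b c d e) := by
  rw [Ops.pentRow, cOps_sum5, cOps_sum5, cOps_add, mul_add, Finset.mul_sum, Finset.mul_sum]
  simp only [norm5_tree5_right, norm5_forest5_right, root_treeExp, root_forestExp, cOps_mul]
  congr 1 <;> exact Finset.sum_congr rfl fun j _ => mul_left_comm _ _ _

theorem decPentagon4 : pentagon triv4 (dec3 (rotCW proj4) 2 (bend21 triv4)) =
    (∑ i : Fin 6, ∑ j : Fin 5,
        pentTree q4 i j • dec5 (rotCW proj4) i (right5^[j] (tree5 triv4))) +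
      ∑ i : Fin 6, ∑ j : Fin 5,
        pentForest q4 i j • dec5 (rotCW proj4) i (right5^[j] (forest5 triv4)) := by
  refine gauge4.ext5 fun a b c d e hab hbc hcd hde hea => ?_
  rw [norm5_pentagon4 _ (fun x _ => cOps.dec2 x a b (invol b)) a b c d e
    (fun x => norm3_dec3_two4 x a b), decPentagon_eq hab hbc hcd hde hea, Ops.decPentR,
    gauge4.norm5_add, gauge4.norm5_sum, gauge4.norm5_sum, Fin.sum_univ_six, Fin.sum_univ_six]
  simp only [gauge4.norm5_sum, gauge4.norm5_add, gauge4.norm5_smul,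
    gauge4.norm5_dec5_zero, gauge4.norm5_dec5_1 _ lval_rotCW_proj4_of_ne,
    gauge4.norm5_dec5_2 _ lval_rotCW_proj4_of_ne, gauge4.norm5_dec5_3 _ lval_rotCW_proj4_of_ne,
    gauge4.norm5_dec5_4 _ lval_rotCW_proj4_of_ne, gauge4.norm5_dec5_5 _ lval_rotCW_proj4_of_ne,
    red4, mul_pentRow_eq, cOps_add, cOps_mul]
  rw [← one_mul (cOps.pentRow 0 a b c d e), mul_pentRow_eq]
  simp only [one_mul]
  abel

theorem loop4 : (coev ⨾ ev : Hom Γ₄ 0 0) =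
    (q4 ^ 10 + q4 ^ 8 + q4 ^ 2 + 1 + q4 ^ (-2 : ℤ) + q4 ^ (-8 : ℤ) + q4 ^ (-10 : ℤ)) • idm 0 := by
  have hq : q4 ^ 10 + q4 ^ 8 + q4 ^ 2 + 1 + q4 ^ (-2 : ℤ) + q4 ^ (-8 : ℤ) + q4 ^ (-10 : ℤ) =
      2 + (√2 : ℝ) * (√3 : ℝ) := by
    rw [← root_add_two, ← root_add_three, q4_zpow_neg_2, q4_zpow_neg_8, q4_zpow_neg_10]
    grind [q4_pow_24, q4_pow_16]
  refine hom_ext_0_0 fun a hp => ?_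
  rw [lval_coev_comp _ _ _ (by simp), lval_smul, lval_idm_self hp.1, hq]
  have : ∀ x, lval (ev : Hom Γ₄ 2 0) [a, x, a] [a] = edgeWeight Γ₄ a x := by
    intro x; rw [lval_ev, if_pos ⟨rfl, rfl⟩]
  simp only [this]
  have he : ∀ x, edgeWeight Γ₄ a x = if adj4 a x = true then rt4 x / rt4 a else 0 := by
    intro x
    split_ifs with h
    · exact edgeWeight4 h
    · exact if_neg h
  simp only [he]
  rw [Fin.sum_univ_six]
  fin_cases a <;> simp [adj4, rt4, s4_inv] <;> grind [s4_sq, sqrt_two_sq, sqrt_three_sq]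

theorem d4Relations : D4Relations q4 triv4 proj4 where
  trivalent :=
    { loop := loop4
      lollipop := lollipop4
      rotate := rotate4
      bigon := bigon4
      trigon := trigon4
      tetragon := tetragon4
      pentagon := pentagon4 }
  recouple := recouple4
  reverse := reverse4
  schur0 := schur0_4
  schur1 := schur1_4
  swap := swap4
  decStick := decStick4
  decBigon := decBigon4
  changeOfBasis := changeOfBasis4
  decTrigon := decTrigon4
  decTrigon' := decTrigon'4
  decTrigonInner := decTrigonInner4
  decTetragon := decTetragon4
  decPentagon := decPentagon4

/-! ### The number of nonzero coefficients -/

/-- A sum of powers of `q ^ 2` that vanishes also vanishes modulo the prime `97`, where the residue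
`4` is a primitive `24`-th root of unity: the cyclotomic polynomial of `q ^ 2` divides the polynomial
with these exponents, and it vanishes at `4` modulo `97`. -/
theorem root_eq_zero {l : List ℕ} (h : cOps.root l = 0) :
    (l.map fun k => (4 : ZMod 97) ^ k).sum = 0 := by
  have h24 : ((24 : ℕ) : ZMod 97) ≠ 0 := by decide
  have h4 : IsPrimitiveRoot (4 : ZMod 97) 24 :=
    .mk_of_lt _ (by norm_num) (by decide) fun l h0 h1 => by interval_cases l <;> decide
  have : Fact (Nat.Prime 97) := ⟨by norm_num⟩
  have : NeZero ((24 : ℕ) : ZMod 97) := ⟨h24⟩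
  have hq : IsPrimitiveRoot (q4 ^ 2) 24 := by
    have h := Complex.isPrimitiveRoot_exp 24 (by norm_num)
    have e : q4 ^ 2 = Complex.exp (2 * Real.pi * Complex.I / (24 : ℕ)) := by
      rw [q4, ← Complex.exp_nat_mul]; congr 1; push_cast; ring
    rwa [e]
  let p : Polynomial ℤ := (l.map fun k => Polynomial.X ^ k).sum
  have hp : ∀ {R : Type} [CommRing R] (x : R), Polynomial.aeval x p = (l.map fun k => x ^ k).sum := by
    intro R _ x
    simp [p, map_list_sum, Function.comp_def]
  have hd : Polynomial.cyclotomic 24 ℤ ∣ p := by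
    rw [Polynomial.cyclotomic_eq_minpoly hq (by norm_num)]
    exact minpoly.isIntegrallyClosed_dvd (hq.isIntegral (by norm_num)) ((hp _).trans h)
  obtain ⟨r, hr⟩ := hd
  have h0 : Polynomial.aeval (4 : ZMod 97) (Polynomial.cyclotomic 24 ℤ) = 0 := by
    have := Polynomial.isRoot_cyclotomic_iff.2 h4
    rw [Polynomial.IsRoot, ← Polynomial.map_cyclotomic_int, Polynomial.eval_map] at this
    exact this
  rw [← hp, hr, map_mul, h0, zero_mul]

theorem root_ne_zero_iff {e : Fin 6 → Fin 5 → List ℕ}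
    (he : ∀ i j, e i j = [] ∨ ((e i j).map fun k => (4 : ZMod 97) ^ k).sum ≠ 0) (i : Fin 6)
    (j : Fin 5) : cOps.root (e i j) ≠ 0 ↔ e i j ≠ [] := by
  refine ⟨fun h h' => h (by rw [h', cOps_root_nil]), fun h h' => ?_⟩
  exact (he i j).elim h fun h1 => h1 (root_eq_zero h')

theorem ncard_pentTree : {p : Fin 6 × Fin 5 | pentTree q4 p.1 p.2 ≠ 0}.ncard = 20 := by
  have h : {p : Fin 6 × Fin 5 | pentTree q4 p.1 p.2 ≠ 0} =
      ((Finset.univ.filter fun p : Fin 6 × Fin 5 => treeExp p.1 p.2 ≠ [] : Finset _) : Set _) := by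
    ext p
    simp only [Set.mem_ofPred_eq, Finset.coe_filter, Finset.mem_univ, true_and]
    rw [← root_treeExp, root_ne_zero_iff (by decide)]
  rw [h, Set.ncard_coe_finset]
  decide

theorem ncard_pentForest : {p : Fin 6 × Fin 5 | pentForest q4 p.1 p.2 ≠ 0}.ncard = 24 := by
  have h : {p : Fin 6 × Fin 5 | pentForest q4 p.1 p.2 ≠ 0} =
      ((Finset.univ.filter fun p : Fin 6 × Fin 5 => forestExp p.1 p.2 ≠ [] : Finset _) : Set _) := by
    ext p
    simp only [Set.mem_ofPred_eq, Finset.coe_filter, Finset.mem_univ, true_and]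
    rw [← root_forestExp, root_ne_zero_iff (by decide)]
  rw [h, Set.ncard_coe_finset]
  decide

end GPA

end

theorem mainTheorem5 :
    GPA.D4Relations GPA.q4 GPA.triv4 GPA.proj4 ∧
      {p : Fin 6 × Fin 5 | GPA.pentTree GPA.q4 p.1 p.2 ≠ 0}.ncard +
        {p : Fin 6 × Fin 5 | GPA.pentForest GPA.q4 p.1 p.2 ≠ 0}.ncard = 44 := by
  refine ⟨GPA.d4Relations, ?_⟩
  rw [GPA.ncard_pentTree, GPA.ncard_pentForest]
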